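/- Setting. Let $0<c<1$, let $0<\underline v\le\overline v$ and let $C>0$. Let $\mathcal V$ be the set of functions $v:[0,1]\to\mathbb R$ with $\underline v\le v\le\overline v$ on $[0,1]$ that are infinitely differentiable on $(0,1)$ with $|v^{(\ell)}(y)/(\ell+1)!|<C$ for all $y\in(0,1)$ and $\ell\ge1$. A customer who is offered $S\subseteq[0,1]$ makes a random choice $X^S\in[0,1]\cup\{\emptyset\}$ with $P(X^S\in A)=\int_A v/(1+\int_S v)$ for Borel $A\subseteq S$ and $P(X^S=\emptyset)=1/(1+\int_S v)$. Let $N=\lceil 1/c\rceil$ and, for $i=1,\dots,N$, let $S^i=[a_i,b_i]$ with $a_i=\frac{i-1}{N-1}(1-c)$ and $b_i=a_i+c$. Each $S^i$ is offered to $M\in\mathbb N$ customers, and the $NM$ choices are independent. Let $|E_i|$ be the number of no-purchases among the customers who are offered $S^i$, and let $A_i$ be the family (with multiplicity) of the products bought by them, so that $|A_i|=M-|E_i|$. Put $\alpha_i=\int_{S^i}v$, $f_i=v/\alpha_i$ on $S^i$, $p_i=1/(1+\alpha_i)$, $\epsilon_i=\frac12\min\{p_i,1-p_i\}$ and $M_i=\max\{\frac1{p_i},\frac7{1-p_i}\}$.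 The clean event is $\mathcal E=\{\,|E_i|/M\in(p_i-\epsilon_i,p_i+\epsilon_i)\text{ for all }i\,\}$. Estimators. Let $h=\min\{c/2,1/e\}$, and let $\ell_i$ be the integer nearest to $\frac12\log(-2|A_i|\log h)-\frac12$ (on the clean event, when $M\ge M_i$, one has $|A_i|\ge 4$ and $\ell_i\ge1$). Let $\varphi_j(x)=\sqrt{\frac{2j+1}2}\,\frac1{2^jj!}\frac{d^j}{dx^j}(x^2-1)^j$. For $x\in S^i$ let $I^i_x=[-\min\{1,\frac{x-a_i}h\},\min\{1,\frac{b_i-x}h\}]$, let $(\gamma^i_x,\zeta^i_x)$ be $(\frac{2h}{h+x-a_i},-\frac{h-(x-a_i)}{h+x-a_i})$ if $x<a_i+h$, $(1,0)$ if $a_i+h\le x\le b_i-h$, and $(\frac{2h}{h+b_i-x},\frac{h-(b_i-x)}{h+b_i-x})$ if $x>b_i-h$, and let $K^i_x(u)=\gamma^i_x\sum_{j=0}^{\ell_i}\varphi_j(\zeta^i_x)\varphi_j(\gamma^i_xu+\zeta^i_x)$ for $u\in I^i_x$ and $K^i_x(u)=0$ otherwise. Put $$\hat\alpha_i=\frac{|A_i|}{|E_i|+1},\qquad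 \hat f_i(x)=\frac1{|A_i|h}\sum_{X\in A_i}K^i_x\Big(\frac{X-x}h\Big)\quad(x\in S^i),$$ $\hat v_i(x)=\frac1{(|E_i|+1)h}\sum_{X\in A_i}K^i_x(\frac{X-x}h)$ for $x\in S^i$ and $\hat v_i(x)=0$ for $x\notin S^i$, and $\hat v(x)=\frac1{k(x)}\sum_{i=1}^N\hat v_i(x)$ for $x\in[0,1]$, where $k(x)$ is the number of the sets $S^i$ that contain $x$. Proposition. There are positive constants $C_1,C_2,C_3$ that depend only on $c,\underline v,\overline v,C$ such that the following holds for all $v\in\mathcal V$ and all $M$. For every $i$ with $M\ge M_i$ (a conditional bound being void if $P(\mathcal E)=0$), $$E\big[|\alpha_i-\hat\alpha_i|\,\big|\,\mathcal E\big]\le C_1\frac1{\sqrt M},\qquad E\Big[\int_{S^i}\big(f_i(x)-\hat f_i(x)\big)^2dx\,\Big|\,\mathcal E\Big]\le C_2\frac{\log M}M.$$ If $M\ge\max_iM_i$, then $P(\mathcal E)>0$ and $$E\Big[\int_0^1|v(x)-\hat v(x)|\,dx\,\Big|\,\mathcal E\Big]\le C_3\frac{(\log M)^{1/2}}{M^{1/2}}.$$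 -/

import Mathlib

open MeasureTheory ProbabilityTheory Set

noncomputable section

namespace KDEP

/-- The outcome of one customer visit: `Sum.inl x` is the purchase of product `x`,
`Sum.inr ()` is a no-purchase. -/
abbrev Outcome : Type := ℝ ⊕ Unit

/-- The preference functions under consideration: `lo ≤ v ≤ hi` on `[0,1]`, and `v` is smooth on
`(0,1)` with `|v⁽ˡ⁾(y) / (l+1)!| < B` for all `y ∈ (0,1)` and all `l ≥ 1`. -/
structure IsPreference (lo hi B : ℝ) (v : ℝ → ℝ) : Prop where
  bounds : ∀ y ∈ Icc (0 : ℝ) 1, lo ≤ v y ∧ v y ≤ hi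
  smooth : ContDiffOn ℝ (⊤ : ℕ∞) v (Ioo (0 : ℝ) 1)
  deriv_lt : ∀ l : ℕ, 1 ≤ l → ∀ y ∈ Ioo (0 : ℝ) 1,
    |iteratedDeriv l v y / ((l + 1).factorial : ℝ)| < B

/-- Preference mass `∫_S v` of an assortment `S`. -/
def mass (v : ℝ → ℝ) (S : Set ℝ) : ℝ := ∫ x in S, v x

/-- The law of the choice of a customer who is offered `S`: for Borel `A ⊆ S` a product from `A`
is bought with probability `∫_A v / (1 + ∫_S v)`, and nothing is bought with probability
`1 / (1 + ∫_S v)`. -/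
def choiceLaw (v : ℝ → ℝ) (S : Set ℝ) : Measure Outcome :=
  ENNReal.ofReal (1 / (1 + mass v S)) •
    (((volume.restrict S).withDensity fun x => ENNReal.ofReal (v x)).map Sum.inl
      + Measure.dirac (Sum.inr ()))

/-- No-purchase probability when `S` is offered. -/
def noPurchaseProb (v : ℝ → ℝ) (S : Set ℝ) : ℝ := 1 / (1 + mass v S)

/-! ### Test assortments and exploration data -/

/-- The number `N = ⌈1/c⌉` of test assortments. -/
def numTests (c : ℝ) : ℕ := ⌈1 / c⌉₊

/-- Left end point of a test assortment; the index runs from `0` to `N - 1`. -/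
def leftEnd (c : ℝ) (i : Fin (numTests c)) : ℝ :=
  ((i : ℕ) : ℝ) / ((numTests c : ℝ) - 1) * (1 - c)

/-- Right end point of a test assortment. -/
def rightEnd (c : ℝ) (i : Fin (numTests c)) : ℝ := leftEnd c i + c

/-- The test assortment with index `i`. -/
def testAssortment (c : ℝ) (i : Fin (numTests c)) : Set ℝ := Icc (leftEnd c i) (rightEnd c i)

/-- The observations of the exploration phase, in which each of the `N` test assortments is
offered to `M` customers: `X i m` is the choice of customer `m` among those who are offered the
test assortment `i` (the customer of period `i * M + m + 1`). The choices are independent. -/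
structure IsExploration {Ω : Type*} [MeasurableSpace Ω] (μ : Measure Ω) (c : ℝ) (v : ℝ → ℝ)
    (M : ℕ) (X : Fin (numTests c) → Fin M → Ω → Outcome) : Prop where
  measurable : ∀ i m, Measurable (X i m)
  law : ∀ i m, μ.map (X i m) = choiceLaw v (testAssortment c i)
  indep : iIndepFun (fun q : Fin (numTests c) × Fin M => X q.1 q.2) μ

/-- The number `|E_i|` of no-purchases in the data `d` of one test assortment. -/
def numNone {M : ℕ} (d : Fin M → Outcome) : ℕ :=
  (Finset.univ.filter fun m => (d m).isRight = true).card

/-- The number `|A_i|` of purchases in the data `d` of one test assortment. -/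
def numSold {M : ℕ} (d : Fin M → Outcome) : ℕ :=
  (Finset.univ.filter fun m => (d m).isLeft = true).card

/-- The sum of `g` over the purchased products in the data `d`, with multiplicity. -/
def sumSold {M : ℕ} (d : Fin M → Outcome) (g : ℝ → ℝ) : ℝ :=
  ∑ m, Sum.elim g (fun _ => (0 : ℝ)) (d m)

/-! ### Legendre kernel -/

/-- The orthonormal Legendre polynomials on `[-1,1]`, by Rodrigues' formula. -/
def legendre (j : ℕ) (x : ℝ) : ℝ :=
  √((2 * (j : ℝ) + 1) / 2) * (1 / (2 ^ j * (j.factorial : ℝ))) *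
    iteratedDeriv j (fun y : ℝ => (y ^ 2 - 1) ^ j) x

/-- Shifted support at the point `x` of `[a,b]`, with bandwidth `h`. -/
def shiftedSupport (h a b x : ℝ) : Set ℝ :=
  Icc (-min 1 ((x - a) / h)) (min 1 ((b - x) / h))

/-- The shift coefficient `γ`. -/
def gammaCoeff (h a b x : ℝ) : ℝ :=
  if x < a + h then 2 * h / (h + x - a)
  else if x ≤ b - h then 1
  else 2 * h / (h + b - x)

/-- The shift coefficient `ζ`. -/
def zetaCoeff (h a b x : ℝ) : ℝ :=
  if x < a + h then -((h - (x - a)) / (h + x - a))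
  else if x ≤ b - h then 0
  else (h - (b - x)) / (h + b - x)

open Classical in
/-- The Legendre kernel of order `l` for `[a,b]`, at the point `x ∈ [a,b]`. -/
def kernel (h : ℝ) (l : ℕ) (a b x u : ℝ) : ℝ :=
  if u ∈ shiftedSupport h a b x then
    gammaCoeff h a b x * ∑ j ∈ Finset.range (l + 1),
      legendre j (zetaCoeff h a b x) *
        legendre j (gammaCoeff h a b x * u + zetaCoeff h a b x)
  else 0

/-! ### Estimators -/

/-- The bandwidth `min {c/2, 1/e}`. -/
def bandwidth (c : ℝ) : ℝ := min (c / 2) (1 / Real.exp 1)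

/-- The order of the kernel for `n` purchases: the integer nearest to
`log (-2 n log h) / 2 - 1 / 2`, where `h` is the bandwidth. -/
def order (c : ℝ) (n : ℕ) : ℕ :=
  (round (1 / 2 * Real.log (-2 * (n : ℝ) * Real.log (bandwidth c)) - 1 / 2)).toNat

/-- The kernel for the test assortment `i`; its order is determined by the number of purchases in
the data `d` of that assortment. -/
def dataKernel (c : ℝ) (i : Fin (numTests c)) {M : ℕ} (d : Fin M → Outcome) (x u : ℝ) : ℝ :=
  kernel (bandwidth c) (order c (numSold d)) (leftEnd c i) (rightEnd c i) x u

/-- The estimate of the preference mass of a test assortment. -/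
def alphaHat {M : ℕ} (d : Fin M → Outcome) : ℝ := (numSold d : ℝ) / ((numNone d : ℝ) + 1)

/-- The estimate of the normalized density of the test assortment `i`, at `x` in it. -/
def fHat (c : ℝ) (i : Fin (numTests c)) {M : ℕ} (d : Fin M → Outcome) (x : ℝ) : ℝ :=
  1 / ((numSold d : ℝ) * bandwidth c) *
    sumSold d fun y => dataKernel c i d x ((y - x) / bandwidth c)

/-- The normalized density `f_i = v / ∫_{S^i} v`. -/
def density (v : ℝ → ℝ) (c : ℝ) (i : Fin (numTests c)) (x : ℝ) : ℝ :=
  v x / mass v (testAssortment c i)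

open Classical in
/-- The estimate of `v` on the test assortment `i`, extended by zero. -/
def vHatPart (c : ℝ) (i : Fin (numTests c)) {M : ℕ} (d : Fin M → Outcome) (x : ℝ) : ℝ :=
  if x ∈ testAssortment c i then
    1 / (((numNone d : ℝ) + 1) * bandwidth c) *
      sumSold d fun y => dataKernel c i d x ((y - x) / bandwidth c)
  else 0

open Classical in
/-- The number of test assortments that contain `x`. -/
def cover (c x : ℝ) : ℕ := (Finset.univ.filter fun i => x ∈ testAssortment c i).card

/-- The estimate of `v` on `[0,1]` from the data `D` of all test assortments. -/
def vHat (c : ℝ) {M : ℕ} (D : Fin (numTests c) → Fin M → Outcome) (x : ℝ) : ℝ :=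
  1 / (cover c x : ℝ) * ∑ i, vHatPart c i (D i) x

/-! ### Clean event and sample size -/

/-- The no-purchase probability `p_i` of the test assortment `i`. -/
def p (v : ℝ → ℝ) (c : ℝ) (i : Fin (numTests c)) : ℝ := noPurchaseProb v (testAssortment c i)

/-- `ε_i = min {p_i, 1 - p_i} / 2`. -/
def eps (v : ℝ → ℝ) (c : ℝ) (i : Fin (numTests c)) : ℝ := 1 / 2 * min (p v c i) (1 - p v c i)

/-- The clean event. -/
def cleanEvent {Ω : Type*} (v : ℝ → ℝ) (c : ℝ) {M : ℕ}
    (X : Fin (numTests c) → Fin M → Ω → Outcome) : Set Ω :=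
  {ω | ∀ i, (numNone (fun m => X i m ω) : ℝ) / (M : ℝ) ∈
    Ioo (p v c i - eps v c i) (p v c i + eps v c i)}

/-- `M_i = max {1 / p_i, 7 / (1 - p_i)}`. -/
def minSize (v : ℝ → ℝ) (c : ℝ) (i : Fin (numTests c)) : ℝ :=
  max (1 / p v c i) (7 / (1 - p v c i))

end KDEP

end

/-! Everything is done conditionally on the pattern of which customers buy. The clean event is a
union of patterns (`cleanEvent_eq`). Given a pattern, the counts and the kernel orders are
constants, and the products bought from one test assortment are independent with density `f_i`
(`map_product_cond`, `iIndepFun_cond`). So `fHat` is an average of `n` i.i.d. terms, and its squared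
error splits into variance over `n` plus squared bias.

Up to an affine change of variable, the kernel at `x` is the reproducing kernel `K` of the
polynomials of degree at most `l` on `[-1,1]`, carried to the window `[x-h,x+h] ∩ [a,b]`
(`scaledKernel_eq`). Reproduction reduces the bias to the distance from `f_i` to polynomials on the
window. Chebyshev interpolation makes this distance at most a constant times `(l+2)(h/2)^(l+1)`, and
it is amplified by the `L¹` norm of the kernel, whose square is at most `2 K(ζ,ζ)`. The variance is
at most a constant times `K(ζ,ζ)`. Integrated over `x`, `K(ζ,ζ)` contributes `O(l+1)`: near the ends
of the assortment `ζ` sweeps half of `[-1,1]` and the trace of `K` is `l+1`, while in the middle `ζ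
= 0` and each `φ_j(0)²` is at most `1`. The order is about half of `log n`, which makes the squared
bias bound `O(1/n)` and `l+1 = O(log M)`. On the clean event `n` is at least a constant times `M`,
whence the rate `log M / M` (`densityBound_le`).

The mass is a smooth function of the no-purchase probability, so its estimate inherits the `1/√M`
fluctuation of the empirical rate. Conditioning on the clean event costs a factor two once that
event has probability at least one half; for smaller `M` a deterministic bound suffices. Finally `v
= α f` and the partial estimate of `v` is the product of the two estimates (`vHatPart_eq`), so the
error for `v` follows from the other two, using Young's inequality to pass from squared to absolute
errors. -/

namespace KDEP

open Polynomial

/-! ### Legendre polynomials -/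

/-- Iterated derivatives of polynomial functions are polynomial functions. -/
theorem iteratedDeriv_polynomial (q : ℝ[X]) (k : ℕ) (x : ℝ) :
    iteratedDeriv k (fun y => q.eval y) x = (derivative^[k] q).eval x := by
  induction k generalizing x with
  | zero => simp
  | succ k ih =>
    rw [iteratedDeriv_succ, funext ih, Function.iterate_succ_apply']
    exact Polynomial.deriv _

/-- The unnormalized Legendre polynomial `dʲ/dxʲ (x² - 1)ʲ`. -/
noncomputable def rodrigues (j : ℕ) : ℝ[X] := derivative^[j] ((X ^ 2 - 1) ^ j)

/-- The normalizing factor of the Legendre polynomial of degree `j`. -/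
noncomputable def legendreFactor (j : ℕ) : ℝ :=
  √((2 * (j : ℝ) + 1) / 2) * (1 / (2 ^ j * (j.factorial : ℝ)))

theorem legendre_eq (j : ℕ) (x : ℝ) : legendre j x = legendreFactor j * (rodrigues j).eval x := by
  have h : (fun y : ℝ => (y ^ 2 - 1) ^ j) = fun y => ((X ^ 2 - 1 : ℝ[X]) ^ j).eval y := by
    ext y; simp
  rw [legendre, h, iteratedDeriv_polynomial, legendreFactor, rodrigues]

theorem legendreFactor_sq (j : ℕ) :
    legendreFactor j ^ 2 = (2 * (j : ℝ) + 1) / 2 / (4 ^ j * (j.factorial : ℝ) ^ 2) := by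
  have h : (0 : ℝ) ≤ (2 * (j : ℝ) + 1) / 2 := by positivity
  have h4 : (4 : ℝ) ^ j = (2 ^ j) ^ 2 := by rw [← pow_mul, mul_comm, pow_mul]; norm_num
  rw [legendreFactor, mul_pow, Real.sq_sqrt h, h4]
  field_simp

theorem legendreFactor_pos (j : ℕ) : 0 < legendreFactor j := by
  unfold legendreFactor; positivity

theorem continuous_legendre (j : ℕ) : Continuous (legendre j) := by
  have : legendre j = fun x => legendreFactor j * (rodrigues j).eval x := funext (legendre_eq j)
  rw [this]; fun_prop

theorem integral_mul_derivative (p q : ℝ[X]) (h1 : p.eval 1 = 0) (h2 : p.eval (-1) = 0) :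
    ∫ t in (-1 : ℝ)..1, (derivative p).eval t * q.eval t =
      -∫ t in (-1 : ℝ)..1, p.eval t * (derivative q).eval t := by
  have := intervalIntegral.integral_deriv_mul_eq_sub (a := -1) (b := 1)
    (u := fun t => p.eval t) (v := fun t => q.eval t)
    (u' := fun t => (derivative p).eval t) (v' := fun t => (derivative q).eval t)
    (fun t _ => p.hasDerivAt t) (fun t _ => q.hasDerivAt t)
    ((derivative p).continuous.intervalIntegrable _ _)
    ((derivative q).continuous.intervalIntegrable _ _)
  rw [intervalIntegral.integral_add ((by fun_prop : Continuous fun t =>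
      (derivative p).eval t * q.eval t).intervalIntegrable _ _)
      ((by fun_prop : Continuous fun t =>
      p.eval t * (derivative q).eval t).intervalIntegrable _ _), h1, h2] at this
  linarith

/-- Fewer than `j` derivatives leave a factor `X ^ 2 - 1`. This kills the boundary terms when
integrating by parts. -/
theorem eval_iterate_derivative_sq_sub_one {j k : ℕ} (hk : k < j) {x : ℝ} (hx : x ^ 2 = 1) :
    (derivative^[k] ((X ^ 2 - 1 : ℝ[X]) ^ j)).eval x = 0 := by
  obtain ⟨r, hr⟩ := pow_sub_dvd_iterate_derivative_pow (X ^ 2 - 1 : ℝ[X]) j k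
  rw [hr]
  simp [hx, Nat.sub_ne_zero_of_lt hk]

theorem integral_iterate_derivative_mul (j k : ℕ) (hk : k ≤ j) (q : ℝ[X]) :
    ∫ t in (-1 : ℝ)..1, (derivative^[k] ((X ^ 2 - 1 : ℝ[X]) ^ j)).eval t * q.eval t =
      (-1) ^ k * ∫ t in (-1 : ℝ)..1, ((X ^ 2 - 1 : ℝ[X]) ^ j).eval t *
        (derivative^[k] q).eval t := by
  induction k generalizing q with
  | zero => simp
  | succ k ih =>
    rw [Function.iterate_succ_apply', integral_mul_derivative _ _
      (eval_iterate_derivative_sq_sub_one hk (by norm_num))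
      (eval_iterate_derivative_sq_sub_one hk (by norm_num)), ih (by omega),
      ← Function.iterate_succ_apply, pow_succ]
    ring

theorem natDegree_sq_sub_one_pow (j : ℕ) : ((X ^ 2 - 1 : ℝ[X]) ^ j).natDegree = 2 * j := by
  have h : (X ^ 2 - 1 : ℝ[X]).natDegree = 2 := by
    simpa using natDegree_X_pow_sub_C (n := 2) (r := (1 : ℝ))
  rw [natDegree_pow, h, mul_comm]

theorem monic_sq_sub_one_pow (j : ℕ) : ((X ^ 2 - 1 : ℝ[X]) ^ j).Monic := by
  have h : (X ^ 2 - 1 : ℝ[X]).Monic := by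
    simpa using monic_X_pow_sub_C (1 : ℝ) (n := 2) (by norm_num)
  exact h.pow j

theorem natDegree_rodrigues_le (j : ℕ) : (rodrigues j).natDegree ≤ j := by
  have := natDegree_iterate_derivative ((X ^ 2 - 1 : ℝ[X]) ^ j) j
  rw [natDegree_sq_sub_one_pow] at this
  rw [rodrigues]; omega

/-- The degree is exactly `j`, so these polynomials form a triangular basis. -/
theorem coeff_rodrigues_self_ne_zero (j : ℕ) : (rodrigues j).coeff j ≠ 0 := by
  have h1 : ((X ^ 2 - 1 : ℝ[X]) ^ j).coeff (j + j) = 1 := by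
    have := monic_sq_sub_one_pow j
    rw [Monic, leadingCoeff, natDegree_sq_sub_one_pow] at this
    rwa [← two_mul]
  rw [rodrigues, coeff_iterate_derivative, h1, nsmul_eq_mul, mul_one, Nat.cast_ne_zero]
  exact (Nat.descFactorial_pos.2 (by omega)).ne'

/-- Legendre polynomials are orthogonal to polynomials of smaller degree. -/
theorem integral_rodrigues_mul_eq_zero {j : ℕ} {q : ℝ[X]} (hq : q.natDegree < j) :
    ∫ t in (-1 : ℝ)..1, (rodrigues j).eval t * q.eval t = 0 := by
  rw [rodrigues, integral_iterate_derivative_mul j j le_rfl, iterate_derivative_eq_zero hq]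
  simp

theorem integral_one_sub_sq_pow (j : ℕ) :
    ∫ t in (-1 : ℝ)..1, (1 - t ^ 2) ^ j =
      2 * 4 ^ j * (j.factorial : ℝ) ^ 2 / ((2 * j + 1).factorial : ℝ) := by
  induction j with
  | zero => norm_num
  | succ j ih =>
    -- This antiderivative vanishes at both ends, so integrating its derivative gives `(2j+3)
    -- I_{j+1} = (2j+2) I_j`.
    have hd : ∀ t : ℝ, HasDerivAt (fun t : ℝ => t * (1 - t ^ 2) ^ (j + 1))
        ((2 * j + 3) * (1 - t ^ 2) ^ (j + 1) - (2 * j + 2) * (1 - t ^ 2) ^ j) t := by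
      intro t
      have h := (hasDerivAt_id t).mul ((((hasDerivAt_id t).pow 2).const_sub 1).pow (j + 1))
      refine h.congr_deriv ?_
      simp
      ring
    have hint := intervalIntegral.integral_eq_sub_of_hasDerivAt (a := -1) (b := 1)
      (fun t _ => hd t) ((by fun_prop : Continuous fun t : ℝ =>
        (2 * (j : ℝ) + 3) * (1 - t ^ 2) ^ (j + 1) - (2 * j + 2) * (1 - t ^ 2) ^ j
        ).intervalIntegrable _ _)
    rw [intervalIntegral.integral_sub ((by fun_prop : Continuous fun t : ℝ =>
        (2 * (j : ℝ) + 3) * (1 - t ^ 2) ^ (j + 1)).intervalIntegrable _ _)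
        ((by fun_prop : Continuous fun t : ℝ =>
        (2 * (j : ℝ) + 2) * (1 - t ^ 2) ^ j).intervalIntegrable _ _),
      intervalIntegral.integral_const_mul, intervalIntegral.integral_const_mul, ih] at hint
    simp only [one_pow, sub_self, ne_eq, Nat.add_eq_zero_iff, one_ne_zero, and_false,
      not_false_eq_true, zero_pow, mul_zero, even_two, Even.neg_pow] at hint
    have h3 : ((2 * (j + 1) + 1).factorial : ℝ) =
        (2 * j + 3) * ((2 * j + 2) * ((2 * j + 1).factorial : ℝ)) := by
      have : 2 * (j + 1) + 1 = (2 * j + 1) + 1 + 1 := by ring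
      rw [this, Nat.factorial_succ, Nat.factorial_succ]
      push_cast; ring
    have hf : ((2 * j + 1).factorial : ℝ) ≠ 0 := by positivity
    have hI : ∫ t in (-1 : ℝ)..1, (1 - t ^ 2) ^ (j + 1) = (2 * j + 2) *
        (2 * 4 ^ j * (j.factorial : ℝ) ^ 2 / ((2 * j + 1).factorial : ℝ)) / (2 * j + 3) := by
      rw [eq_div_iff (by positivity)]
      linarith
    rw [hI, h3, Nat.factorial_succ j]
    push_cast
    field_simp
    ring

/-- After `j` integrations by parts one factor carries the `2j`-th derivative of a monic polynomial
of degree `2j`, the constant `(2j)!`; a Beta integral remains. -/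
theorem integral_rodrigues_sq (j : ℕ) :
    legendreFactor j ^ 2 * ∫ t in (-1 : ℝ)..1, (rodrigues j).eval t * (rodrigues j).eval t = 1 := by
  have h1 : derivative^[j] (rodrigues j) = C ((2 * j).factorial : ℝ) := by
    rw [rodrigues, ← Function.iterate_add_apply]
    have h0 : (derivative^[j + j] ((X ^ 2 - 1 : ℝ[X]) ^ j)).natDegree = 0 := by
      have := natDegree_iterate_derivative ((X ^ 2 - 1 : ℝ[X]) ^ j) (j + j)
      rw [natDegree_sq_sub_one_pow] at this
      omega
    rw [eq_C_of_natDegree_eq_zero h0, coeff_iterate_derivative, zero_add, ← two_mul]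
    have := monic_sq_sub_one_pow j
    rw [Monic, leadingCoeff, natDegree_sq_sub_one_pow] at this
    rw [this, Nat.descFactorial_self]
    simp
  have h2 : ∫ t in (-1 : ℝ)..1, (rodrigues j).eval t * (rodrigues j).eval t =
      ((2 * j).factorial : ℝ) * ∫ t in (-1 : ℝ)..1, (1 - t ^ 2) ^ j := by
    conv_lhs => rw [rodrigues]
    rw [integral_iterate_derivative_mul j j le_rfl, ← rodrigues, h1,
      ← intervalIntegral.integral_const_mul, ← intervalIntegral.integral_const_mul]
    congr 1
    ext t
    have : (1 - t ^ 2) ^ j = (-1) ^ j * (t ^ 2 - 1) ^ j := by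
      rw [← mul_pow]; ring
    rw [this]
    simp
    ring
  rw [h2, integral_one_sub_sq_pow, legendreFactor_sq, Nat.factorial_succ]
  push_cast
  field_simp

theorem integral_rodrigues_mul_rodrigues {i j : ℕ} (hij : i ≠ j) :
    ∫ t in (-1 : ℝ)..1, (rodrigues i).eval t * (rodrigues j).eval t = 0 := by
  rcases lt_or_gt_of_ne hij with h | h
  · simp_rw [mul_comm ((rodrigues i).eval _)]
    exact integral_rodrigues_mul_eq_zero ((natDegree_rodrigues_le i).trans_lt h)
  · exact integral_rodrigues_mul_eq_zero ((natDegree_rodrigues_le j).trans_lt h)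

/-- The Legendre polynomials are orthonormal on `[-1,1]`. -/
theorem integral_legendre_mul_legendre (i j : ℕ) :
    ∫ t in (-1 : ℝ)..1, legendre i t * legendre j t = if i = j then 1 else 0 := by
  have : ∀ t, legendre i t * legendre j t = legendreFactor i * legendreFactor j *
      ((rodrigues i).eval t * (rodrigues j).eval t) := by
    intro t; rw [legendre_eq, legendre_eq]; ring
  simp_rw [this]
  rw [intervalIntegral.integral_const_mul]
  split_ifs with h
  · subst h; rw [← sq]; exact integral_rodrigues_sq i
  · rw [integral_rodrigues_mul_rodrigues h, mul_zero]

/-- A polynomial of degree at most `l` is a combination of Legendre polynomials of degree at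
most `l`. -/
theorem exists_eq_sum_legendre (n : ℕ) (q : ℝ[X]) (hq : q.degree < n) :
    ∃ a : ℕ → ℝ, ∀ x, q.eval x = ∑ j ∈ Finset.range n, a j * legendre j x := by
  induction n generalizing q with
  | zero =>
    have : q = 0 := by simpa using hq
    exact ⟨0, by simp [this]⟩
  | succ n ih =>
    -- Subtracting this multiple cancels the coefficient of degree `n`, so the induction hypothesis
    -- applies to the rest.
    set b := q.coeff n / (rodrigues n).coeff n with hb
    have hdeg : (q - C b * rodrigues n).degree < n := by
      rw [degree_lt_iff_coeff_zero]
      intro m hm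
      rcases hm.eq_or_lt with rfl | hm
      · rw [coeff_sub, coeff_C_mul, hb, div_mul_cancel₀ _ (coeff_rodrigues_self_ne_zero _),
          sub_self]
      · rw [coeff_sub, coeff_C_mul, coeff_eq_zero_of_natDegree_lt
          ((natDegree_rodrigues_le n).trans_lt hm), mul_zero, sub_zero]
        exact (degree_lt_iff_coeff_zero _ _).1 hq m hm
    obtain ⟨a, ha⟩ := ih _ hdeg
    refine ⟨fun j => if j = n then b / legendreFactor n else a j, fun x => ?_⟩
    simp only [Finset.sum_range_succ, if_true]
    rw [legendre_eq n, ← mul_assoc,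
      div_mul_cancel₀ _ (legendreFactor_pos n).ne']
    have h2 : q.eval x = (q - C b * rodrigues n).eval x + b * (rodrigues n).eval x := by simp
    rw [h2, ha]
    congr 1
    refine Finset.sum_congr rfl fun j hj => ?_
    rw [if_neg (Finset.mem_range.1 hj).ne]

theorem integral_sum_const_mul (s : Finset ℕ) (a : ℕ → ℝ) (g : ℕ → ℝ → ℝ)
    (hg : ∀ j, Continuous (g j)) (p q : ℝ) :
    ∫ t in p..q, ∑ j ∈ s, a j * g j t = ∑ j ∈ s, a j * ∫ t in p..q, g j t := by
  rw [intervalIntegral.integral_finsetSum fun j _ =>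
    (by have := hg j; fun_prop : Continuous fun t => a j * g j t).intervalIntegrable _ _]
  simp_rw [intervalIntegral.integral_const_mul]

/-! ### Reproducing kernel of the polynomials of bounded degree -/

/-- The Christoffel-Darboux kernel `∑_{j ≤ l} φ_j(s) φ_j(t)`. -/
noncomputable def legendreKernel (l : ℕ) (s t : ℝ) : ℝ :=
  ∑ j ∈ Finset.range (l + 1), legendre j s * legendre j t

theorem continuous_legendreKernel (l : ℕ) (s : ℝ) : Continuous (legendreKernel l s) := by
  unfold legendreKernel
  exact continuous_finsetSum _ fun j _ => continuous_const.mul (continuous_legendre j)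

theorem legendreKernel_self_nonneg (l : ℕ) (s : ℝ) : 0 ≤ legendreKernel l s s :=
  Finset.sum_nonneg fun _ _ => mul_self_nonneg _

theorem integral_legendreKernel_mul_legendre (l : ℕ) (s : ℝ) {j : ℕ} (hj : j ≤ l) :
    ∫ t in (-1 : ℝ)..1, legendreKernel l s t * legendre j t = legendre j s := by
  simp_rw [legendreKernel, Finset.sum_mul, mul_assoc]
  rw [integral_sum_const_mul _ _ (fun i t => legendre i t * legendre j t)
    fun i => (continuous_legendre i).mul (continuous_legendre j)]
  simp_rw [integral_legendre_mul_legendre]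
  simp [Nat.lt_succ_of_le hj]

/-- The kernel reproduces polynomials of degree at most `l`. -/
theorem integral_legendreKernel_mul_polynomial (l : ℕ) (s : ℝ) {q : ℝ[X]}
    (hq : q.degree < (l + 1 : ℕ)) :
    ∫ t in (-1 : ℝ)..1, legendreKernel l s t * q.eval t = q.eval s := by
  obtain ⟨a, ha⟩ := exists_eq_sum_legendre _ q hq
  simp_rw [ha, Finset.mul_sum, mul_left_comm (legendreKernel l s _)]
  rw [integral_sum_const_mul _ _ (fun i t => legendreKernel l s t * legendre i t)
    fun i => (continuous_legendreKernel l s).mul (continuous_legendre i)]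
  refine Finset.sum_congr rfl fun j hj => ?_
  rw [integral_legendreKernel_mul_legendre l s (Nat.lt_succ_iff.1 (Finset.mem_range.1 hj))]

/-- The reproducing property applied to the kernel itself, which is a polynomial of degree at most
`l` in `t`. -/
theorem integral_legendreKernel_sq (l : ℕ) (s : ℝ) :
    ∫ t in (-1 : ℝ)..1, legendreKernel l s t ^ 2 = legendreKernel l s s := by
  have : ∀ t, legendreKernel l s t ^ 2 = ∑ j ∈ Finset.range (l + 1),
      legendre j s * (legendreKernel l s t * legendre j t) := by
    intro t
    rw [sq]
    conv_lhs => enter [2]; rw [legendreKernel]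
    rw [Finset.mul_sum]
    exact Finset.sum_congr rfl fun j _ => by ring
  simp_rw [this]
  rw [integral_sum_const_mul _ _ (fun i t => legendreKernel l s t * legendre i t)
    fun i => (continuous_legendreKernel l s).mul (continuous_legendre i)]
  refine Finset.sum_congr rfl fun j hj => ?_
  rw [integral_legendreKernel_mul_legendre l s (Nat.lt_succ_iff.1 (Finset.mem_range.1 hj))]

/-- Cauchy-Schwarz on an interval of length `2`, obtained by integrating the squared deviation from
the mean value `A / 2`. -/
theorem integral_abs_legendreKernel_sq_le (l : ℕ) (s : ℝ) :
    (∫ t in (-1 : ℝ)..1, |legendreKernel l s t|) ^ 2 ≤ 2 * legendreKernel l s s := by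
  set A := ∫ t in (-1 : ℝ)..1, |legendreKernel l s t|
  have hc := continuous_legendreKernel l s
  have h : 0 ≤ ∫ t in (-1 : ℝ)..1, (|legendreKernel l s t| - A / 2) ^ 2 :=
    intervalIntegral.integral_nonneg (by norm_num) fun t _ => sq_nonneg _
  have h2 : ∀ t, (|legendreKernel l s t| - A / 2) ^ 2 =
      legendreKernel l s t ^ 2 - A * |legendreKernel l s t| + A ^ 2 / 4 := by
    intro t; rw [sub_sq, sq_abs]; ring
  simp_rw [h2] at h
  rw [intervalIntegral.integral_add (Continuous.intervalIntegrable (by fun_prop) _ _)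
      (Continuous.intervalIntegrable (by fun_prop) _ _),
    intervalIntegral.integral_sub (Continuous.intervalIntegrable (by fun_prop) _ _)
      (Continuous.intervalIntegrable (by fun_prop) _ _),
    intervalIntegral.integral_const_mul, integral_legendreKernel_sq,
    intervalIntegral.integral_const] at h
  change 0 ≤ legendreKernel l s s - A * A + (1 - -1) • (A ^ 2 / 4) at h
  rw [smul_eq_mul] at h
  nlinarith

/-! ### Legendre polynomials at the midpoint -/

/-- A Wallis-type bound: the left side grows by the factor `4 (2k+3)(2k+1)/(k+1)²` at each step, and
`(2k+1)(2k+3) ≤ 4(k+1)²`. -/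
theorem centralBinom_sq_le (k : ℕ) :
    (2 * (k : ℝ) + 1) * (k.centralBinom : ℝ) ^ 2 ≤ 16 ^ k := by
  induction k with
  | zero => simp
  | succ k ih =>
    have h := Nat.succ_mul_centralBinom_succ k
    have h' : ((k : ℝ) + 1) * ((k + 1).centralBinom : ℝ) = 2 * (2 * k + 1) * k.centralBinom := by
      exact_mod_cast h
    have hk : (0 : ℝ) < (k : ℝ) + 1 := by positivity
    have h2 : ((k + 1).centralBinom : ℝ) = 2 * (2 * k + 1) * k.centralBinom / (k + 1) := by
      field_simp; linarith
    rw [h2, pow_succ (16 : ℝ)]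
    push_cast
    have h3 : (2 * ((k : ℝ) + 1) + 1) * (2 * (2 * k + 1) * (k.centralBinom : ℝ) / (k + 1)) ^ 2 =
        ((2 * (k : ℝ) + 1) * (k.centralBinom : ℝ) ^ 2) *
          (4 * (2 * k + 3) * (2 * k + 1) / (k + 1) ^ 2) := by
      field_simp; ring
    rw [h3]
    have h4 : 4 * (2 * (k : ℝ) + 3) * (2 * k + 1) / (k + 1) ^ 2 ≤ 16 := by
      rw [div_le_iff₀ (by positivity)]; nlinarith
    exact mul_le_mul ih h4 (by positivity) (by positivity)

/-- The value at `0` comes from the coefficient of `X^j` in `(X²-1)^j`. It vanishes for odd `j` and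
is a signed central binomial coefficient for `j = 2k`, so the square is `(4k+1)/2 ·
binom(2k,k)²/16^k`. -/
theorem legendre_zero_sq_le (j : ℕ) : legendre j 0 ^ 2 ≤ 1 := by
  rw [legendre_eq, mul_pow, legendreFactor_sq, ← coeff_zero_eq_eval_zero, rodrigues,
    coeff_iterate_derivative, zero_add, Nat.descFactorial_self, nsmul_eq_mul]
  have hexp : ((X ^ 2 - 1 : ℝ[X]) ^ j) = expand ℝ 2 ((X - 1) ^ j) := by simp
  rw [hexp, coeff_expand (by norm_num)]
  split_ifs with h
  · obtain ⟨k, rfl⟩ := h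
    have hc : ((X - 1 : ℝ[X]) ^ (2 * k)).coeff k ^ 2 = (k.centralBinom : ℝ) ^ 2 := by
      have : (X - 1 : ℝ[X]) = X + C (-1) := by simp [sub_eq_add_neg]
      rw [this, coeff_X_add_C_pow, mul_pow, ← pow_mul, mul_comm _ 2, pow_mul,
        Nat.centralBinom_eq_two_mul_choose]
      simp
    rw [Nat.mul_div_cancel_left _ (by norm_num : 0 < 2), mul_pow, hc]
    have h16 : (4 : ℝ) ^ (2 * k) = 16 ^ k := by rw [pow_mul]; norm_num
    rw [h16]
    have hb := centralBinom_sq_le k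
    have h0 : (0 : ℝ) < 16 ^ k := by positivity
    have hf : (((2 * k).factorial : ℝ)) ≠ 0 := by positivity
    have : (2 * ((2 * k : ℕ) : ℝ) + 1) / 2 / (16 ^ k * ((2 * k).factorial : ℝ) ^ 2) *
        (((2 * k).factorial : ℝ) ^ 2 * (k.centralBinom : ℝ) ^ 2) =
        (4 * k + 1) / 2 * (k.centralBinom : ℝ) ^ 2 / 16 ^ k := by
      push_cast; field_simp; ring
    rw [this, div_le_one h0]
    nlinarith [sq_nonneg (k.centralBinom : ℝ)]
  · simp

end KDEP

namespace KDEP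

open Polynomial

/-! ### Chebyshev interpolation -/

/-- Iterated Rolle theorem: a smooth function with `n + 1` zeros in an open interval has a zero of
its `n`-th derivative there. -/
theorem exists_iteratedDeriv_eq_zero {A B : ℝ} (n : ℕ) (G : ℝ → ℝ) (z : ℕ → ℝ)
    (hG : ContDiffOn ℝ (⊤ : ℕ∞) G (Ioo A B)) (hz : ∀ i < n, z i < z (i + 1))
    (hzm : ∀ i ≤ n, z i ∈ Ioo A B ∧ G (z i) = 0) :
    ∃ ξ ∈ Ioo A B, iteratedDeriv n G ξ = 0 := by
  induction n generalizing G z with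
  | zero => exact ⟨z 0, (hzm 0 le_rfl).1, by simpa using (hzm 0 le_rfl).2⟩
  | succ n ih =>
    -- Rolle between consecutive zeros yields `n + 1` increasing zeros of the derivative, one fewer
    -- than before.
    have hex : ∀ i, ∃ y, i ≤ n → y ∈ Ioo (z i) (z (i + 1)) ∧ deriv G y = 0 := by
      intro i
      by_cases hi : i ≤ n
      · have h1 := hzm i (by omega)
        have h2 := hzm (i + 1) (by omega)
        obtain ⟨y, hy, hy'⟩ := exists_deriv_eq_zero (f := G) (hz i (by omega))
          (hG.continuousOn.mono (Icc_subset_Ioo h1.1.1 h2.1.2)) (h1.2.trans h2.2.symm)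
        exact ⟨y, fun _ => ⟨hy, hy'⟩⟩
      · exact ⟨0, fun h => absurd h hi⟩
    choose y hy using hex
    obtain ⟨ξ, hξ, h0⟩ := ih (deriv G) y (hG.deriv_of_isOpen isOpen_Ioo (by simp))
      (fun i hi => (hy i (by omega)).1.2.trans (hy (i + 1) (by omega)).1.1)
      (fun i hi => ⟨⟨(hzm i (by omega)).1.1.trans (hy i hi).1.1,
        (hy i hi).1.2.trans (hzm (i + 1) (by omega)).1.2⟩, (hy i hi).2⟩)
    exact ⟨ξ, hξ, by rw [iteratedDeriv_succ']; exact h0⟩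

theorem exists_iteratedDeriv_eq_zero_of_finset {A B : ℝ} (n : ℕ) (G : ℝ → ℝ) (Z : Finset ℝ)
    (hG : ContDiffOn ℝ (⊤ : ℕ∞) G (Ioo A B)) (hcard : Z.card = n + 1)
    (hZ : ∀ z ∈ Z, z ∈ Ioo A B ∧ G z = 0) :
    ∃ ξ ∈ Ioo A B, iteratedDeriv n G ξ = 0 := by
  let e := Z.orderEmbOfFin hcard
  refine exists_iteratedDeriv_eq_zero n G
    (fun i => if h : i < n + 1 then e ⟨i, h⟩ else 0) hG (fun i hi => ?_) (fun i hi => ?_)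
  · simp only [show i < n + 1 by omega, show i + 1 < n + 1 by omega, dif_pos]
    exact e.strictMono (by simp [Fin.lt_def])
  · simp only [show i < n + 1 by omega, dif_pos]
    exact hZ _ (Z.orderEmbOfFin_mem hcard _)

theorem contDiff_polynomial (P : ℝ[X]) {n : WithTop ℕ∞} : ContDiff ℝ n fun y => P.eval y := by
  simpa [aeval_def] using P.contDiff_aeval (𝕜 := ℝ) n

/-- Error of polynomial interpolation at the zeros of a polynomial `w` of degree `n`. -/
theorem exists_interpolation {A B : ℝ} {f : ℝ → ℝ}
    (hf : ContDiffOn ℝ (⊤ : ℕ∞) f (Ioo A B)) (n : ℕ) (w : ℝ[X]) (hw : w.natDegree ≤ n)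
    (Z : Finset ℝ) (hcard : Z.card = n) (hZ : ∀ z ∈ Z, z ∈ Ioo A B)
    (hroot : ∀ x, w.eval x = 0 ↔ x ∈ Z) :
    ∃ q : ℝ[X], q.degree < n ∧ ∀ x ∈ Ioo A B, ∃ ξ ∈ Ioo A B,
      (f x - q.eval x) * w.coeff n = iteratedDeriv n f ξ / n.factorial * w.eval x := by
  set q := Lagrange.interpolate Z id f with hq
  have hinj : Set.InjOn (id : ℝ → ℝ) Z := Set.injOn_id _
  have hqd : q.degree < n := hcard ▸ Lagrange.degree_interpolate_lt f hinj
  refine ⟨q, hqd, fun x hx => ?_⟩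
  have hqZ : ∀ z ∈ Z, q.eval z = f z := fun z hz => Lagrange.eval_interpolate_at_node f hinj hz
  by_cases hxZ : x ∈ Z
  · exact ⟨x, hx, by rw [hqZ x hxZ, (hroot x).2 hxZ]; simp⟩
  have hwx : w.eval x ≠ 0 := fun h => hxZ ((hroot x).1 h)
  -- With this factor `f - q - lam w` also vanishes at `x`, so it has `n + 1` zeros and iterated
  -- Rolle applies.
  set lam := (f x - q.eval x) / w.eval x with hlam
  set P := q + C lam * w with hP
  have hG : ContDiffOn ℝ (⊤ : ℕ∞) (f - fun y => P.eval y) (Ioo A B) :=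
    hf.sub (contDiff_polynomial P).contDiffOn
  obtain ⟨ξ, hξ, h0⟩ := exists_iteratedDeriv_eq_zero_of_finset n _ (insert x Z) hG
    (by rw [Finset.card_insert_of_notMem hxZ, hcard]) (by
      intro z hz
      rcases Finset.mem_insert.1 hz with rfl | hz
      · refine ⟨hx, ?_⟩
        simp only [hP, hlam, Pi.sub_apply, eval_add, eval_mul, eval_C]
        rw [div_mul_cancel₀ _ hwx]; ring
      · refine ⟨hZ z hz, ?_⟩
        simp [hP, hqZ z hz, (hroot z).2 hz])
  refine ⟨ξ, hξ, ?_⟩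
  have hfξ : ContDiffAt ℝ n f ξ :=
    ((hf ξ hξ).contDiffAt (isOpen_Ioo.mem_nhds hξ)).of_le (by exact_mod_cast le_top)
  rw [iteratedDeriv_sub hfξ (contDiff_polynomial P).contDiffAt, iteratedDeriv_polynomial, sub_eq_zero] at h0
  have hPd : P.natDegree ≤ n := by
    refine natDegree_le_of_degree_le ((degree_add_le _ _).trans (max_le hqd.le ?_))
    exact degree_le_of_natDegree_le ((natDegree_C_mul_le _ _).trans hw)
  -- The interpolant has degree below `n`, so only the top coefficient of `w` survives `n`
  -- derivatives.
  have hD : derivative^[n] P = C ((n.factorial : ℝ) * (lam * w.coeff n)) := by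
    have h1 : (derivative^[n] P).natDegree = 0 := by
      have := natDegree_iterate_derivative P n
      omega
    rw [eq_C_of_natDegree_eq_zero h1, coeff_iterate_derivative, zero_add,
      Nat.descFactorial_self, nsmul_eq_mul, hP, coeff_add, coeff_C_mul,
      coeff_eq_zero_of_degree_lt hqd, zero_add]
  rw [h0, hD, eval_C, hlam]
  field_simp

/-- Chebyshev interpolation of degree `n` on an interval. -/
theorem exists_polynomial_abs_sub_le {A B : ℝ} (hAB : A < B) {f : ℝ → ℝ}
    (hf : ContDiffOn ℝ (⊤ : ℕ∞) f (Ioo A B)) (n : ℕ) {D : ℝ}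
    (hD : ∀ y ∈ Ioo A B, |iteratedDeriv (n + 1) f y| / (n + 1).factorial ≤ D) :
    ∃ q : ℝ[X], q.degree < (n + 1 : ℕ) ∧ ∀ x ∈ Ioo A B,
      |f x - q.eval x| ≤ 2 * D * ((B - A) / 4) ^ (n + 1) := by
  set r := (B - A) / 2 with hr
  set m := (A + B) / 2 with hm
  have hr0 : 0 < r := by rw [hr]; linarith
  -- The nodes are the zeros of the Chebyshev polynomial carried to `(A,B)`: it is bounded by `1`
  -- there and has the large leading coefficient `2^n / r^(n+1)`.
  set T := Chebyshev.T ℝ ((n + 1 : ℕ) : ℤ) with hT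
  set R := (Finset.range (n + 1)).image
    (fun k : ℕ => Real.cos ((2 * k + 1) * Real.pi / (2 * (n + 1 : ℕ)))) with hR
  have hroots : T.roots = R.val := Chebyshev.roots_T_real (n + 1)
  have hTdeg : T.natDegree = n + 1 := by rw [hT, Chebyshev.natDegree_T, Int.natAbs_natCast]
  have hT0 : T ≠ 0 := by intro h; rw [h] at hTdeg; simp at hTdeg
  have hTroot : ∀ t, T.eval t = 0 ↔ t ∈ R := by
    intro t
    rw [← Finset.mem_val, ← hroots, mem_roots hT0]; rfl
  have hRcard : R.card = n + 1 := by
    rw [hR, Finset.card_image_of_injOn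
      ((Finset.range (n + 1)).nodup_map_iff_injOn.mp (Chebyshev.roots_T_real_nodup (n + 1))),
      Finset.card_range]
  have hRmem : ∀ t ∈ R, t ∈ Ioo (-1 : ℝ) 1 := by
    intro t ht
    have h0 := (hTroot t).2 ht
    obtain ⟨k, -, rfl⟩ := Finset.mem_image.1 ht
    -- Outside `(-1,1)` the Chebyshev polynomial has absolute value at least `1`, so no root lies
    -- there.
    refine abs_lt.1 (lt_of_not_ge fun h => ?_)
    have := Chebyshev.one_le_abs_eval_T_real ((n + 1 : ℕ) : ℤ) h
    rw [← hT, h0] at this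
    norm_num at this
  set L : ℝ[X] := C (1 / r) * X + C (-(m / r)) with hL
  have hLdeg : L.natDegree = 1 := natDegree_linear (by positivity)
  set w := T.comp L with hw
  have hwdeg : w.natDegree = n + 1 := by rw [hw, natDegree_comp, hTdeg, hLdeg, mul_one]
  have hLeval : ∀ x, L.eval x = (x - m) / r := by intro x; simp [hL]; field_simp; ring
  have hweval : ∀ x, w.eval x = T.eval ((x - m) / r) := by
    intro x; rw [hw, eval_comp, hLeval]
  have hwcoeff : w.coeff (n + 1) = 2 ^ n / r ^ (n + 1) := by
    have h1 : w.leadingCoeff = T.leadingCoeff * L.leadingCoeff ^ T.natDegree :=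
      leadingCoeff_comp (by rw [hLdeg]; norm_num)
    rw [leadingCoeff, hwdeg, hTdeg, hT, Chebyshev.leadingCoeff_T, Int.natAbs_natCast, hL,
      leadingCoeff_linear (by positivity)] at h1
    rw [h1]
    simp [div_eq_mul_inv]
  obtain ⟨q, hq, hqe⟩ := exists_interpolation hf (n + 1) w hwdeg.le
    (R.image fun t => m + r * t)
    (by rw [Finset.card_image_of_injective _ (fun a b h => by
      have : r * a = r * b := by simpa using h
      exact mul_left_cancel₀ hr0.ne' this), hRcard])
    (by
      intro z hz
      obtain ⟨t, ht, rfl⟩ := Finset.mem_image.1 hz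
      have := hRmem t ht
      constructor
      · have := mul_lt_mul_of_pos_left this.1 hr0; rw [hm, hr] at *; linarith
      · have := mul_lt_mul_of_pos_left this.2 hr0; rw [hm, hr] at *; linarith)
    (by
      intro x
      rw [hweval, hTroot]
      constructor
      · intro h; exact Finset.mem_image.2 ⟨_, h, by field_simp; ring⟩
      · intro h
        obtain ⟨t, ht, rfl⟩ := Finset.mem_image.1 h
        convert ht using 1; field_simp; ring)
  refine ⟨q, hq, fun x hx => ?_⟩
  obtain ⟨ξ, hξ, he⟩ := hqe x hx
  have hw1 : |w.eval x| ≤ 1 := by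
    rw [hweval]
    refine Chebyshev.abs_eval_T_real_le_one _ ?_
    rw [abs_div, abs_of_pos hr0, div_le_one hr0, abs_le, hr, hm]
    constructor <;> linarith [hx.1, hx.2]
  have h2 : |f x - q.eval x| * (2 ^ n / r ^ (n + 1)) ≤ D := by
    have h3 := congrArg abs he
    rw [abs_mul, abs_mul, hwcoeff, abs_of_pos (by positivity : 0 < 2 ^ n / r ^ (n + 1)), abs_div,
      abs_of_pos (by positivity : (0 : ℝ) < (n + 1).factorial)] at h3
    rw [h3]
    exact (mul_le_of_le_one_right (by positivity) hw1).trans (hD ξ hξ)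
  have h4 : 2 * D * ((B - A) / 4) ^ (n + 1) = D / (2 ^ n / r ^ (n + 1)) := by
    have : (B - A) / 4 = r / 2 := by rw [hr]; ring
    rw [this, div_pow, pow_succ 2 n]
    field_simp
  rw [h4, le_div_iff₀ (by positivity)]
  exact h2

end KDEP

namespace KDEP

open Polynomial

/-! ### The kernel in the original coordinates -/

/-- The left end point of the window `[x - h, x + h] ∩ [a, b]`. -/
noncomputable def windowLeft (h a x : ℝ) : ℝ := max a (x - h)

/-- The right end point of the window `[x - h, x + h] ∩ [a, b]`. -/
noncomputable def windowRight (h b x : ℝ) : ℝ := min b (x + h)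

/-- Half the length of the window. -/
noncomputable def windowRadius (h a b x : ℝ) : ℝ := (windowRight h b x - windowLeft h a x) / 2

/-- The midpoint of the window. -/
noncomputable def windowMid (h a b x : ℝ) : ℝ := (windowLeft h a x + windowRight h b x) / 2

/-- The kernel at `x` as a weight on `[a,b]`. -/
noncomputable def scaledKernel (h : ℝ) (l : ℕ) (a b x y : ℝ) : ℝ :=
  kernel h l a b x ((y - x) / h) / h

section window

variable {h a b x : ℝ}

/-- As `b - a ≥ 2h`, the window is cut on one side at most and still contains an interval of length
`h` on the other side of `x`. -/
theorem windowRadius_mem (hh : 0 < h) (hab : 2 * h ≤ b - a) (hx : x ∈ Icc a b) :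
    windowRadius h a b x ∈ Icc (h / 2) h := by
  obtain ⟨h1, h2⟩ := hx
  unfold windowRadius windowLeft windowRight
  rcases max_cases a (x - h) with ⟨e, _⟩ | ⟨e, _⟩ <;>
  rcases min_cases b (x + h) with ⟨e', _⟩ | ⟨e', _⟩ <;> rw [e, e'] <;> constructor <;> linarith

theorem windowRadius_pos (hh : 0 < h) (hab : 2 * h ≤ b - a) (hx : x ∈ Icc a b) :
    0 < windowRadius h a b x := by
  have := (windowRadius_mem hh hab hx).1
  linarith

/-- The three cases correspond to a window cut off at `a`, uncut, or cut off at `b`. This identity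
and `zetaCoeff_eq` say that `u ↦ γ u + ζ` is the affine map of the window onto `[-1,1]`. -/
theorem gammaCoeff_eq (hh : 0 < h) (hab : 2 * h ≤ b - a) (hx : x ∈ Icc a b) :
    gammaCoeff h a b x = h / windowRadius h a b x := by
  obtain ⟨h1, h2⟩ := hx
  unfold gammaCoeff windowRadius windowLeft windowRight
  split_ifs with c1 c2
  · rw [max_eq_left (by linarith), min_eq_right (by linarith)]
    have : h + x - a ≠ 0 := by linarith
    have : x + h - a ≠ 0 := by linarith
    field_simp; ring
  · rw [max_eq_right (by linarith), min_eq_right (by linarith)]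
    have : x + h - (x - h) = 2 * h := by ring
    rw [this]; field_simp
  · rw [max_eq_right (by linarith), min_eq_left (by linarith)]
    have : h + b - x ≠ 0 := by linarith
    have : b - (x - h) ≠ 0 := by linarith
    field_simp; ring

theorem zetaCoeff_eq (hh : 0 < h) (hab : 2 * h ≤ b - a) (hx : x ∈ Icc a b) :
    zetaCoeff h a b x = (x - windowMid h a b x) / windowRadius h a b x := by
  obtain ⟨h1, h2⟩ := hx
  unfold zetaCoeff windowRadius windowMid windowLeft windowRight
  split_ifs with c1 c2
  · rw [max_eq_left (by linarith), min_eq_right (by linarith)]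
    have : h + x - a ≠ 0 := by linarith
    have : x + h - a ≠ 0 := by linarith
    field_simp; ring
  · rw [max_eq_right (by linarith), min_eq_right (by linarith)]
    have : x - (x - h + (x + h)) / 2 = 0 := by ring
    rw [this, zero_div]
  · rw [max_eq_right (by linarith), min_eq_left (by linarith)]
    have : h + b - x ≠ 0 := by linarith
    have : b - (x - h) ≠ 0 := by linarith
    field_simp; ring

theorem mem_shiftedSupport_iff (hh : 0 < h) (y : ℝ) :
    (y - x) / h ∈ shiftedSupport h a b x ↔ y ∈ Icc (windowLeft h a x) (windowRight h b x) := by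
  unfold shiftedSupport windowLeft windowRight
  rw [mem_Icc, mem_Icc, neg_le, ← neg_div, le_min_iff, le_min_iff, max_le_iff, le_min_iff,
    div_le_div_iff_of_pos_right hh, div_le_div_iff_of_pos_right hh, div_le_one hh, div_le_one hh]
  constructor <;> rintro ⟨⟨_, _⟩, _, _⟩ <;> refine ⟨⟨?_, ?_⟩, ?_, ?_⟩ <;> linarith

/-- For `u = (y - x)/h`, the number `γ u + ζ` is the coordinate of `y` in the window, and `γ / h` is
the reciprocal of the window radius. -/
theorem scaledKernel_eq (hh : 0 < h) (hab : 2 * h ≤ b - a) (hx : x ∈ Icc a b) (l : ℕ) :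
    scaledKernel h l a b x = (Icc (windowLeft h a x) (windowRight h b x)).indicator fun y =>
      1 / windowRadius h a b x * legendreKernel l (zetaCoeff h a b x)
        ((y - windowMid h a b x) / windowRadius h a b x) := by
  ext y
  have hr := windowRadius_pos hh hab hx
  unfold scaledKernel kernel indicator
  simp only [mem_shiftedSupport_iff hh]
  split_ifs
  · have : gammaCoeff h a b x * ((y - x) / h) + zetaCoeff h a b x =
        (y - windowMid h a b x) / windowRadius h a b x := by
      rw [gammaCoeff_eq hh hab hx, zetaCoeff_eq hh hab hx]
      field_simp; ring
    rw [this, gammaCoeff_eq hh hab hx, legendreKernel]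
    field_simp
  · simp

theorem windowLeft_eq : windowLeft h a x = windowMid h a b x - windowRadius h a b x := by
  unfold windowMid windowRadius; ring

theorem windowRight_eq : windowRight h b x = windowMid h a b x + windowRadius h a b x := by
  unfold windowMid windowRadius; ring

theorem window_subset : Icc (windowLeft h a x) (windowRight h b x) ⊆ Icc a b :=
  Icc_subset_Icc (le_max_left _ _) (min_le_left _ _)

theorem mem_window (hh : 0 < h) (hx : x ∈ Ioo a b) :
    x ∈ Ioo (windowLeft h a x) (windowRight h b x) :=
  ⟨max_lt hx.1 (by linarith), lt_min hx.2 (by linarith)⟩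

theorem integral_window_comp (hh : 0 < h) (hab : 2 * h ≤ b - a) (hx : x ∈ Icc a b) (G : ℝ → ℝ) :
    ∫ y in Icc (windowLeft h a x) (windowRight h b x),
      G ((y - windowMid h a b x) / windowRadius h a b x) =
      windowRadius h a b x * ∫ t in (-1 : ℝ)..1, G t := by
  have hr := windowRadius_pos hh hab hx
  rw [windowLeft_eq (b := b), windowRight_eq (a := a)]
  set r := windowRadius h a b x
  set m := windowMid h a b x
  rw [integral_Icc_eq_integral_Ioc, ← intervalIntegral.integral_of_le (by linarith)]
  have h1 : ∀ y, (y - m) / r = y / r - m / r := fun y => sub_div _ _ _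
  simp_rw [h1]
  rw [intervalIntegral.integral_comp_div_sub _ hr.ne', smul_eq_mul]
  congr 2 <;> field_simp <;> ring

/-- Weighted integrals against the kernel are integrals over the window. -/
theorem integral_comp_scaledKernel (hh : 0 < h) (hab : 2 * h ≤ b - a) (hx : x ∈ Icc a b) (l : ℕ)
    (Φ : ℝ → ℝ → ℝ) (hΦ : ∀ y, Φ 0 y = 0) :
    ∫ y in Icc a b, Φ (scaledKernel h l a b x y) y =
      ∫ y in Icc (windowLeft h a x) (windowRight h b x),
        Φ (1 / windowRadius h a b x * legendreKernel l (zetaCoeff h a b x)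
          ((y - windowMid h a b x) / windowRadius h a b x)) y := by
  have : (fun y => Φ (scaledKernel h l a b x y) y) =
      (Icc (windowLeft h a x) (windowRight h b x)).indicator fun y =>
        Φ (1 / windowRadius h a b x * legendreKernel l (zetaCoeff h a b x)
          ((y - windowMid h a b x) / windowRadius h a b x)) y := by
    ext y
    rw [scaledKernel_eq hh hab hx]
    by_cases hy : y ∈ Icc (windowLeft h a x) (windowRight h b x)
    · simp only [indicator_of_mem hy]
    · simp only [indicator_of_notMem hy, hΦ]
  rw [this, setIntegral_indicator measurableSet_Icc, inter_eq_self_of_subset_right window_subset]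

theorem continuous_window_kernel (l : ℕ) : Continuous fun y =>
    1 / windowRadius h a b x * legendreKernel l (zetaCoeff h a b x)
      ((y - windowMid h a b x) / windowRadius h a b x) := by
  have := continuous_legendreKernel l (zetaCoeff h a b x)
  fun_prop

/-- The kernel reproduces polynomials of degree at most `l`. -/
theorem integral_scaledKernel_mul_polynomial (hh : 0 < h) (hab : 2 * h ≤ b - a) (hx : x ∈ Icc a b)
    (l : ℕ) {q : ℝ[X]} (hq : q.degree < (l + 1 : ℕ)) :
    ∫ y in Icc (windowLeft h a x) (windowRight h b x),
      1 / windowRadius h a b x * legendreKernel l (zetaCoeff h a b x)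
        ((y - windowMid h a b x) / windowRadius h a b x) * q.eval y = q.eval x := by
  have hr := windowRadius_pos hh hab hx
  set r := windowRadius h a b x with hrdef
  set m := windowMid h a b x with hmdef
  set z := zetaCoeff h a b x with hz
  -- This is `q` in the window coordinate; the substitution is affine and keeps the degree, and the
  -- point `x` has coordinate `ζ`.
  set Q := q.comp (C r * X + C m) with hQ
  have hQd : Q.degree < (l + 1 : ℕ) := by
    by_cases h0 : q = 0
    · rw [hQ, h0, zero_comp]; simp
    · have h1 : Q.natDegree = q.natDegree := by
        rw [hQ, natDegree_comp, natDegree_linear hr.ne', mul_one]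
      have h2 : q.natDegree < l + 1 := (natDegree_lt_iff_degree_lt h0).2 hq
      exact lt_of_le_of_lt degree_le_natDegree (by rw [h1]; exact_mod_cast h2)
  have hG := integral_window_comp hh hab hx fun t => 1 / r * (legendreKernel l z t * Q.eval t)
  have hcongr : ∀ y, 1 / r * legendreKernel l z ((y - m) / r) * q.eval y =
      1 / r * (legendreKernel l z ((y - m) / r) * Q.eval ((y - m) / r)) := by
    intro y
    have : q.eval y = Q.eval ((y - m) / r) := by
      rw [hQ, eval_comp]
      congr 1
      simp
      field_simp; ring
    rw [this, mul_assoc]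
  simp_rw [hcongr]
  rw [hG, intervalIntegral.integral_const_mul, integral_legendreKernel_mul_polynomial _ _ hQd,
    ← hrdef, hz, zetaCoeff_eq hh hab hx, hQ, eval_comp]
  field_simp
  simp
  congr 1
  rw [← hrdef, ← hmdef]
  field_simp; ring

/-- Bias of the kernel smoother. -/
theorem sq_sub_integral_scaledKernel_le (hh : 0 < h) (hab : 2 * h ≤ b - a) (hx : x ∈ Ioo a b)
    (l : ℕ) {ρ : ℝ → ℝ} (hρ : IntegrableOn ρ (Icc a b)) {q : ℝ[X]}
    (hq : q.degree < (l + 1 : ℕ)) {δ : ℝ}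
    (hδ : ∀ y ∈ Ioo (windowLeft h a x) (windowRight h b x), |ρ y - q.eval y| ≤ δ) :
    (ρ x - ∫ y in Icc a b, scaledKernel h l a b x y * ρ y) ^ 2 ≤
      2 * δ ^ 2 *
        (1 + 2 * legendreKernel l (zetaCoeff h a b x) (zetaCoeff h a b x)) := by
  have hx' := Ioo_subset_Icc_self hx
  have hr := windowRadius_pos hh hab hx'
  have hδ0 : 0 ≤ δ := (abs_nonneg _).trans (hδ x (mem_window hh hx))
  rw [integral_comp_scaledKernel hh hab hx' l (fun k y => k * ρ y) (by simp)]
  set W := Icc (windowLeft h a x) (windowRight h b x) with hW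
  set k : ℝ → ℝ := fun y => 1 / windowRadius h a b x * legendreKernel l (zetaCoeff h a b x)
    ((y - windowMid h a b x) / windowRadius h a b x) with hk
  have hkc : Continuous k := continuous_window_kernel l
  have hρW : IntegrableOn ρ W := hρ.mono_set window_subset
  have hkρ : IntegrableOn (fun y => k y * ρ y) W :=
    hρW.continuousOn_mul hkc.continuousOn isCompact_Icc
  have hkq : IntegrableOn (fun y => k y * q.eval y) W :=
    (hkc.mul q.continuous).continuousOn.integrableOn_compact isCompact_Icc
  have hka : IntegrableOn (fun y => |k y|) W :=
    hkc.abs.continuousOn.integrableOn_compact isCompact_Icc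
  have hrep : ∫ y in W, k y * q.eval y = q.eval x :=
    integral_scaledKernel_mul_polynomial hh hab hx' l hq
  have habs : ∫ y in W, |k y| =
      ∫ t in (-1 : ℝ)..1, |legendreKernel l (zetaCoeff h a b x) t| := by
    have := integral_window_comp hh hab hx' fun t =>
      |1 / windowRadius h a b x * legendreKernel l (zetaCoeff h a b x) t|
    rw [this]
    simp_rw [abs_mul, abs_of_pos (one_div_pos.2 hr)]
    rw [intervalIntegral.integral_const_mul, ← mul_assoc, mul_one_div_cancel hr.ne', one_mul]
  set A := ∫ t in (-1 : ℝ)..1, |legendreKernel l (zetaCoeff h a b x) t| with hA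
  have hA2 : A ^ 2 ≤ _ := integral_abs_legendreKernel_sq_le l (zetaCoeff h a b x)
  have hA0 : 0 ≤ A := intervalIntegral.integral_nonneg (by norm_num) fun _ _ => abs_nonneg _
  have hdiff : |∫ y in W, k y * (q.eval y - ρ y)| ≤ δ * A := by
    rw [← habs, ← integral_const_mul]
    -- The approximation bound is known on the open window only; the end points are null.
    rw [hW, integral_Icc_eq_integral_Ioo, integral_Icc_eq_integral_Ioo, ← Real.norm_eq_abs]
    refine norm_integral_le_of_norm_le ((hka.mono_set Ioo_subset_Icc_self).const_mul δ) ?_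
    refine (ae_restrict_iff' measurableSet_Ioo).2 (ae_of_all _ fun y hy => ?_)
    rw [Real.norm_eq_abs, abs_mul, abs_sub_comm, mul_comm]
    exact mul_le_mul_of_nonneg_right (hδ y hy) (abs_nonneg _)
  -- Since the kernel reproduces `q`, only `ρ - q` contributes to the bias.
  have heq : ρ x - ∫ y in W, k y * ρ y =
      (ρ x - q.eval x) + ∫ y in W, k y * (q.eval y - ρ y) := by
    simp_rw [mul_sub]
    rw [integral_sub hkq hkρ, hrep]; ring
  have h1 := hδ x (mem_window hh hx)
  have h2 : |ρ x - ∫ y in W, k y * ρ y| ≤ δ + δ * A := by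
    rw [heq]; exact (abs_add_le _ _).trans (add_le_add h1 hdiff)
  rw [← sq_abs]
  calc |ρ x - ∫ y in W, k y * ρ y| ^ 2 ≤ (δ + δ * A) ^ 2 := by gcongr
    -- This is `(1 + A)² ≤ 2(1 + A²)`; then `A²` is bounded by twice the diagonal value.
    _ ≤ 2 * δ ^ 2 * (1 + A ^ 2) := by nlinarith [sq_nonneg (δ * (1 - A))]
    _ ≤ _ := by gcongr

/-- Second moment of the kernel. -/
theorem integral_scaledKernel_sq_mul_le (hh : 0 < h) (hab : 2 * h ≤ b - a) (hx : x ∈ Icc a b)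
    (l : ℕ) {ρ : ℝ → ℝ} (hρ : IntegrableOn ρ (Icc a b)) {F : ℝ} (hF0 : 0 ≤ F)
    (hF : ∀ y ∈ Icc a b, ρ y ≤ F) :
    ∫ y in Icc a b, scaledKernel h l a b x y ^ 2 * ρ y ≤
      2 * F / h * legendreKernel l (zetaCoeff h a b x) (zetaCoeff h a b x) := by
  have hr := windowRadius_pos hh hab hx
  have hr2 := (windowRadius_mem hh hab hx).1
  rw [integral_comp_scaledKernel hh hab hx l (fun k y => k ^ 2 * ρ y) (by simp)]
  set W := Icc (windowLeft h a x) (windowRight h b x) with hW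
  set k : ℝ → ℝ := fun y => 1 / windowRadius h a b x * legendreKernel l (zetaCoeff h a b x)
    ((y - windowMid h a b x) / windowRadius h a b x) with hk
  have hkc : Continuous k := continuous_window_kernel l
  have hkρ : IntegrableOn (fun y => k y ^ 2 * ρ y) W :=
    (hρ.mono_set window_subset).continuousOn_mul (hkc.pow 2).continuousOn isCompact_Icc
  have hk2 : IntegrableOn (fun y => F * k y ^ 2) W :=
    (continuous_const.mul (hkc.pow 2)).continuousOn.integrableOn_compact isCompact_Icc
  have hsq : ∫ y in W, k y ^ 2 = 1 / windowRadius h a b x *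
      legendreKernel l (zetaCoeff h a b x) (zetaCoeff h a b x) := by
    have := integral_window_comp hh hab hx fun t =>
      (1 / windowRadius h a b x * legendreKernel l (zetaCoeff h a b x) t) ^ 2
    rw [this]
    simp_rw [mul_pow]
    rw [intervalIntegral.integral_const_mul, integral_legendreKernel_sq]
    field_simp
  have h0 := legendreKernel_self_nonneg l (zetaCoeff h a b x)
  calc ∫ y in W, k y ^ 2 * ρ y ≤ ∫ y in W, F * k y ^ 2 := by
        refine setIntegral_mono_on hkρ hk2 measurableSet_Icc fun y hy => ?_
        rw [mul_comm]
        exact mul_le_mul_of_nonneg_right (hF y (window_subset hy)) (sq_nonneg _)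
    _ = F * (1 / windowRadius h a b x) *
        legendreKernel l (zetaCoeff h a b x) (zetaCoeff h a b x) := by
        rw [integral_const_mul, hsq, mul_assoc]
    _ ≤ _ := by
        refine mul_le_mul_of_nonneg_right ?_ h0
        rw [mul_one_div, div_le_div_iff₀ hr hh]
        nlinarith

end window

end KDEP

namespace KDEP

/-! ### The integrated diagonal of the kernel -/

theorem continuous_legendreKernel_diag (l : ℕ) : Continuous fun t => legendreKernel l t t := by
  unfold legendreKernel
  exact continuous_finsetSum _ fun j _ => (continuous_legendre j).mul (continuous_legendre j)

theorem integral_legendreKernel_diag (l : ℕ) :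
    ∫ t in (-1 : ℝ)..1, legendreKernel l t t = l + 1 := by
  unfold legendreKernel
  have hc : ∀ j, Continuous fun t => legendre j t * legendre j t := fun j =>
    (continuous_legendre j).mul (continuous_legendre j)
  rw [intervalIntegral.integral_finsetSum fun j _ => (hc j).intervalIntegrable _ _]
  simp_rw [integral_legendre_mul_legendre]
  simp

theorem legendreKernel_zero_zero_le (l : ℕ) : legendreKernel l 0 0 ≤ l + 1 := by
  unfold legendreKernel
  refine (Finset.sum_le_card_nsmul _ _ 1 fun j _ => ?_).trans_eq (by simp)
  rw [← sq]; exact legendre_zero_sq_le j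

/-- Substitute `t = z s`: as `κ z' ≥ 1`, the integral is at most `κ` times the trace of the kernel
over a part of `[-1,1]`, and the whole trace is `l + 1`. It serves the two boundary zones. -/
theorem lintegral_comp_le_of_deriv {p q κ : ℝ} (hpq : p ≤ q) (hκ : 0 < κ) {z z' : ℝ → ℝ}
    (hz : ∀ s ∈ Icc p q, HasDerivAt z (z' s) s) (hz' : ContinuousOn z' (Icc p q))
    (hlow : ∀ s ∈ Icc p q, 1 / κ ≤ z' s) (hp : -1 ≤ z p) (hq : z q ≤ 1) (l : ℕ) :
    ∫⁻ s in Icc p q, ENNReal.ofReal (legendreKernel l (z s) (z s)) ≤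
      ENNReal.ofReal (κ * (l + 1)) := by
  have hg := continuous_legendreKernel_diag l
  have hzc : ContinuousOn z (Icc p q) := fun s hs => (hz s hs).continuousAt.continuousWithinAt
  have hcont : ContinuousOn (fun s => legendreKernel l (z s) (z s)) (Icc p q) :=
    hg.comp_continuousOn hzc
  have h0 : ∀ s, 0 ≤ legendreKernel l (z s) (z s) := fun s => legendreKernel_self_nonneg _ _
  rw [← ofReal_integral_eq_lintegral_ofReal (hcont.integrableOn_compact isCompact_Icc)
    (ae_of_all _ h0)]
  refine ENNReal.ofReal_le_ofReal ?_
  have hzpq : z p ≤ z q := by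
    have hmono : MonotoneOn z (Icc p q) := by
      refine monotoneOn_of_deriv_nonneg (convex_Icc p q) hzc
        (fun s hs => (hz s (interior_subset hs)).differentiableAt.differentiableWithinAt)
        fun s hs => ?_
      rw [(hz s (interior_subset hs)).deriv]
      exact (one_div_pos.2 hκ).le.trans (hlow s (interior_subset hs))
    exact hmono (left_mem_Icc.2 hpq) (right_mem_Icc.2 hpq) hpq
  have hsub := intervalIntegral.integral_comp_mul_deriv (a := p) (b := q) (f := z) (f' := z')
    (g := fun t => legendreKernel l t t) (by rwa [uIcc_of_le hpq]) (by rwa [uIcc_of_le hpq]) hg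
  have hint : IntegrableOn (fun s => legendreKernel l (z s) (z s) * z' s) (Icc p q) :=
    (hcont.mul hz').integrableOn_compact isCompact_Icc
  calc ∫ s in Icc p q, legendreKernel l (z s) (z s)
      ≤ ∫ s in Icc p q, κ * (legendreKernel l (z s) (z s) * z' s) := by
        refine setIntegral_mono_on (hcont.integrableOn_compact isCompact_Icc) (hint.const_mul κ)
          measurableSet_Icc fun s hs => ?_
        have h1 : 1 ≤ κ * z' s := by
          have := hlow s hs
          rw [div_le_iff₀ hκ] at this; linarith
        nlinarith [h0 s]
    _ = κ * ∫ t in (z p)..(z q), legendreKernel l t t := by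
        rw [integral_const_mul, integral_Icc_eq_integral_Ioc,
          ← intervalIntegral.integral_of_le hpq, ← hsub]
        rfl
    _ ≤ κ * (l + 1) := by
        rw [← integral_legendreKernel_diag l]
        refine mul_le_mul_of_nonneg_left ?_ hκ.le
        exact intervalIntegral.integral_mono_interval hp hzpq hq
          (ae_of_all _ fun t => legendreKernel_self_nonneg _ _) (hg.intervalIntegrable _ _)

/-- The variance proxy of the kernel smoother, integrated over `[a,b]`. -/
theorem lintegral_legendreKernel_zetaCoeff_le {h a b : ℝ} (hh : 0 < h) (hab : 2 * h ≤ b - a)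
    (l : ℕ) :
    ∫⁻ x in Icc a b, ENNReal.ofReal
      (legendreKernel l (zetaCoeff h a b x) (zetaCoeff h a b x)) ≤
      ENNReal.ofReal ((b - a + 4 * h) * (l + 1)) := by
  set g : ℝ → ENNReal := fun x => ENNReal.ofReal
      (legendreKernel l (zetaCoeff h a b x) (zetaCoeff h a b x)) with hg
  have hcover : Icc a b ⊆ Ico a (a + h) ∪ (Icc (a + h) (b - h) ∪ Ioc (b - h) b) := by
    intro x hx
    by_cases h1 : x < a + h
    · exact Or.inl ⟨hx.1, h1⟩
    · by_cases h2 : x ≤ b - h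
      · exact Or.inr (Or.inl ⟨not_lt.1 h1, h2⟩)
      · exact Or.inr (Or.inr ⟨not_le.1 h2, hx.2⟩)
  have hL : ∫⁻ x in Ico a (a + h), g x ≤ ENNReal.ofReal (2 * h * (l + 1)) := by
    -- Here `ζ` increases from `-1` to `0` with slope `2h/(h+s-a)² ≥ 1/(2h)`, hence `κ = 2h`. The
    -- right zone is the mirror image.
    have hbound := lintegral_comp_le_of_deriv (p := a) (q := a + h) (κ := 2 * h) (by linarith)
      (by linarith) (z := fun s => -((h - (s - a)) / (h + s - a)))
      (z' := fun s => 2 * h / (h + s - a) ^ 2) (fun s hs => by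
        have hne : h + s - a ≠ 0 := by linarith [hs.1]
        have h1 : HasDerivAt (fun s : ℝ => h - (s - a)) (-1) s :=
          ((hasDerivAt_id s).sub_const a).const_sub h
        have h2 : HasDerivAt (fun s : ℝ => h + s - a) 1 s :=
          ((hasDerivAt_id s).const_add h).sub_const a
        refine (h1.div h2 hne).neg.congr_deriv ?_
        field_simp; ring)
      (by
        refine continuousOn_const.div (by fun_prop) fun s hs => ?_
        have : h + s - a ≠ 0 := by linarith [hs.1]
        positivity)
      (fun s hs => by
        have h1 : 0 < h + s - a := by linarith [hs.1]
        have h2 : h + s - a ≤ 2 * h := by linarith [hs.2]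
        rw [div_le_div_iff₀ (by positivity) (by positivity)]
        nlinarith)
      (by simp [div_self hh.ne']) (by simp) l
    refine le_trans ?_ hbound
    calc ∫⁻ x in Ico a (a + h), g x = ∫⁻ s in Ico a (a + h), ENNReal.ofReal (legendreKernel l
          (-((h - (s - a)) / (h + s - a))) (-((h - (s - a)) / (h + s - a)))) := by
          refine setLIntegral_congr_fun measurableSet_Ico fun x hx => ?_
          simp only [hg, zetaCoeff, if_pos hx.2]
      _ ≤ _ := lintegral_mono_set Ico_subset_Icc_self
  have hR : ∫⁻ x in Ioc (b - h) b, g x ≤ ENNReal.ofReal (2 * h * (l + 1)) := by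
    have hbound := lintegral_comp_le_of_deriv (p := b - h) (q := b) (κ := 2 * h) (by linarith)
      (by linarith) (z := fun s => (h - (b - s)) / (h + b - s))
      (z' := fun s => 2 * h / (h + b - s) ^ 2) (fun s hs => by
        have hne : h + b - s ≠ 0 := by linarith [hs.2]
        have h1 : HasDerivAt (fun s : ℝ => h - (b - s)) 1 s :=
          (((hasDerivAt_id s).const_sub b).const_sub h).congr_deriv (by simp)
        have h2 : HasDerivAt (fun s : ℝ => h + b - s) (-1) s :=
          (hasDerivAt_id s).const_sub (h + b)
        refine (h1.div h2 hne).congr_deriv ?_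
        field_simp; ring)
      (by
        refine continuousOn_const.div (by fun_prop) fun s hs => ?_
        have : h + b - s ≠ 0 := by linarith [hs.2]
        positivity)
      (fun s hs => by
        have h1 : 0 < h + b - s := by linarith [hs.2]
        have h2 : h + b - s ≤ 2 * h := by linarith [hs.1]
        rw [div_le_div_iff₀ (by positivity) (by positivity)]
        nlinarith)
      (by simp) (by simp [div_self hh.ne']) l
    refine le_trans ?_ hbound
    calc ∫⁻ x in Ioc (b - h) b, g x = ∫⁻ s in Ioc (b - h) b, ENNReal.ofReal (legendreKernel l
          ((h - (b - s)) / (h + b - s)) ((h - (b - s)) / (h + b - s))) := by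
          refine setLIntegral_congr_fun measurableSet_Ioc fun x hx => ?_
          have h1 : ¬ x < a + h := by have := hx.1; linarith
          have h2 : ¬ x ≤ b - h := not_le.2 hx.1
          simp only [hg, zetaCoeff, if_neg h1, if_neg h2]
      _ ≤ _ := lintegral_mono_set Ioc_subset_Icc_self
  -- In the uncut zone `ζ = 0`, so the bound at the midpoint of `[-1,1]` applies.
  have hM : ∫⁻ x in Icc (a + h) (b - h), g x ≤ ENNReal.ofReal ((b - a) * (l + 1)) := by
    calc ∫⁻ x in Icc (a + h) (b - h), g x
        ≤ ∫⁻ _ in Icc (a + h) (b - h), ENNReal.ofReal (l + 1) := by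
          refine setLIntegral_mono measurable_const fun x hx => ?_
          have h1 : ¬ x < a + h := not_lt.2 hx.1
          simp only [hg, zetaCoeff, if_neg h1, if_pos hx.2]
          exact ENNReal.ofReal_le_ofReal (legendreKernel_zero_zero_le l)
      _ = ENNReal.ofReal ((l + 1) * (b - h - (a + h))) := by
          rw [setLIntegral_const, Real.volume_Icc, ← ENNReal.ofReal_mul (by positivity)]
      _ ≤ _ := ENNReal.ofReal_le_ofReal (by
          rw [mul_comm]
          exact mul_le_mul_of_nonneg_right (by linarith) (by positivity))
  calc ∫⁻ x in Icc a b, g x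
      ≤ ∫⁻ x in Ico a (a + h) ∪ (Icc (a + h) (b - h) ∪ Ioc (b - h) b), g x :=
        lintegral_mono_set hcover
    _ ≤ (∫⁻ x in Ico a (a + h), g x) +
        ((∫⁻ x in Icc (a + h) (b - h), g x) + ∫⁻ x in Ioc (b - h) b, g x) :=
        (lintegral_union_le _ _ _).trans (add_le_add le_rfl (lintegral_union_le _ _ _))
    _ ≤ ENNReal.ofReal (2 * h * (l + 1)) + (ENNReal.ofReal ((b - a) * (l + 1)) +
        ENNReal.ofReal (2 * h * (l + 1))) := add_le_add hL (add_le_add hM hR)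
    _ = _ := by
        have : 0 ≤ b - a := by linarith
        rw [← ENNReal.ofReal_add (by positivity) (by positivity),
          ← ENNReal.ofReal_add (by positivity) (by positivity)]
        congr 1; ring

end KDEP

namespace KDEP

/-! ### Test assortments -/

section assortments

variable {c : ℝ}

theorem two_le_numTests (hc0 : 0 < c) (hc1 : c < 1) : 2 ≤ numTests c := by
  have h : 1 < 1 / c := by rw [lt_div_iff₀ hc0]; linarith
  have : 1 < numTests c := Nat.lt_ceil.2 (by simpa using h)
  omega

theorem leftEnd_nonneg (hc0 : 0 < c) (hc1 : c < 1) (i : Fin (numTests c)) : 0 ≤ leftEnd c i := by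
  have h2 : (2 : ℝ) ≤ numTests c := by exact_mod_cast two_le_numTests hc0 hc1
  unfold leftEnd
  exact mul_nonneg (div_nonneg (by positivity) (by linarith)) (by linarith)

theorem rightEnd_le_one (hc0 : 0 < c) (hc1 : c < 1) (i : Fin (numTests c)) :
    rightEnd c i ≤ 1 := by
  have h2 : (2 : ℝ) ≤ numTests c := by exact_mod_cast two_le_numTests hc0 hc1
  have hi : ((i : ℕ) : ℝ) ≤ (numTests c : ℝ) - 1 := by
    have : (i : ℕ) + 1 ≤ numTests c := i.2
    have : ((i : ℕ) : ℝ) + 1 ≤ numTests c := by exact_mod_cast this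
    linarith
  have h1 : ((i : ℕ) : ℝ) / ((numTests c : ℝ) - 1) ≤ 1 := by
    rw [div_le_one (by linarith)]; exact hi
  unfold rightEnd leftEnd
  nlinarith

theorem rightEnd_sub_leftEnd (i : Fin (numTests c)) : rightEnd c i - leftEnd c i = c := by
  unfold rightEnd; ring

theorem testAssortment_subset (hc0 : 0 < c) (hc1 : c < 1) (i : Fin (numTests c)) :
    testAssortment c i ⊆ Icc 0 1 :=
  Icc_subset_Icc (leftEnd_nonneg hc0 hc1 i) (rightEnd_le_one hc0 hc1 i)

theorem volume_testAssortment (i : Fin (numTests c)) :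
    volume (testAssortment c i) = ENNReal.ofReal c := by
  rw [testAssortment, Real.volume_Icc, rightEnd_sub_leftEnd]

/-- Every product belongs to a test assortment. -/
theorem exists_mem_testAssortment (hc0 : 0 < c) (hc1 : c < 1) {x : ℝ} (hx : x ∈ Icc (0 : ℝ) 1) :
    ∃ i, x ∈ testAssortment c i := by
  have h2 := two_le_numTests hc0 hc1
  have h2' : (2 : ℝ) ≤ numTests c := by exact_mod_cast h2
  -- `N ≥ 1/c` makes the spacing `d` of the left end points at most the length `c`, so consecutive
  -- assortments leave no gap.
  have hN : (1 - c) ≤ ((numTests c : ℝ) - 1) * c := by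
    have : 1 / c ≤ numTests c := Nat.le_ceil _
    rw [div_le_iff₀ hc0] at this
    linarith
  have hd : 0 < (1 - c) / ((numTests c : ℝ) - 1) := div_pos (by linarith) (by linarith)
  set d := (1 - c) / ((numTests c : ℝ) - 1) with hdef
  have hdc : d ≤ c := by rw [hdef, div_le_iff₀ (by linarith)]; linarith
  have hleft : ∀ i : Fin (numTests c), leftEnd c i = i * d := by
    intro i; rw [hdef]; unfold leftEnd; ring
  -- Below `1 - c` the index is the last one whose left end does not exceed `x`; above, the last
  -- assortment `[1 - c, 1]` serves.
  by_cases hx1 : x ≤ 1 - c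
  · have hk : ⌊x / d⌋₊ < numTests c := by
      rw [Nat.floor_lt (div_nonneg hx.1 hd.le), div_lt_iff₀ hd]
      have : (numTests c : ℝ) * d = (1 - c) + d := by
        rw [hdef]
        have : (numTests c : ℝ) - 1 ≠ 0 := by linarith
        field_simp; ring
      rw [this]; linarith
    refine ⟨⟨_, hk⟩, ?_, ?_⟩
    · rw [hleft]
      have := Nat.floor_le (div_nonneg hx.1 hd.le)
      rw [le_div_iff₀ hd] at this
      exact this
    · rw [rightEnd, hleft]
      have := Nat.lt_floor_add_one (x / d)
      rw [div_lt_iff₀ hd] at this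
      change x ≤ (⌊x / d⌋₊ : ℝ) * d + c
      linarith
  · refine ⟨⟨numTests c - 1, by omega⟩, ?_, ?_⟩
    · rw [hleft]
      change ((numTests c - 1 : ℕ) : ℝ) * d ≤ x
      rw [Nat.cast_sub (by omega), hdef, Nat.cast_one, mul_div_cancel₀ _ (by linarith)]
      linarith
    · rw [rightEnd, hleft]
      change x ≤ ((numTests c - 1 : ℕ) : ℝ) * d + c
      rw [Nat.cast_sub (by omega), hdef, Nat.cast_one, mul_div_cancel₀ _ (by linarith)]
      linarith [hx.2]

theorem bandwidth_pos (hc0 : 0 < c) : 0 < bandwidth c :=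
  lt_min (by linarith) (by positivity)

theorem two_mul_bandwidth_le (i : Fin (numTests c)) :
    2 * bandwidth c ≤ rightEnd c i - leftEnd c i := by
  rw [rightEnd_sub_leftEnd]
  have : bandwidth c ≤ c / 2 := min_le_left _ _
  linarith

/-- This is the role of the cap `1/e` on the bandwidth: each further order gains at least a factor
`e`. -/
theorem one_le_neg_log_bandwidth (hc0 : 0 < c) : 1 ≤ -Real.log (bandwidth c) := by
  have h : bandwidth c ≤ 1 / Real.exp 1 := min_le_right _ _
  have := Real.log_le_log (bandwidth_pos hc0) h
  rw [Real.log_div one_ne_zero (Real.exp_pos 1).ne', Real.log_one, Real.log_exp] at this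
  linarith

end assortments

/-! ### Preference functions -/

section preferences

variable {c lo hi B : ℝ} {v : ℝ → ℝ}

/-- Smoothness is assumed on the open interval only, and the two end points are null. -/
theorem IsPreference.aemeasurable (hv : IsPreference lo hi B v) {S : Set ℝ}
    (hS : S ⊆ Icc 0 1) : AEMeasurable v (volume.restrict S) := by
  have h1 : AEMeasurable v (volume.restrict (Icc (0 : ℝ) 1)) := by
    rw [← restrict_Ioo_eq_restrict_Icc]
    exact hv.smooth.continuousOn.aemeasurable measurableSet_Ioo
  exact h1.mono_measure (Measure.restrict_mono hS le_rfl)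

theorem IsPreference.integrableOn (hv : IsPreference lo hi B v) {S : Set ℝ}
    (hSm : MeasurableSet S) (hS : S ⊆ Icc 0 1) : IntegrableOn v S := by
  have : IsFiniteMeasure (volume.restrict S) :=
    isFiniteMeasure_restrict.2 ((measure_mono hS).trans_lt (by simp)).ne
  refine Integrable.of_bound (hv.aemeasurable hS).aestronglyMeasurable (max |lo| |hi|) ?_
  refine (ae_restrict_iff' hSm).2 (ae_of_all _ fun x hx => ?_)
  have := hv.bounds x (hS hx)
  rw [Real.norm_eq_abs]
  exact abs_le_max_abs_abs this.1 this.2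

theorem IsPreference.le (hv : IsPreference lo hi B v) : lo ≤ hi :=
  (hv.bounds 0 (by simp)).1.trans (hv.bounds 0 (by simp)).2

theorem IsPreference.pos (hv : IsPreference lo hi B v) : 0 < B :=
  (abs_nonneg _).trans_lt (hv.deriv_lt 1 le_rfl (1 / 2) (by norm_num))

theorem measurableSet_testAssortment (i : Fin (numTests c)) :
    MeasurableSet (testAssortment c i) := measurableSet_Icc

theorem IsPreference.integrableOn_testAssortment (hv : IsPreference lo hi B v) (hc0 : 0 < c)
    (hc1 : c < 1) (i : Fin (numTests c)) : IntegrableOn v (testAssortment c i) :=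
  hv.integrableOn (measurableSet_testAssortment i) (testAssortment_subset hc0 hc1 i)

theorem IsPreference.le_mass (hv : IsPreference lo hi B v) (hc0 : 0 < c) (hc1 : c < 1)
    (i : Fin (numTests c)) : lo * c ≤ mass v (testAssortment c i) := by
  have h := setIntegral_mono_on (integrableOn_const (C := lo) (by simp [volume_testAssortment]))
    (hv.integrableOn_testAssortment hc0 hc1 i) (measurableSet_testAssortment i)
    fun x hx => (hv.bounds x (testAssortment_subset hc0 hc1 i hx)).1
  rw [setIntegral_const, Measure.real, volume_testAssortment, ENNReal.toReal_ofReal hc0.le,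
    smul_eq_mul] at h
  rw [mul_comm]; exact h

theorem IsPreference.mass_le (hv : IsPreference lo hi B v) (hc0 : 0 < c) (hc1 : c < 1)
    (i : Fin (numTests c)) : mass v (testAssortment c i) ≤ hi * c := by
  have h := setIntegral_mono_on (hv.integrableOn_testAssortment hc0 hc1 i)
    (integrableOn_const (C := hi) (by simp [volume_testAssortment]))
    (measurableSet_testAssortment i)
    fun x hx => (hv.bounds x (testAssortment_subset hc0 hc1 i hx)).2
  rw [setIntegral_const, Measure.real, volume_testAssortment, ENNReal.toReal_ofReal hc0.le,
    smul_eq_mul] at h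
  rw [mul_comm]; exact h

theorem IsPreference.mass_pos (hv : IsPreference lo hi B v) (hc0 : 0 < c) (hc1 : c < 1)
    (hlo : 0 < lo) (i : Fin (numTests c)) : 0 < mass v (testAssortment c i) :=
  (mul_pos hlo hc0).trans_le (hv.le_mass hc0 hc1 i)

theorem IsPreference.p_pos (hv : IsPreference lo hi B v) (hc0 : 0 < c) (hc1 : c < 1)
    (hlo : 0 < lo) (i : Fin (numTests c)) : 0 < p v c i := by
  have := hv.mass_pos hc0 hc1 hlo i
  unfold p noPurchaseProb; positivity

theorem IsPreference.one_sub_p (hv : IsPreference lo hi B v) (hc0 : 0 < c) (hc1 : c < 1)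
    (hlo : 0 < lo) (i : Fin (numTests c)) :
    1 - p v c i = mass v (testAssortment c i) * p v c i := by
  have := hv.mass_pos hc0 hc1 hlo i
  unfold p noPurchaseProb
  field_simp; ring

theorem IsPreference.p_lt_one (hv : IsPreference lo hi B v) (hc0 : 0 < c) (hc1 : c < 1)
    (hlo : 0 < lo) (i : Fin (numTests c)) : p v c i < 1 := by
  have := hv.one_sub_p hc0 hc1 hlo i
  have := mul_pos (hv.mass_pos hc0 hc1 hlo i) (hv.p_pos hc0 hc1 hlo i)
  linarith

theorem IsPreference.le_p (hv : IsPreference lo hi B v) (hc0 : 0 < c) (hc1 : c < 1)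
    (hlo : 0 < lo) (i : Fin (numTests c)) : 1 / (1 + hi * c) ≤ p v c i := by
  have := hv.mass_pos hc0 hc1 hlo i
  have := hv.mass_le hc0 hc1 i
  unfold p noPurchaseProb
  exact one_div_le_one_div_of_le (by linarith) (by linarith)

theorem IsPreference.le_one_sub_p (hv : IsPreference lo hi B v) (hc0 : 0 < c) (hc1 : c < 1)
    (hlo : 0 < lo) (i : Fin (numTests c)) : lo * c / (1 + lo * c) ≤ 1 - p v c i := by
  have h0 : 0 < lo * c := mul_pos hlo hc0
  have h1 := hv.le_mass hc0 hc1 i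
  have h2 : p v c i ≤ 1 / (1 + lo * c) := by
    unfold p noPurchaseProb
    exact one_div_le_one_div_of_le (by linarith) (by linarith)
  have h3 : lo * c / (1 + lo * c) = 1 - 1 / (1 + lo * c) := by field_simp; ring
  linarith

/-! ### The choice law -/

theorem measurable_isLeft : Measurable fun o : Outcome => o.isLeft :=
  measurable_fun_sum measurable_const measurable_const

theorem measurableSet_isLeft (t : Bool) : MeasurableSet {o : Outcome | o.isLeft = t} :=
  measurable_isLeft (measurableSet_singleton t)

theorem IsPreference.lintegral_eq (hv : IsPreference lo hi B v) (hc0 : 0 < c) (hc1 : c < 1)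
    (hlo : 0 < lo) (i : Fin (numTests c)) :
    ∫⁻ x in testAssortment c i, ENNReal.ofReal (v x) =
      ENNReal.ofReal (mass v (testAssortment c i)) := by
  rw [mass, ofReal_integral_eq_lintegral_ofReal (hv.integrableOn_testAssortment hc0 hc1 i)]
  exact (ae_restrict_iff' (measurableSet_testAssortment i)).2 (ae_of_all _ fun x hx =>
    hlo.le.trans (hv.bounds x (testAssortment_subset hc0 hc1 i hx)).1)

theorem choiceLaw_apply (S : Set ℝ) {T : Set Outcome} (hT : MeasurableSet T) :
    choiceLaw v S T = ENNReal.ofReal (noPurchaseProb v S) *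
      ((volume.restrict S).withDensity (fun x => ENNReal.ofReal (v x)) (Sum.inl ⁻¹' T) +
        T.indicator 1 (Sum.inr ())) := by
  rw [choiceLaw, Measure.smul_apply, Measure.add_apply, Measure.map_apply measurable_inl hT,
    Measure.dirac_apply' _ hT, smul_eq_mul, noPurchaseProb]

theorem IsPreference.choiceLaw_isLeft (hv : IsPreference lo hi B v) (hc0 : 0 < c) (hc1 : c < 1)
    (hlo : 0 < lo) (i : Fin (numTests c)) :
    choiceLaw v (testAssortment c i) {o | o.isLeft = true} = ENNReal.ofReal (1 - p v c i) := by
  rw [choiceLaw_apply _ (measurableSet_isLeft _)]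
  have h1 : (Sum.inl ⁻¹' {o : Outcome | o.isLeft = true} : Set ℝ) = univ := by ext; simp
  rw [h1, withDensity_apply _ MeasurableSet.univ, Measure.restrict_univ,
    hv.lintegral_eq hc0 hc1 hlo, hv.one_sub_p hc0 hc1 hlo,
    ENNReal.ofReal_mul (hv.mass_pos hc0 hc1 hlo i).le, p]
  simp [mul_comm]

theorem choiceLaw_isRight (i : Fin (numTests c)) :
    choiceLaw v (testAssortment c i) {o | o.isLeft = false} = ENNReal.ofReal (p v c i) := by
  rw [choiceLaw_apply _ (measurableSet_isLeft _)]
  have h1 : (Sum.inl ⁻¹' {o : Outcome | o.isLeft = false} : Set ℝ) = ∅ := by ext; simp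
  rw [h1, measure_empty, p, indicator_of_mem (by simp)]
  simp

end preferences

end KDEP

namespace KDEP

/-! ### Conditioning on the purchase pattern -/

/-- A bound for the expectation conditional on each value of a finite random variable carries over
to the expectation conditional on a set of values. -/
theorem lintegral_cond_preimage_le {Ω T : Type*} [MeasurableSpace Ω] {μ : Measure Ω}
    [IsFiniteMeasure μ] [Fintype T] [MeasurableSpace T] [MeasurableSingletonClass T] {Y : Ω → T}
    (hY : Measurable Y) (G : Set T) (F : Ω → ENNReal) (b : ENNReal)
    (hb : ∀ t ∈ G, μ (Y ⁻¹' {t}) ≠ 0 → ∫⁻ ω, F ω ∂(cond μ (Y ⁻¹' {t})) ≤ b) :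
    ∫⁻ ω, F ω ∂(cond μ (Y ⁻¹' G)) ≤ b := by
  classical
  by_cases h0 : μ (Y ⁻¹' G) = 0
  -- Conditioning on a null event gives the zero measure, so the bound holds trivially.
  · rw [cond_eq_zero_of_meas_eq_zero h0]; simp
  have hpart : ∀ t ∈ G, ∫⁻ ω in Y ⁻¹' {t}, F ω ∂μ ≤ b * μ (Y ⁻¹' {t}) := by
    intro t ht
    by_cases ht0 : μ (Y ⁻¹' {t}) = 0
    · rw [setLIntegral_measure_zero _ _ ht0]; exact zero_le
    · have h := hb t ht ht0
      rw [ProbabilityTheory.cond, lintegral_smul_measure, smul_eq_mul] at h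
      calc ∫⁻ ω in Y ⁻¹' {t}, F ω ∂μ
          = (μ (Y ⁻¹' {t}))⁻¹ * (∫⁻ ω in Y ⁻¹' {t}, F ω ∂μ) * μ (Y ⁻¹' {t}) := by
            rw [mul_comm, ← mul_assoc, ENNReal.mul_inv_cancel ht0 (measure_ne_top _ _), one_mul]
        _ ≤ _ := mul_le_mul_left h _
  have hU : Y ⁻¹' G = ⋃ t : G, Y ⁻¹' {(t : T)} := by ext ω; simp
  have hsum : ∫⁻ ω in Y ⁻¹' G, F ω ∂μ ≤ b * μ (Y ⁻¹' G) := by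
    have hm : μ (Y ⁻¹' G) = ∑' t : G, μ (Y ⁻¹' {(t : T)}) := by
      conv_lhs => rw [hU]
      refine measure_iUnion (fun s t hst => ?_) fun t => hY (measurableSet_singleton _)
      refine Disjoint.preimage _ ?_
      rw [disjoint_singleton]
      exact fun h => hst (Subtype.ext h)
    rw [hm, ← ENNReal.tsum_mul_left]
    conv_lhs => rw [hU]
    -- Countable subadditivity of the integral over the pieces is enough, so `F` need not be
    -- measurable.
    exact (lintegral_iUnion_le _ _).trans (ENNReal.tsum_le_tsum fun t => hpart t t.2)
  rw [ProbabilityTheory.cond, lintegral_smul_measure, smul_eq_mul]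
  calc (μ (Y ⁻¹' G))⁻¹ * ∫⁻ ω in Y ⁻¹' G, F ω ∂μ
      ≤ (μ (Y ⁻¹' G))⁻¹ * (b * μ (Y ⁻¹' G)) := mul_le_mul_right hsum _
    _ = b := by
      rw [mul_comm, mul_assoc, ENNReal.mul_inv_cancel h0 (measure_ne_top _ _), mul_one]

/-- Mean squared error of an average of pairwise independent variables. -/
theorem lintegral_sq_sub_average_le {Ω ι : Type*} [MeasurableSpace Ω] {ν : Measure Ω}
    [IsProbabilityMeasure ν] {s : Finset ι} (hs : s.Nonempty) {Y : ι → Ω → ℝ}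
    (hL : ∀ i ∈ s, MemLp (Y i) 2 ν)
    (hind : Set.Pairwise (s : Set ι) fun i j => IndepFun (Y i) (Y j) ν) {e V : ℝ} (f : ℝ)
    (he : ∀ i ∈ s, ∫ ω, Y i ω ∂ν = e) (hV : ∀ i ∈ s, ∫ ω, Y i ω ^ 2 ∂ν ≤ V) :
    ∫⁻ ω, ENNReal.ofReal ((f - 1 / (s.card : ℝ) * ∑ i ∈ s, Y i ω) ^ 2) ∂ν ≤
      ENNReal.ofReal (V / s.card + (f - e) ^ 2) := by
  have hn : (0 : ℝ) < s.card := by exact_mod_cast hs.card_pos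
  set n : ℝ := (s.card : ℝ) with hndef
  set Z : Ω → ℝ := ∑ i ∈ s, Y i with hZ
  have hZL : MemLp Z 2 ν := memLp_finsetSum' _ hL
  have hZint : Integrable Z ν := hZL.integrable (by norm_num)
  have hZmean : ∫ ω, Z ω ∂ν = n * e := by
    simp only [hZ, Finset.sum_apply]
    rw [integral_finsetSum _ fun i hi => (hL i hi).integrable (by norm_num),
      Finset.sum_congr rfl he]
    simp [hndef]
  have hvar : Var[Z; ν] ≤ n * V := by
    rw [hZ, IndepFun.variance_sum hL hind]
    -- Each variance is at most the second moment.
    calc ∑ i ∈ s, Var[Y i; ν] ≤ ∑ _i ∈ s, V := Finset.sum_le_sum fun i hi =>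
          (variance_le_expectation_sq (hL i hi).aestronglyMeasurable).trans (hV i hi)
      _ = n * V := by simp [hndef]
  have hW : MemLp (fun ω => f - 1 / n * Z ω) 2 ν := (memLp_const f).sub (hZL.const_mul _)
  have hfun : ∀ ω, f - 1 / n * ∑ i ∈ s, Y i ω = f - 1 / n * Z ω := by
    intro ω; simp [hZ]
  simp_rw [hfun]
  rw [← ofReal_integral_eq_lintegral_ofReal hW.integrable_sq (ae_of_all _ fun _ => sq_nonneg _)]
  refine ENNReal.ofReal_le_ofReal ?_
  have h1 := variance_eq_sub hW
  have h2 : Var[fun ω => f - 1 / n * Z ω; ν] = (1 / n) ^ 2 * Var[Z; ν] := by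
    have : (fun ω => f - 1 / n * Z ω) = fun ω => (-(1 / n)) * Z ω + f := by ext; ring
    rw [this, variance_add_const (hZL.const_mul _).aestronglyMeasurable, variance_const_mul,
      neg_sq]
  have h3 : ∫ ω, (f - 1 / n * Z ω) ∂ν = f - e := by
    rw [integral_sub (integrable_const f) (hZint.const_mul _), integral_const_mul, hZmean]
    simp
    field_simp
  rw [h2, h3] at h1
  have h4 : ∫ ω, (f - 1 / n * Z ω) ^ 2 ∂ν = (1 / n) ^ 2 * Var[Z; ν] + (f - e) ^ 2 := by
    rw [h1]
    simp
  rw [h4]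
  have h5 : (1 / n) ^ 2 * Var[Z; ν] ≤ (1 / n) ^ 2 * (n * V) := by gcongr
  have h6 : (1 / n) ^ 2 * (n * V) = V / n := by field_simp
  linarith

/-- The product bought in a purchase, and `0` if there is no purchase. -/
def product : Outcome → ℝ := Sum.elim id fun _ => 0

theorem measurable_product : Measurable product := measurable_id.sumElim measurable_const

/-- The pattern of purchases and no-purchases. -/
def pattern {Ω : Type*} {c : ℝ} {M : ℕ}
    (X : Fin (numTests c) → Fin M → Ω → Outcome) (ω : Ω) :
    Fin (numTests c) × Fin M → Bool :=
  fun q => (X q.1 q.2 ω).isLeft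

theorem pattern_preimage {Ω : Type*} {c : ℝ} {M : ℕ}
    (X : Fin (numTests c) → Fin M → Ω → Outcome) (τ : Fin (numTests c) × Fin M → Bool) :
    pattern X ⁻¹' {τ} = ⋂ q, (fun ω => (X q.1 q.2 ω).isLeft) ⁻¹' {τ q} := by
  ext ω
  simp [pattern, funext_iff]

section exploration

variable {Ω : Type*} [MeasurableSpace Ω] {μ : Measure Ω} {c lo hi B : ℝ} {v : ℝ → ℝ} {M : ℕ}
  {X : Fin (numTests c) → Fin M → Ω → Outcome}

theorem IsExploration.measurable_pattern (hX : IsExploration μ c v M X) :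
    Measurable (pattern X) :=
  measurable_pi_lambda _ fun q => measurable_isLeft.comp (hX.measurable q.1 q.2)

theorem IsExploration.measure_preimage (hX : IsExploration μ c v M X) (q : Fin (numTests c) × Fin M)
    {T : Set Outcome} (hT : MeasurableSet T) :
    μ (X q.1 q.2 ⁻¹' T) = choiceLaw v (testAssortment c q.1) T := by
  rw [← hX.law q.1 q.2, Measure.map_apply (hX.measurable _ _) hT]

theorem IsExploration.measure_isLeft (hX : IsExploration μ c v M X) (hv : IsPreference lo hi B v)
    (hc0 : 0 < c) (hc1 : c < 1) (hlo : 0 < lo) (q : Fin (numTests c) × Fin M) :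
    μ ((fun ω => (X q.1 q.2 ω).isLeft) ⁻¹' {true}) = ENNReal.ofReal (1 - p v c q.1) := by
  rw [← hv.choiceLaw_isLeft hc0 hc1 hlo, ← hX.measure_preimage q (measurableSet_isLeft true)]
  rfl

theorem IsExploration.measure_isRight (hX : IsExploration μ c v M X)
    (q : Fin (numTests c) × Fin M) :
    μ ((fun ω => (X q.1 q.2 ω).isLeft) ⁻¹' {false}) = ENNReal.ofReal (p v c q.1) := by
  rw [← choiceLaw_isRight, ← hX.measure_preimage q (measurableSet_isLeft false)]
  rfl

theorem IsExploration.measure_isLeft_ne_zero (hX : IsExploration μ c v M X)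
    (hv : IsPreference lo hi B v) (hc0 : 0 < c) (hc1 : c < 1) (hlo : 0 < lo)
    (q : Fin (numTests c) × Fin M) (t : Bool) :
    μ ((fun ω => (X q.1 q.2 ω).isLeft) ⁻¹' {t}) ≠ 0 := by
  cases t
  · rw [hX.measure_isRight, Ne, ENNReal.ofReal_eq_zero, not_le]
    exact hv.p_pos hc0 hc1 hlo _
  · rw [hX.measure_isLeft hv hc0 hc1 hlo, Ne, ENNReal.ofReal_eq_zero, not_le, sub_pos]
    exact hv.p_lt_one hc0 hc1 hlo _

/-- Each outcome is paired with its own conditioning variable; conditioning on these variables then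
preserves independence. -/
theorem IsExploration.iIndepFun_prod (hX : IsExploration μ c v M X) :
    iIndepFun (fun (q : Fin (numTests c) × Fin M) ω => (X q.1 q.2 ω, (X q.1 q.2 ω).isLeft)) μ :=
  hX.indep.comp (fun _ o => (o, o.isLeft)) fun _ => measurable_id.prodMk measurable_isLeft

/-- A pattern is an intersection of events of positive probability, one for each customer, so
conditioning reweights every coordinate separately. -/
theorem IsExploration.iIndepFun_cond (hX : IsExploration μ c v M X) (hv : IsPreference lo hi B v)
    (hc0 : 0 < c) (hc1 : c < 1) (hlo : 0 < lo) (τ : Fin (numTests c) × Fin M → Bool) :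
    iIndepFun (fun q : Fin (numTests c) × Fin M => X q.1 q.2) (cond μ (pattern X ⁻¹' {τ})) := by
  rw [pattern_preimage]
  exact hX.iIndepFun_prod.cond (fun q => measurable_isLeft.comp (hX.measurable q.1 q.2))
    (fun q => hX.measure_isLeft_ne_zero hv hc0 hc1 hlo q _) fun _ => measurableSet_singleton _

/-- Every pattern has positive probability. -/
theorem IsExploration.measure_pattern_ne_zero (hX : IsExploration μ c v M X)
    (hv : IsPreference lo hi B v) (hc0 : 0 < c) (hc1 : c < 1) (hlo : 0 < lo)
    (τ : Fin (numTests c) × Fin M → Bool) : μ (pattern X ⁻¹' {τ}) ≠ 0 := by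
  rw [pattern_preimage]
  have h := hX.indep.meas_iInter (s := fun q => (fun ω => (X q.1 q.2 ω).isLeft) ⁻¹' {τ q})
    fun q => ⟨{o | o.isLeft = τ q}, measurableSet_isLeft _, rfl⟩
  rw [h, Finset.prod_ne_zero_iff]
  exact fun q _ => hX.measure_isLeft_ne_zero hv hc0 hc1 hlo q _

/-- Conditional on the pattern, the purchased products have the normalized density. -/
theorem IsExploration.map_product_cond (hX : IsExploration μ c v M X)
    (hv : IsPreference lo hi B v) (hc0 : 0 < c) (hc1 : c < 1) (hlo : 0 < lo)
    (τ : Fin (numTests c) × Fin M → Bool) (q : Fin (numTests c) × Fin M) (hq : τ q = true) :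
    (cond μ (pattern X ⁻¹' {τ})).map (fun ω => product (X q.1 q.2 ω)) =
      (volume.restrict (testAssortment c q.1)).withDensity
        fun x => ENNReal.ofReal (density v c q.1 x) := by
  ext T hT
  have hmeas : ∀ q : Fin (numTests c) × Fin M, Measurable fun ω => (X q.1 q.2 ω).isLeft :=
    fun q => measurable_isLeft.comp (hX.measurable q.1 q.2)
  have hprod : Measurable fun ω => product (X q.1 q.2 ω) :=
    measurable_product.comp (hX.measurable _ _)
  rw [Measure.map_apply hprod hT]
  -- By independence, for an event about customer `q` only the factor of `q` in the pattern matters.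
  have h1 := cond_iInter (μ := μ) (s := {q})
    (X := fun (q : Fin (numTests c) × Fin M) => X q.1 q.2)
    (Y := fun (q : Fin (numTests c) × Fin M) ω => (X q.1 q.2 ω).isLeft)
    (t := fun q => {τ q}) (f := fun q => (fun ω => product (X q.1 q.2 ω)) ⁻¹' T) hmeas
    hX.iIndepFun_prod (fun q _ => ⟨product ⁻¹' T, measurable_product hT, rfl⟩)
    (fun q _ => hX.measure_isLeft_ne_zero hv hc0 hc1 hlo q _) fun _ => measurableSet_singleton _
  simp only [Finset.mem_singleton, iInter_iInter_eq_left, Finset.prod_singleton] at h1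
  rw [pattern_preimage, h1, cond_apply (hmeas q (measurableSet_singleton _)), hq,
    hX.measure_isLeft hv hc0 hc1 hlo]
  have h2 : (fun ω => (X q.1 q.2 ω).isLeft) ⁻¹' {true} ∩
      (fun ω => product (X q.1 q.2 ω)) ⁻¹' T =
      X q.1 q.2 ⁻¹' ({o | o.isLeft = true} ∩ product ⁻¹' T) := rfl
  rw [h2, hX.measure_preimage q ((measurableSet_isLeft _).inter (measurable_product hT)),
    choiceLaw_apply _ ((measurableSet_isLeft _).inter (measurable_product hT))]
  have h3 : (Sum.inl ⁻¹' ({o : Outcome | o.isLeft = true} ∩ product ⁻¹' T) : Set ℝ) = T := by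
    ext; simp [product]
  rw [h3, indicator_of_notMem (by simp), add_zero, withDensity_apply _ hT, withDensity_apply _ hT]
  have hα := hv.mass_pos hc0 hc1 hlo q.1
  have hp := hv.p_pos hc0 hc1 hlo q.1
  set α := mass v (testAssortment c q.1) with hαdef
  have h4 : ∀ x, ENNReal.ofReal (density v c q.1 x) =
      ENNReal.ofReal α⁻¹ * ENNReal.ofReal (v x) := by
    intro x
    rw [← ENNReal.ofReal_mul (by positivity), density, ← hαdef, div_eq_inv_mul]
  simp_rw [h4]
  rw [lintegral_const_mul' _ _ ENNReal.ofReal_ne_top, ← mul_assoc, hv.one_sub_p hc0 hc1 hlo,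
    ← ENNReal.ofReal_inv_of_pos (by positivity)]
  change ENNReal.ofReal (α * p v c q.1)⁻¹ * ENNReal.ofReal (p v c q.1) * _ = _
  rw [← ENNReal.ofReal_mul (by positivity)]
  -- What remains is `p / (1 - p) = 1 / α`, since `1 - p = α p`.
  congr 2
  field_simp

end exploration

end KDEP

namespace KDEP

/-! ### Local polynomial approximation and normalized densities -/

open Polynomial in
/-- Polynomial approximation of a preference function on an interval of length at most `2 h`. -/
theorem IsPreference.exists_polynomial {lo hi B : ℝ} {v : ℝ → ℝ} (hv : IsPreference lo hi B v)
    {h A A' : ℝ} (hAA : A < A') (hA : 0 ≤ A) (hA' : A' ≤ 1) (hlen : A' - A ≤ 2 * h) (l : ℕ) :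
    ∃ q : ℝ[X], q.degree < (l + 1 : ℕ) ∧ ∀ y ∈ Ioo A A',
      |v y - q.eval y| ≤ 2 * B * (l + 2) * (h / 2) ^ (l + 1) := by
  have hsub : Ioo A A' ⊆ Ioo 0 1 := Ioo_subset_Ioo hA hA'
  obtain ⟨q, hq, hq'⟩ := exists_polynomial_abs_sub_le hAA (hv.smooth.mono hsub) l
    -- The hypothesis divides the derivative of order `l + 1` by `(l+2)!`, whereas interpolation
    -- divides it by `(l+1)!`.
    (D := B * (l + 2)) (fun y hy => by
      have := (hv.deriv_lt (l + 1) (by omega) y (hsub hy)).le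
      rw [abs_div, abs_of_pos (by positivity : (0 : ℝ) < (l + 1 + 1).factorial),
        Nat.factorial_succ (l + 1), div_le_iff₀ (by positivity)] at this
      rw [div_le_iff₀ (by positivity)]
      push_cast at this
      linarith)
  refine ⟨q, hq, fun y hy => (hq' y hy).trans ?_⟩
  have hB := hv.pos
  have h0 : 0 ≤ (A' - A) / 4 := by linarith
  have h1 : (A' - A) / 4 ≤ h / 2 := by linarith
  rw [← mul_assoc]
  gcongr

section density

variable {c lo hi B : ℝ} {v : ℝ → ℝ}

theorem IsPreference.density_nonneg (hv : IsPreference lo hi B v) (hc0 : 0 < c) (hc1 : c < 1)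
    (hlo : 0 < lo) (i : Fin (numTests c)) {x : ℝ} (hx : x ∈ testAssortment c i) :
    0 ≤ density v c i x :=
  div_nonneg (hlo.le.trans (hv.bounds x (testAssortment_subset hc0 hc1 i hx)).1)
    (hv.mass_pos hc0 hc1 hlo i).le

theorem IsPreference.density_le (hv : IsPreference lo hi B v) (hc0 : 0 < c) (hc1 : c < 1)
    (hlo : 0 < lo) (i : Fin (numTests c)) {x : ℝ} (hx : x ∈ testAssortment c i) :
    density v c i x ≤ hi / (lo * c) := by
  have h1 := hv.bounds x (testAssortment_subset hc0 hc1 i hx)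
  exact div_le_div₀ (hlo.le.trans (h1.1.trans h1.2)) h1.2 (mul_pos hlo hc0)
    (hv.le_mass hc0 hc1 i)

theorem IsPreference.aemeasurable_density (hv : IsPreference lo hi B v) (hc0 : 0 < c)
    (hc1 : c < 1) (i : Fin (numTests c)) :
    AEMeasurable (density v c i) (volume.restrict (testAssortment c i)) :=
  (hv.aemeasurable (testAssortment_subset hc0 hc1 i)).div_const _

theorem IsPreference.integrableOn_density (hv : IsPreference lo hi B v) (hc0 : 0 < c)
    (hc1 : c < 1) (i : Fin (numTests c)) : IntegrableOn (density v c i) (testAssortment c i) :=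
  (hv.integrableOn_testAssortment hc0 hc1 i).div_const _

theorem IsPreference.integral_density (hv : IsPreference lo hi B v) (hc0 : 0 < c)
    (hc1 : c < 1) (hlo : 0 < lo) (i : Fin (numTests c)) :
    ∫ x in testAssortment c i, density v c i x = 1 := by
  unfold density
  rw [integral_div]
  exact div_self (hv.mass_pos hc0 hc1 hlo i).ne'

end density

/-! ### Measurability of the kernel -/

theorem measurable_gammaCoeff (h a b : ℝ) : Measurable (gammaCoeff h a b) := by
  unfold gammaCoeff
  refine Measurable.ite measurableSet_Iio (by fun_prop) (Measurable.ite measurableSet_Iic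
    measurable_const (by fun_prop))

theorem measurable_zetaCoeff (h a b : ℝ) : Measurable (zetaCoeff h a b) := by
  unfold zetaCoeff
  refine Measurable.ite measurableSet_Iio (by fun_prop) (Measurable.ite measurableSet_Iic
    measurable_const (by fun_prop))

theorem measurable_scaledKernel (h : ℝ) (l : ℕ) (a b : ℝ) :
    Measurable fun z : ℝ × ℝ => scaledKernel h l a b z.1 z.2 := by
  have hγ : Measurable fun z : ℝ × ℝ => gammaCoeff h a b z.1 :=
    (measurable_gammaCoeff h a b).comp measurable_fst
  have hζ : Measurable fun z : ℝ × ℝ => zetaCoeff h a b z.1 :=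
    (measurable_zetaCoeff h a b).comp measurable_fst
  have hφ : ∀ j, Measurable (legendre j) := fun j => (continuous_legendre j).measurable
  have hs : MeasurableSet {z : ℝ × ℝ | (z.2 - z.1) / h ∈ shiftedSupport h a b z.1} := by
    have h1 : MeasurableSet {z : ℝ × ℝ | -min 1 ((z.1 - a) / h) ≤ (z.2 - z.1) / h} :=
      measurableSet_le (by fun_prop) (by fun_prop)
    have h2 : MeasurableSet {z : ℝ × ℝ | (z.2 - z.1) / h ≤ min 1 ((b - z.1) / h)} :=
      measurableSet_le (by fun_prop) (by fun_prop)
    exact h1.inter h2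
  unfold scaledKernel kernel
  exact Measurable.div_const (Measurable.ite hs (hγ.mul (Finset.measurable_sum _ fun j _ =>
    ((hφ j).comp hζ).mul ((hφ j).comp ((hγ.mul (by fun_prop)).add hζ)))) measurable_const) h

theorem measurable_scaledKernel_right (h : ℝ) (l : ℕ) (a b x : ℝ) :
    Measurable fun y => scaledKernel h l a b x y := by
  have hk := measurable_scaledKernel h l a b
  generalize scaledKernel h l a b = f at *
  exact hk.comp (measurable_const.prodMk measurable_id)

/-- Joint measurability, needed to exchange the expectation with the integral over `x`. -/
theorem aemeasurable_sq_sub_average {Ω ι : Type*} [MeasurableSpace Ω] {ν : Measure Ω} [SFinite ν]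
    {ν' : Measure ℝ} [SFinite ν'] {f : ℝ → ℝ → ℝ} (hf : Measurable fun z : ℝ × ℝ => f z.1 z.2)
    {ρ : ℝ → ℝ} (hρ : AEMeasurable ρ ν') (s : Finset ι) {P : ι → Ω → ℝ}
    (hP : ∀ m, Measurable (P m)) (r : ℝ) :
    AEMeasurable (fun z : Ω × ℝ => ENNReal.ofReal
      ((ρ z.2 - r * ∑ m ∈ s, f z.2 (P m z.1)) ^ 2)) (ν.prod ν') := by
  have h1 : AEMeasurable (fun z : Ω × ℝ => ρ z.2) (ν.prod ν') := hρ.comp_snd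
  have h2 : Measurable fun z : Ω × ℝ => r * ∑ m ∈ s, f z.2 (P m z.1) :=
    measurable_const.mul (Finset.measurable_sum _ fun m _ =>
      hf.comp (measurable_snd.prodMk ((hP m).comp measurable_fst)))
  exact ((h1.sub h2.aemeasurable).pow_const 2).ennreal_ofReal

theorem exists_abs_scaledKernel_le {h a b x : ℝ} (hh : 0 < h) (hab : 2 * h ≤ b - a)
    (hx : x ∈ Icc a b) (l : ℕ) : ∃ K, ∀ y, |scaledKernel h l a b x y| ≤ K := by
  obtain ⟨K, hK⟩ := (isCompact_Icc (a := windowLeft h a x)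
    (b := windowRight h b x)).exists_bound_of_continuousOn
    (continuous_window_kernel (h := h) (a := a) (b := b) (x := x) l).continuousOn
  refine ⟨max K 0, fun y => ?_⟩
  rw [scaledKernel_eq hh hab hx]
  by_cases hy : y ∈ Icc (windowLeft h a x) (windowRight h b x)
  · rw [indicator_of_mem hy]
    exact (hK y hy).trans (le_max_left _ _)
  · rw [indicator_of_notMem hy]; simp

/-! ### Mean squared error for a given purchase pattern -/

section exploration

variable {Ω : Type*} [MeasurableSpace Ω] {μ : Measure Ω} {c lo hi B : ℝ} {v : ℝ → ℝ} {M : ℕ}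
  {X : Fin (numTests c) → Fin M → Ω → Outcome}

/-- The customers who buy from the test assortment `i` under the pattern `τ`. -/
def buyers {c : ℝ} {M : ℕ} (τ : Fin (numTests c) × Fin M → Bool) (i : Fin (numTests c)) :
    Finset (Fin M) :=
  Finset.univ.filter fun m => τ (i, m) = true

theorem IsExploration.integral_product_cond (hX : IsExploration μ c v M X)
    (hv : IsPreference lo hi B v) (hc0 : 0 < c) (hc1 : c < 1) (hlo : 0 < lo)
    (τ : Fin (numTests c) × Fin M → Bool) (i : Fin (numTests c)) {m : Fin M}
    (hm : m ∈ buyers τ i) {g : ℝ → ℝ} (hg : Measurable g) :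
    ∫ ω, g (product (X i m ω)) ∂(cond μ (pattern X ⁻¹' {τ})) =
      ∫ x in testAssortment c i, g x * density v c i x := by
  have hq : τ (i, m) = true := by simpa [buyers] using hm
  have hprod : Measurable fun ω => product (X i m ω) :=
    measurable_product.comp (hX.measurable i m)
  have hmap := hX.map_product_cond hv hc0 hc1 hlo τ (i, m) hq
  rw [← integral_map (φ := fun ω => product (X i m ω)) hprod.aemeasurable
    hg.aestronglyMeasurable]
  change ∫ y, g y ∂(Measure.map (fun ω => product (X (i, m).1 (i, m).2 ω)) _) = _
  rw [hmap, integral_withDensity_eq_integral_toReal_smul₀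
    (hv.aemeasurable_density hc0 hc1 i).ennreal_ofReal (ae_of_all _ fun _ => ENNReal.ofReal_lt_top)]
  refine setIntegral_congr_fun (measurableSet_testAssortment i) fun x hx => ?_
  simp only [smul_eq_mul, ENNReal.toReal_ofReal (hv.density_nonneg hc0 hc1 hlo i hx)]
  ring

/-- The bias bound for a kernel of order `l`. -/
noncomputable def biasBound (c lo B : ℝ) (l : ℕ) : ℝ :=
  2 * B / (lo * c) * (l + 2) * (bandwidth c / 2) ^ (l + 1)

/-- Mean squared error at a point. -/
theorem IsExploration.lintegral_sq_sub_le (hX : IsExploration μ c v M X) [IsProbabilityMeasure μ]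
    (hv : IsPreference lo hi B v) (hc0 : 0 < c) (hc1 : c < 1) (hlo : 0 < lo)
    (τ : Fin (numTests c) × Fin M → Bool) (i : Fin (numTests c)) (hne : (buyers τ i).Nonempty)
    (l : ℕ) {x : ℝ} (hx : x ∈ Ioo (leftEnd c i) (rightEnd c i)) :
    ∫⁻ ω, ENNReal.ofReal ((density v c i x - 1 / ((buyers τ i).card : ℝ) * ∑ m ∈ buyers τ i,
        scaledKernel (bandwidth c) l (leftEnd c i) (rightEnd c i) x (product (X i m ω))) ^ 2)
        ∂(cond μ (pattern X ⁻¹' {τ})) ≤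
      ENNReal.ofReal ((2 * (hi / (lo * c)) / bandwidth c / (buyers τ i).card +
          4 * biasBound c lo B l ^ 2) * legendreKernel l
          (zetaCoeff (bandwidth c) (leftEnd c i) (rightEnd c i) x)
          (zetaCoeff (bandwidth c) (leftEnd c i) (rightEnd c i) x) +
        2 * biasBound c lo B l ^ 2) := by
  set h := bandwidth c with hh
  set a := leftEnd c i
  set b := rightEnd c i
  have hh0 : 0 < h := bandwidth_pos hc0
  have hab : 2 * h ≤ b - a := two_mul_bandwidth_le i
  have hx' : x ∈ Icc a b := Ioo_subset_Icc_self hx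
  have hS : testAssortment c i = Icc a b := rfl
  have hprob : IsProbabilityMeasure (cond μ (pattern X ⁻¹' {τ})) :=
    cond_isProbabilityMeasure (hX.measure_pattern_ne_zero hv hc0 hc1 hlo τ)
  have hk : Measurable (scaledKernel h l a b x) := measurable_scaledKernel_right h l a b x
  have hkp : Measurable fun o => scaledKernel h l a b x (product o) := hk.comp measurable_product
  obtain ⟨K, hK⟩ := exists_abs_scaledKernel_le hh0 hab hx' l
  have hind := hX.iIndepFun_cond hv hc0 hc1 hlo τ
  have hρi : IntegrableOn (density v c i) (Icc a b) := hv.integrableOn_density hc0 hc1 i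
  have hα := hv.mass_pos hc0 hc1 hlo i
  have hB := hv.pos
  have hF0 : 0 ≤ hi / (lo * c) :=
    (hv.density_nonneg hc0 hc1 hlo i hx').trans (hv.density_le hc0 hc1 hlo i hx')
  have hV := integral_scaledKernel_sq_mul_le hh0 hab hx' l hρi hF0
    fun y hy => hv.density_le hc0 hc1 hlo i hy
  set ν := cond μ (pattern X ⁻¹' {τ}) with hν
  set Y : Fin M → Ω → ℝ := fun m ω => scaledKernel h l a b x (product (X i m ω)) with hY
  have hYm : ∀ m, Measurable (Y m) := fun m => hkp.comp (hX.measurable i m)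
  have hL : ∀ m ∈ buyers τ i, MemLp (Y m) 2 ν := fun m _ =>
    MemLp.of_bound (hYm m).aestronglyMeasurable K (ae_of_all _ fun ω => hK _)
  have hYind : Set.Pairwise (buyers τ i : Set (Fin M)) fun m m' => IndepFun (Y m) (Y m') ν := by
    intro m _ m' _ hmm
    have hne' : ((i, m) : Fin (numTests c) × Fin M) ≠ (i, m') := by simpa using hmm
    have h1 : IndepFun (X i m) (X i m') ν := hind.indepFun hne'
    exact h1.comp hkp hkp
  have hmean : ∀ m ∈ buyers τ i, ∫ ω, Y m ω ∂ν =
      ∫ y in testAssortment c i, scaledKernel h l a b x y * density v c i y :=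
    fun m hm => hX.integral_product_cond hv hc0 hc1 hlo τ i hm hk
  have hsq : ∀ m ∈ buyers τ i, ∫ ω, Y m ω ^ 2 ∂ν ≤ 2 * (hi / (lo * c)) / h *
      legendreKernel l (zetaCoeff h a b x) (zetaCoeff h a b x) :=
    fun m hm => (hX.integral_product_cond hv hc0 hc1 hlo τ i hm (hk.pow_const 2)).trans_le hV
  have hmse := lintegral_sq_sub_average_le hne hL hYind (density v c i x) hmean hsq
  refine hmse.trans (ENNReal.ofReal_le_ofReal ?_)
  have hr := windowRadius_mem hh0 hab hx'
  have hrdef : windowRight h b x - windowLeft h a x = 2 * windowRadius h a b x := by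
    unfold windowRadius; ring
  -- The window lies in `[0,1]` and has length at most `2h`. Dividing the approximant of `v` by the
  -- mass then approximates the density.
  obtain ⟨q, hq, hqv⟩ := hv.exists_polynomial (h := h) (A := windowLeft h a x)
    (A' := windowRight h b x) (by linarith [hr.1])
    ((leftEnd_nonneg hc0 hc1 i).trans (le_max_left _ _))
    ((min_le_left _ _).trans (rightEnd_le_one hc0 hc1 i)) (by linarith [hr.2]) l
  have hbias := sq_sub_integral_scaledKernel_le hh0 hab hx l hρi
    (q := Polynomial.C (mass v (testAssortment c i))⁻¹ * q) (δ := biasBound c lo B l)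
    (by rw [Polynomial.degree_C_mul (inv_ne_zero hα.ne')]; exact hq) (fun y hy => by
      have h1 := hqv y hy
      have h2 : density v c i y - (Polynomial.C (mass v (testAssortment c i))⁻¹ * q).eval y =
          (v y - q.eval y) / mass v (testAssortment c i) := by
        rw [density, Polynomial.eval_mul, Polynomial.eval_C]; field_simp
      rw [h2, abs_div, abs_of_pos hα]
      calc |v y - q.eval y| / mass v (testAssortment c i)
          ≤ 2 * B * (l + 2) * (h / 2) ^ (l + 1) / (lo * c) :=
            div_le_div₀ (by positivity) h1 (mul_pos hlo hc0) (hv.le_mass hc0 hc1 i)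
        _ = biasBound c lo B l := by rw [biasBound, ← hh]; ring)
  rw [hS]
  refine (add_le_add le_rfl hbias).trans (le_of_eq ?_)
  ring

/-- Mean integrated squared error for a given pattern and a given order. -/
theorem IsExploration.lintegral_lintegral_sq_sub_le (hX : IsExploration μ c v M X)
    [IsProbabilityMeasure μ]
    (hv : IsPreference lo hi B v) (hc0 : 0 < c) (hc1 : c < 1) (hlo : 0 < lo)
    (τ : Fin (numTests c) × Fin M → Bool) (i : Fin (numTests c)) (hne : (buyers τ i).Nonempty)
    (l : ℕ) :
    ∫⁻ ω, (∫⁻ x in testAssortment c i, ENNReal.ofReal ((density v c i x -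
        1 / ((buyers τ i).card : ℝ) * ∑ m ∈ buyers τ i,
        scaledKernel (bandwidth c) l (leftEnd c i) (rightEnd c i) x (product (X i m ω))) ^ 2))
        ∂(cond μ (pattern X ⁻¹' {τ})) ≤
      ENNReal.ofReal ((2 * (hi / (lo * c)) / bandwidth c / (buyers τ i).card +
          4 * biasBound c lo B l ^ 2) * ((c + 4 * bandwidth c) * (l + 1)) +
        2 * biasBound c lo B l ^ 2 * c) := by
  have hh0 : 0 < bandwidth c := bandwidth_pos hc0
  have hab := two_mul_bandwidth_le (c := c) i
  have hF0 : 0 ≤ hi / (lo * c) := by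
    have := hv.le
    have : 0 < lo * c := mul_pos hlo hc0
    exact div_nonneg (by linarith) this.le
  set D := 2 * (hi / (lo * c)) / bandwidth c / (buyers τ i).card + 4 * biasBound c lo B l ^ 2
    with hD
  have hD0 : 0 ≤ D := by positivity
  -- After the exchange the pointwise bound applies; it is affine in the diagonal value of the
  -- kernel, whose integral is known.
  rw [lintegral_lintegral_swap]
  · rw [testAssortment, ← restrict_Ioo_eq_restrict_Icc]
    have hpt : ∀ x ∈ Ioo (leftEnd c i) (rightEnd c i), _ ≤ ENNReal.ofReal (D * legendreKernel l
        (zetaCoeff (bandwidth c) (leftEnd c i) (rightEnd c i) x)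
        (zetaCoeff (bandwidth c) (leftEnd c i) (rightEnd c i) x) +
        2 * biasBound c lo B l ^ 2) := fun x hx =>
      hX.lintegral_sq_sub_le hv hc0 hc1 hlo τ i hne l hx
    clear_value D
    refine (setLIntegral_mono' measurableSet_Ioo hpt).trans ?_
    rw [restrict_Ioo_eq_restrict_Icc]
    have hnn := fun x => legendreKernel_self_nonneg l
      (zetaCoeff (bandwidth c) (leftEnd c i) (rightEnd c i) x)
    have h1 : ∀ x, ENNReal.ofReal (D * legendreKernel l
        (zetaCoeff (bandwidth c) (leftEnd c i) (rightEnd c i) x)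
        (zetaCoeff (bandwidth c) (leftEnd c i) (rightEnd c i) x) + 2 * biasBound c lo B l ^ 2) =
        ENNReal.ofReal D * ENNReal.ofReal (legendreKernel l
        (zetaCoeff (bandwidth c) (leftEnd c i) (rightEnd c i) x)
        (zetaCoeff (bandwidth c) (leftEnd c i) (rightEnd c i) x)) +
        ENNReal.ofReal (2 * biasBound c lo B l ^ 2) := by
      intro x
      rw [ENNReal.ofReal_add (mul_nonneg hD0 (hnn x)) (by positivity), ENNReal.ofReal_mul hD0]
    simp_rw [h1]
    rw [lintegral_add_right _ measurable_const, lintegral_const_mul' _ _ ENNReal.ofReal_ne_top,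
      setLIntegral_const, Real.volume_Icc, rightEnd_sub_leftEnd]
    rw [ENNReal.ofReal_add (by positivity) (by positivity), ENNReal.ofReal_mul hD0,
      ENNReal.ofReal_mul (p := 2 * biasBound c lo B l ^ 2) (by positivity)]
    have h2 := lintegral_legendreKernel_zetaCoeff_le hh0 hab l
    rw [rightEnd_sub_leftEnd] at h2
    exact add_le_add (mul_le_mul_right h2 _) le_rfl
  · have hk := measurable_scaledKernel (bandwidth c) l (leftEnd c i) (rightEnd c i)
    have hp : ∀ m, Measurable fun ω => product (X i m ω) :=
      fun m => measurable_product.comp (hX.measurable i m)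
    exact aemeasurable_sq_sub_average hk (hv.aemeasurable_density hc0 hc1 i) _ hp _

end exploration

end KDEP

namespace KDEP

/-! ### The order of the kernel -/

section order

variable {c lo hi B : ℝ} {v : ℝ → ℝ} {n : ℕ}

theorem log_nonneg_of_one_le (hc0 : 0 < c) (hn : 1 ≤ n) :
    0 ≤ Real.log (-2 * (n : ℝ) * Real.log (bandwidth c)) := by
  have hL := one_le_neg_log_bandwidth hc0
  have hn' : (1 : ℝ) ≤ n := by exact_mod_cast hn
  exact Real.log_nonneg (by nlinarith)

/-- Rounding loses at most `1/2`, which together with the shift `-1/2` costs `1`. Truncation at `0`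
only helps. -/
theorem le_order (c : ℝ) (n : ℕ) :
    1 / 2 * Real.log (-2 * (n : ℝ) * Real.log (bandwidth c)) ≤ (order c n : ℝ) + 1 := by
  have h1 := abs_le.1 (abs_sub_round
    (1 / 2 * Real.log (-2 * (n : ℝ) * Real.log (bandwidth c)) - 1 / 2))
  have h2 : (round (1 / 2 * Real.log (-2 * (n : ℝ) * Real.log (bandwidth c)) - 1 / 2) : ℝ) ≤
      (order c n : ℝ) := by
    unfold order
    exact_mod_cast Int.self_le_toNat _
  linarith [h1.2]

/-- Rounding up by at most `1/2` is offset by the shift `-1/2`; truncation at `0` is harmless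
because the logarithm is nonnegative. -/
theorem order_le (hc0 : 0 < c) (hn : 1 ≤ n) :
    (order c n : ℝ) ≤ 1 / 2 * Real.log (-2 * (n : ℝ) * Real.log (bandwidth c)) := by
  have h0 := log_nonneg_of_one_le hc0 hn
  have h1 := abs_le.1 (abs_sub_round
    (1 / 2 * Real.log (-2 * (n : ℝ) * Real.log (bandwidth c)) - 1 / 2))
  have h2 : (order c n : ℝ) =
      max (round (1 / 2 * Real.log (-2 * (n : ℝ) * Real.log (bandwidth c)) - 1 / 2) : ℝ) 0 := by
    unfold order
    exact_mod_cast Int.toNat_eq_max _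
  rw [h2]
  exact max_le (by linarith [h1.1]) (by linarith)

/-- The logarithm splits into `log n` and a constant, and `1 ≤ log M` absorbs the constants. -/
theorem order_add_one_le (hc0 : 0 < c) (hn : 1 ≤ n) {M : ℝ} (hnM : (n : ℝ) ≤ M)
    (hM : 1 ≤ Real.log M) :
    (order c n : ℝ) + 1 ≤ (2 + Real.log (-2 * Real.log (bandwidth c))) * Real.log M := by
  have hL := one_le_neg_log_bandwidth hc0
  have hn' : (1 : ℝ) ≤ n := by exact_mod_cast hn
  have h0 : 0 ≤ Real.log (-2 * Real.log (bandwidth c)) := Real.log_nonneg (by linarith)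
  have h1 := order_le hc0 hn
  have h2 : -2 * (n : ℝ) * Real.log (bandwidth c) = n * (-2 * Real.log (bandwidth c)) := by ring
  rw [h2, Real.log_mul (by positivity) (by linarith)] at h1
  have h3 : Real.log n ≤ Real.log M := Real.log_le_log (by linarith) hnM
  nlinarith

/-- In logarithms: `2(l+1) ≥ log(2n |log h|) ≥ log(2n)`, and `|log h| ≥ 1`. -/
theorem bandwidth_pow_order_le (hc0 : 0 < c) (hn : 1 ≤ n) :
    (bandwidth c ^ (order c n + 1)) ^ 2 ≤ 1 / (2 * n) := by
  have hL := one_le_neg_log_bandwidth hc0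
  have hh := bandwidth_pos hc0
  have hn' : (1 : ℝ) ≤ n := by exact_mod_cast hn
  have h1 := le_order c n
  have hpos : 0 < -2 * (n : ℝ) * Real.log (bandwidth c) := by nlinarith
  rw [← pow_mul, ← Real.log_le_log_iff (by positivity) (by positivity), Real.log_pow,
    Real.log_div one_ne_zero (by positivity), Real.log_one, zero_sub]
  have h2 : Real.log (2 * n) ≤ Real.log (-2 * (n : ℝ) * Real.log (bandwidth c)) :=
    Real.log_le_log (by positivity) (by nlinarith)
  push_cast
  have h3 : (0 : ℝ) ≤ order c n := Nat.cast_nonneg _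
  nlinarith

/-- The factor `2^(l+1)` gained from interpolation absorbs `l + 2`, leaving the power of the
bandwidth. -/
theorem biasBound_sq_le (hc0 : 0 < c) (hn : 1 ≤ n) (lo B : ℝ) :
    biasBound c lo B (order c n) ^ 2 ≤ (2 * B / (lo * c)) ^ 2 * (1 / (2 * n)) := by
  have h1 : ((order c n : ℝ) + 2) ≤ 2 ^ (order c n + 1) := by
    have : order c n + 2 ≤ 2 ^ (order c n + 1) := Nat.lt_two_pow_self (n := order c n + 1)
    exact_mod_cast this
  have h2 : ((order c n : ℝ) + 2) / 2 ^ (order c n + 1) ≤ 1 := by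
    rw [div_le_one (by positivity)]; exact h1
  have h3 : biasBound c lo B (order c n) ^ 2 = (2 * B / (lo * c)) ^ 2 *
      ((((order c n : ℝ) + 2) / 2 ^ (order c n + 1)) ^ 2 *
        (bandwidth c ^ (order c n + 1)) ^ 2) := by
    unfold biasBound
    rw [div_pow (bandwidth c)]
    ring
  rw [h3]
  refine mul_le_mul_of_nonneg_left ?_ (sq_nonneg _)
  calc _ ≤ 1 * (bandwidth c ^ (order c n + 1)) ^ 2 := by
        refine mul_le_mul_of_nonneg_right ?_ (sq_nonneg _)
        exact pow_le_one₀ (by positivity) h2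
    _ ≤ _ := by rw [one_mul]; exact bandwidth_pow_order_le hc0 hn

end order

/-! ### Balance of bias and variance -/

/-- The constant in the bound for the mean integrated squared error. -/
noncomputable def densityConst (c lo hi B : ℝ) : ℝ :=
  ((2 * (hi / (lo * c)) / bandwidth c + 2 * (2 * B / (lo * c)) ^ 2) * (c + 4 * bandwidth c) +
      (2 * B / (lo * c)) ^ 2 * c) *
    (2 + Real.log (-2 * Real.log (bandwidth c))) * (2 * (1 + lo * c) / (lo * c))

theorem densityConst_pos {c lo hi B : ℝ} (hc0 : 0 < c) (hlo : 0 < lo) (hhi : lo ≤ hi) :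
    0 < densityConst c lo hi B := by
  have hh := bandwidth_pos hc0
  have hL := one_le_neg_log_bandwidth hc0
  have h0 : 0 ≤ Real.log (-2 * Real.log (bandwidth c)) := Real.log_nonneg (by linarith)
  have : 0 < hi := by linarith
  unfold densityConst
  positivity

/-- Variance and squared bias are both `O(1/n)`, the trace factor `l + 1` is `O(log M)`, and `n` is
at least a fixed fraction of `M`. -/
theorem densityBound_le {c lo hi B : ℝ} (hc0 : 0 < c) (hlo : 0 < lo) (hhi : lo ≤ hi) {n : ℕ}
    {M : ℝ} (hM : 1 ≤ Real.log M) (hM0 : 0 < M) (hnM : (n : ℝ) ≤ M)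
    (hn : lo * c / (1 + lo * c) * M / 2 ≤ n) :
    (2 * (hi / (lo * c)) / bandwidth c / n + 4 * biasBound c lo B (order c n) ^ 2) *
        ((c + 4 * bandwidth c) * (order c n + 1)) + 2 * biasBound c lo B (order c n) ^ 2 * c ≤
      densityConst c lo hi B * (Real.log M / M) := by
  have hh := bandwidth_pos hc0
  have hL := one_le_neg_log_bandwidth hc0
  have h0 : 0 ≤ Real.log (-2 * Real.log (bandwidth c)) := Real.log_nonneg (by linarith)
  have hhi0 : 0 < hi := by linarith
  have hlc : 0 < lo * c := mul_pos hlo hc0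
  have hn0 : (0 : ℝ) < n := lt_of_lt_of_le (by positivity) hn
  have hn1 : 1 ≤ n := by exact_mod_cast hn0
  have hδ := biasBound_sq_le hc0 hn1 lo B
  have hl := order_add_one_le hc0 hn1 hnM hM
  have hl0 : (0 : ℝ) ≤ order c n := Nat.cast_nonneg _
  set δ2 := biasBound c lo B (order c n) ^ 2
  set A2 := (2 * B / (lo * c)) ^ 2 with hA2
  have hA20 : 0 ≤ A2 := sq_nonneg _
  set l1 := (order c n : ℝ) + 1 with hl1
  have hl11 : 1 ≤ l1 := by linarith
  set F := 2 * (hi / (lo * c)) / bandwidth c with hF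
  have hF0 : 0 < F := by positivity
  set W := c + 4 * bandwidth c with hW
  have hW0 : 0 < W := by positivity
  set R := 2 + Real.log (-2 * Real.log (bandwidth c)) with hR
  have hninv : 1 / (n : ℝ) ≤ 2 * (1 + lo * c) / (lo * c) * (1 / M) := by
    rw [div_mul_div_comm, mul_one, div_le_div_iff₀ hn0 (by positivity)]
    have : lo * c / (1 + lo * c) * M / 2 * (2 * (1 + lo * c)) = lo * c * M := by
      field_simp
    nlinarith [mul_le_mul_of_nonneg_right hn (by positivity : 0 ≤ 2 * (1 + lo * c))]
  calc (F / n + 4 * δ2) * (W * l1) + 2 * δ2 * c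
      ≤ (F / n + 4 * (A2 * (1 / (2 * n)))) * (W * l1) + 2 * (A2 * (1 / (2 * n))) * c := by
        gcongr
    _ = ((F + 2 * A2) * W * l1 + A2 * c) * (1 / n) := by field_simp; ring
    _ ≤ ((F + 2 * A2) * W * l1 + A2 * c * l1) * (1 / n) := by
        exact mul_le_mul_of_nonneg_right (add_le_add le_rfl
          (le_mul_of_one_le_right (by positivity) hl11)) (by positivity)
    _ = ((F + 2 * A2) * W + A2 * c) * l1 * (1 / n) := by ring
    _ ≤ ((F + 2 * A2) * W + A2 * c) * (R * Real.log M) *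
        (2 * (1 + lo * c) / (lo * c) * (1 / M)) := by
        gcongr
    _ = densityConst c lo hi B * (Real.log M / M) := by
        rw [densityConst, ← hF, ← hA2, ← hW, ← hR]
        ring

/-! ### Counts -/

section counts

variable {M : ℕ}

theorem numNone_add_numSold (d : Fin M → Outcome) : numNone d + numSold d = M := by
  have h := Finset.card_filter_add_card_filter_not (s := (Finset.univ : Finset (Fin M)))
    (fun m => (d m).isLeft = true)
  have h2 : numNone d = (Finset.univ.filter fun m => ¬ (d m).isLeft = true).card := by
    unfold numNone
    congr 1
    ext m
    cases d m <;> simp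
  have h3 : (Finset.univ : Finset (Fin M)).card = M := by simp
  rw [h2]
  unfold numSold
  omega

theorem numNone_add_numSold_cast (d : Fin M → Outcome) :
    (numNone d : ℝ) + (numSold d : ℝ) = M := by
  exact_mod_cast numNone_add_numSold d

theorem sumSold_eq (d : Fin M → Outcome) (g : ℝ → ℝ) :
    sumSold d g = ∑ m ∈ Finset.univ.filter (fun m => (d m).isLeft = true), g (product (d m)) := by
  rw [sumSold, Finset.sum_filter]
  refine Finset.sum_congr rfl fun m _ => ?_
  cases d m <;> simp [product]

theorem fHat_eq (c : ℝ) (i : Fin (numTests c)) (d : Fin M → Outcome) (x : ℝ) :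
    fHat c i d x = 1 / (numSold d : ℝ) *
      ∑ m ∈ Finset.univ.filter (fun m => (d m).isLeft = true),
        scaledKernel (bandwidth c) (order c (numSold d)) (leftEnd c i) (rightEnd c i) x
          (product (d m)) := by
  rw [fHat, sumSold_eq]
  unfold scaledKernel dataKernel
  rw [← Finset.sum_div, ← one_div_mul_one_div, mul_assoc, one_div_mul_eq_div (bandwidth c)]

end counts

/-! ### The density estimate on the clean event -/

section exploration

variable {Ω : Type*} [MeasurableSpace Ω] {μ : Measure Ω} {c lo hi B : ℝ} {v : ℝ → ℝ} {M : ℕ}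
  {X : Fin (numTests c) → Fin M → Ω → Outcome}

/-- The purchase patterns of the clean event. -/
def cleanPatterns (v : ℝ → ℝ) (c : ℝ) (M : ℕ) : Set (Fin (numTests c) × Fin M → Bool) :=
  {τ | ∀ i, ((M : ℝ) - (buyers τ i).card) / M ∈ Ioo (p v c i - eps v c i) (p v c i + eps v c i)}

theorem card_buyers_pattern {Ω : Type*} {c : ℝ} {M : ℕ}
    (X : Fin (numTests c) → Fin M → Ω → Outcome) (ω : Ω) (i : Fin (numTests c)) :
    (buyers (pattern X ω) i).card = numSold fun m => X i m ω := rfl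

/-- The event depends on the data only through the pattern, so a bound valid for each clean pattern
carries over to it. -/
theorem cleanEvent_eq {Ω : Type*} {c : ℝ} {M : ℕ} (v : ℝ → ℝ)
    (X : Fin (numTests c) → Fin M → Ω → Outcome) :
    cleanEvent v c X = pattern X ⁻¹' cleanPatterns v c M := by
  ext ω
  simp only [cleanEvent, cleanPatterns, mem_ofPred_eq, mem_preimage, card_buyers_pattern]
  refine forall_congr' fun i => ?_
  rw [← numNone_add_numSold_cast fun m => X i m ω, add_sub_cancel_right]

theorem eps_le_left (v : ℝ → ℝ) (c : ℝ) (i : Fin (numTests c)) : eps v c i ≤ p v c i / 2 := by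
  unfold eps
  linarith [min_le_left (p v c i) (1 - p v c i)]

theorem eps_le_right (v : ℝ → ℝ) (c : ℝ) (i : Fin (numTests c)) :
    eps v c i ≤ (1 - p v c i) / 2 := by
  unfold eps
  linarith [min_le_right (p v c i) (1 - p v c i)]

/-- As `ε ≤ (1 - p)/2`, the purchases are at least half of their expected number. -/
theorem le_card_of_mem_cleanPatterns {τ : Fin (numTests c) × Fin M → Bool}
    (hτ : τ ∈ cleanPatterns v c M) (hM : 0 < M) (i : Fin (numTests c)) :
    (1 - p v c i) * M / 2 ≤ (buyers τ i).card := by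
  have h := (hτ i).2
  have hM' : (0 : ℝ) < M := by exact_mod_cast hM
  rw [div_lt_iff₀ hM'] at h
  nlinarith [eps_le_right v c i]

/-- Mean integrated squared error of the density estimate on the clean event. -/
theorem IsExploration.lintegral_density_sub_fHat_le (hX : IsExploration μ c v M X)
    [IsProbabilityMeasure μ] (hv : IsPreference lo hi B v) (hc0 : 0 < c) (hc1 : c < 1)
    (hlo : 0 < lo) (hM : 1 ≤ Real.log M) (i : Fin (numTests c)) :
    ∫⁻ ω, (∫⁻ x in testAssortment c i, ENNReal.ofReal
        ((density v c i x - fHat c i (fun m => X i m ω) x) ^ 2)) ∂(cond μ (cleanEvent v c X)) ≤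
      ENNReal.ofReal (densityConst c lo hi B * (Real.log M / M)) := by
  rw [cleanEvent_eq]
  refine lintegral_cond_preimage_le hX.measurable_pattern _ _ _ fun τ hτ _ => ?_
  have hM0 : 0 < M := by
    rcases Nat.eq_zero_or_pos M with h | h
    · rw [h] at hM; norm_num at hM
    · exact h
  have hM0' : (0 : ℝ) < M := by exact_mod_cast hM0
  have hcard := le_card_of_mem_cleanPatterns hτ hM0 i
  have hp := hv.le_one_sub_p hc0 hc1 hlo i
  have hlow : lo * c / (1 + lo * c) * M / 2 ≤ (buyers τ i).card := by
    refine le_trans ?_ hcard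
    gcongr
  have hpos : (0 : ℝ) < (buyers τ i).card := by
    refine lt_of_lt_of_le ?_ hlow
    have := mul_pos hlo hc0
    positivity
  have hne : (buyers τ i).Nonempty := Finset.card_pos.1 (by exact_mod_cast hpos)
  have hle : ((buyers τ i).card : ℝ) ≤ M := by
    have := Finset.card_le_univ (buyers τ i)
    rw [Fintype.card_fin] at this
    exact_mod_cast this
  have hmain := hX.lintegral_lintegral_sq_sub_le hv hc0 hc1 hlo τ i hne
    (order c (buyers τ i).card)
  refine (le_of_eq ?_).trans (hmain.trans (ENNReal.ofReal_le_ofReal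
    (densityBound_le hc0 hlo hv.le hM hM0' hle hlow)))
  -- On the conditioning event the random purchase count and kernel order equal those of `τ`.
  refine lintegral_congr_ae ?_
  filter_upwards [ae_cond_mem (μ := μ) (hX.measurable_pattern (measurableSet_singleton τ))]
    with ω hω
  have hω' : pattern X ω = τ := hω
  subst hω'
  refine lintegral_congr fun x => ?_
  rw [fHat_eq]
  rfl

end exploration

end KDEP

namespace KDEP

section exploration

variable {Ω : Type*} [MeasurableSpace Ω] {μ : Measure Ω} {c lo hi B : ℝ} {v : ℝ → ℝ} {M : ℕ}
  {X : Fin (numTests c) → Fin M → Ω → Outcome}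

/-! ### The clean event -/

theorem measurableSet_cleanEvent (hX : IsExploration μ c v M X) :
    MeasurableSet (cleanEvent v c X) := by
  rw [cleanEvent_eq]
  exact hX.measurable_pattern (Set.toFinite _).measurableSet

/-- The interval for `k` is open of length `M min(P, 1 - P)`, so the first integer above its left
end works whenever this length exceeds `1`. -/
theorem exists_count {P ε M : ℝ} (hε : ε = 1 / 2 * min P (1 - P)) (hP0 : 0 < P)
    (hP1 : P < 1) (hM : max (1 / P) (7 / (1 - P)) ≤ M) :
    ∃ k : ℕ, (k : ℝ) ≤ M ∧ (k : ℝ) / M ∈ Ioo (P - ε) (P + ε) := by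
  have h1 : 1 ≤ M * P := by
    have := (le_max_left _ _).trans hM
    rwa [div_le_iff₀ hP0] at this
  have h2 : 7 ≤ M * (1 - P) := by
    have := (le_max_right _ _).trans hM
    rwa [div_le_iff₀ (by linarith)] at this
  have hM0 : 0 < M := by nlinarith
  have hεP : ε ≤ P / 2 := by rw [hε]; linarith [min_le_left P (1 - P)]
  have hεP' : ε ≤ (1 - P) / 2 := by rw [hε]; linarith [min_le_right P (1 - P)]
  have hnn : 0 ≤ M * (P - ε) := mul_nonneg hM0.le (by linarith)
  have hfl := Nat.floor_le hnn
  have hfl2 := Nat.lt_floor_add_one (M * (P - ε))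
  have hlt : ((⌊M * (P - ε)⌋₊ : ℝ) + 1) < M * (P + ε) := by
    rcases le_total P (1 - P) with h | h
    · rw [min_eq_left h] at hε
      -- In the borderline case `M P = 1` the interval is `(1/2, 3/2)` and `k = 1` fits.
      rcases h1.eq_or_lt with h1 | h1
      · have h3 : M * (P - ε) = 1 / 2 := by rw [hε]; linarith
        have h4 : ⌊M * (P - ε)⌋₊ = 0 := by rw [h3]; norm_num
        rw [h4, hε]; push_cast; linarith
      · rw [hε] at hfl ⊢; nlinarith
    · rw [min_eq_right h] at hε
      rw [hε] at hfl ⊢; nlinarith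
  refine ⟨⌊M * (P - ε)⌋₊ + 1, ?_, ?_, ?_⟩
  · push_cast
    nlinarith
  · rw [lt_div_iff₀ hM0]; push_cast; linarith
  · rw [div_lt_iff₀ hM0]; push_cast; linarith

theorem card_filter_val_lt {M k : ℕ} (hk : k ≤ M) :
    (Finset.univ.filter fun m : Fin M => (m : ℕ) < k).card = k := by
  rw [Fin.card_filter_val_lt, min_eq_right hk]

/-- The clean event has positive probability. -/
theorem IsExploration.measure_cleanEvent_ne_zero (hX : IsExploration μ c v M X)
    (hv : IsPreference lo hi B v) (hc0 : 0 < c) (hc1 : c < 1) (hlo : 0 < lo)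
    (hM : ∀ i, minSize v c i ≤ (M : ℝ)) : μ (cleanEvent v c X) ≠ 0 := by
  have hk : ∀ i, ∃ k : ℕ, (k : ℝ) ≤ M ∧
      (k : ℝ) / M ∈ Ioo (p v c i - eps v c i) (p v c i + eps v c i) := fun i =>
    exists_count rfl (hv.p_pos hc0 hc1 hlo i) (hv.p_lt_one hc0 hc1 hlo i) (hM i)
  choose k hk1 hk2 using hk
  have hkM : ∀ i, k i ≤ M := fun i => by exact_mod_cast hk1 i
  -- A witness pattern: in assortment `i` exactly the first `M - k i` customers buy. Every single
  -- pattern has positive probability.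
  let τ : Fin (numTests c) × Fin M → Bool := fun q => decide ((q.2 : ℕ) < M - k q.1)
  have hτ : τ ∈ cleanPatterns v c M := by
    intro i
    have h1 : (buyers τ i).card = M - k i := by
      rw [← card_filter_val_lt (Nat.sub_le M (k i))]
      simp [buyers, τ]
    rw [h1, Nat.cast_sub (hkM i), sub_sub_cancel]
    exact hk2 i
  rw [cleanEvent_eq]
  intro h0
  exact hX.measure_pattern_ne_zero hv hc0 hc1 hlo τ
    (measure_mono_null (preimage_mono (singleton_subset_iff.2 hτ)) h0)

/-! ### Fluctuation of the no-purchase rate -/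

/-- The deviation of the empirical no-purchase rate. -/
noncomputable def deviation (v : ℝ → ℝ) (c : ℝ) (i : Fin (numTests c)) {M : ℕ}
    (d : Fin M → Outcome) : ℝ :=
  p v c i - numNone d / M

theorem numNone_eq_sum {M : ℕ} (d : Fin M → Outcome) :
    (numNone d : ℝ) = ∑ m, if (d m).isLeft = true then (0 : ℝ) else 1 := by
  unfold numNone
  rw [Finset.card_filter]
  push_cast
  refine Finset.sum_congr rfl fun m _ => ?_
  cases d m <;> simp

/-- The rate is an unbiased average of `M` independent indicators, each with second moment at most
`1`. -/
theorem IsExploration.lintegral_deviation_sq_le (hX : IsExploration μ c v M X)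
    [IsProbabilityMeasure μ] (hv : IsPreference lo hi B v) (hc0 : 0 < c) (hc1 : c < 1)
    (hlo : 0 < lo) (hM : 0 < M) (i : Fin (numTests c)) :
    ∫⁻ ω, ENNReal.ofReal (deviation v c i (fun m => X i m ω) ^ 2) ∂μ ≤
      ENNReal.ofReal (1 / M) := by
  let g : Outcome → ℝ := fun o => if o.isLeft = true then (0 : ℝ) else 1
  have hg : Measurable g :=
    Measurable.ite (measurableSet_isLeft true) measurable_const measurable_const
  have hY : ∀ m, Measurable fun ω => g (X i m ω) := fun m => hg.comp (hX.measurable i m)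
  have hmean : ∀ m, ∫ ω, g (X i m ω) ∂μ = p v c i := by
    intro m
    have h1 : (fun ω => g (X i m ω)) =
        ((fun ω => (X i m ω).isLeft) ⁻¹' {false}).indicator fun _ => (1 : ℝ) := by
      ext ω
      simp only [g, indicator, mem_preimage, mem_singleton_iff]
      cases (X i m ω).isLeft <;> simp
    have hms : MeasurableSet ((fun ω => (X i m ω).isLeft) ⁻¹' {false}) :=
      (measurable_isLeft.comp (hX.measurable i m)) (measurableSet_singleton _)
    rw [h1, integral_indicator hms, setIntegral_const, Measure.real,
      hX.measure_isRight (i, m), ENNReal.toReal_ofReal (hv.p_pos hc0 hc1 hlo i).le]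
    simp
  have hbd : ∀ o, ‖g o‖ ≤ 1 := by intro o; simp only [g]; split_ifs <;> simp
  have hsq : ∀ m, ∫ ω, g (X i m ω) ^ 2 ∂μ ≤ 1 := by
    intro m
    have h1 : ∀ ω, g (X i m ω) ^ 2 = g (X i m ω) := by
      intro ω; simp only [g]; split_ifs <;> simp
    simp_rw [h1]
    rw [hmean]
    exact (hv.p_lt_one hc0 hc1 hlo i).le
  have hne : (Finset.univ : Finset (Fin M)).Nonempty := ⟨⟨0, hM⟩, Finset.mem_univ _⟩
  have hind : Set.Pairwise ((Finset.univ : Finset (Fin M)) : Set (Fin M)) fun m m' =>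
      IndepFun (fun ω => g (X i m ω)) (fun ω => g (X i m' ω)) μ := by
    intro m _ m' _ hmm
    have hne' : ((i, m) : Fin (numTests c) × Fin M) ≠ (i, m') := by simpa using hmm
    have h1 : IndepFun (X i m) (X i m') μ := hX.indep.indepFun hne'
    exact h1.comp hg hg
  have h := lintegral_sq_sub_average_le hne (Y := fun m ω => g (X i m ω))
    (fun m _ => MemLp.of_bound (hY m).aestronglyMeasurable 1 (ae_of_all _ fun ω => hbd _))
    hind (p v c i) (fun m _ => hmean m) (fun m _ => hsq m)
  rw [sub_self, Finset.card_univ, Fintype.card_fin] at h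
  refine (le_of_eq ?_).trans (h.trans_eq (by simp))
  refine lintegral_congr fun ω => ?_
  rw [deviation, numNone_eq_sum]
  congr 2
  simp only [g]
  ring

theorem measurable_of_pattern (hX : IsExploration μ c v M X) {E : Type*} [MeasurableSpace E]
    (F : (Fin (numTests c) × Fin M → Bool) → E) : Measurable fun ω => F (pattern X ω) := by
  have : Measurable F := measurable_of_finite F
  exact this.comp hX.measurable_pattern

theorem measurable_numSold (hX : IsExploration μ c v M X) (i : Fin (numTests c)) :
    Measurable fun ω => numSold fun m => X i m ω :=
  measurable_of_pattern hX fun τ => (buyers τ i).card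

theorem numNone_eq_sub {M : ℕ} (d : Fin M → Outcome) : numNone d = M - numSold d := by
  have := numNone_add_numSold d
  omega

theorem measurable_numNone (hX : IsExploration μ c v M X) (i : Fin (numTests c)) :
    Measurable fun ω => numNone fun m => X i m ω := by
  simp_rw [numNone_eq_sub]
  exact (measurable_numSold hX i).const_sub M

theorem measurable_deviation (hX : IsExploration μ c v M X) (i : Fin (numTests c)) :
    Measurable fun ω => deviation v c i fun m => X i m ω := by
  unfold deviation
  have h : Measurable fun ω => ((numNone fun m => X i m ω : ℕ) : ℝ) :=
    measurable_from_top.comp (measurable_numNone hX i)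
  exact (h.div_const _).const_sub _

/-- Cauchy-Schwarz in the form `|z| ≤ 1/(2√M) + (√M/2) z²`, so that the second moment bound can be
integrated directly. -/
theorem IsExploration.lintegral_abs_deviation_le (hX : IsExploration μ c v M X)
    [IsProbabilityMeasure μ] (hv : IsPreference lo hi B v) (hc0 : 0 < c) (hc1 : c < 1)
    (hlo : 0 < lo) (hM : 0 < M) (i : Fin (numTests c)) :
    ∫⁻ ω, ENNReal.ofReal |deviation v c i (fun m => X i m ω)| ∂μ ≤
      ENNReal.ofReal (1 / √(M : ℝ)) := by
  have hM' : (0 : ℝ) < M := by exact_mod_cast hM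
  have hs : 0 < √(M : ℝ) := Real.sqrt_pos.2 hM'
  have hpt : ∀ z : ℝ, ENNReal.ofReal |z| ≤ ENNReal.ofReal (1 / (2 * √(M : ℝ))) +
      ENNReal.ofReal (√(M : ℝ) / 2) * ENNReal.ofReal (z ^ 2) := by
    intro z
    rw [← ENNReal.ofReal_mul (by positivity), ← ENNReal.ofReal_add (by positivity) (by positivity)]
    refine ENNReal.ofReal_le_ofReal ?_
    have h1 : 0 ≤ (1 - √(M : ℝ) * |z|) ^ 2 / (2 * √(M : ℝ)) := by positivity
    have h2 : (1 - √(M : ℝ) * |z|) ^ 2 / (2 * √(M : ℝ)) =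
        1 / (2 * √(M : ℝ)) + √(M : ℝ) / 2 * z ^ 2 - |z| := by
      rw [← sq_abs z]; field_simp; ring
    linarith
  calc ∫⁻ ω, ENNReal.ofReal |deviation v c i (fun m => X i m ω)| ∂μ
      ≤ ∫⁻ ω, (ENNReal.ofReal (1 / (2 * √(M : ℝ))) + ENNReal.ofReal (√(M : ℝ) / 2) *
          ENNReal.ofReal (deviation v c i (fun m => X i m ω) ^ 2)) ∂μ :=
        lintegral_mono fun ω => hpt _
    _ = ENNReal.ofReal (1 / (2 * √(M : ℝ))) + ENNReal.ofReal (√(M : ℝ) / 2) *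
          ∫⁻ ω, ENNReal.ofReal (deviation v c i (fun m => X i m ω) ^ 2) ∂μ := by
        rw [lintegral_add_left measurable_const, lintegral_const_mul' _ _ ENNReal.ofReal_ne_top]
        simp
    _ ≤ ENNReal.ofReal (1 / (2 * √(M : ℝ))) + ENNReal.ofReal (√(M : ℝ) / 2) *
          ENNReal.ofReal (1 / M) := by
        gcongr
        exact hX.lintegral_deviation_sq_le hv hc0 hc1 hlo hM i
    _ = ENNReal.ofReal (1 / √(M : ℝ)) := by
        rw [← ENNReal.ofReal_mul (by positivity),
          ← ENNReal.ofReal_add (by positivity) (by positivity)]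
        congr 1
        have h3 : (M : ℝ) = √(M : ℝ) ^ 2 := (Real.sq_sqrt hM'.le).symm
        set s := √(M : ℝ)
        rw [h3]
        field_simp
        norm_num

/-- A lower bound for the tolerances `ε_i`. -/
noncomputable def minEps (c lo hi : ℝ) : ℝ :=
  1 / 2 * min (1 / (1 + hi * c)) (lo * c / (1 + lo * c))

theorem minEps_pos (hc0 : 0 < c) (hlo : 0 < lo) (hhi : lo ≤ hi) : 0 < minEps c lo hi := by
  have : 0 < hi := by linarith
  unfold minEps
  positivity

theorem IsPreference.minEps_le (hv : IsPreference lo hi B v) (hc0 : 0 < c) (hc1 : c < 1)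
    (hlo : 0 < lo) (i : Fin (numTests c)) : minEps c lo hi ≤ eps v c i := by
  unfold minEps eps
  have := min_le_min (hv.le_p hc0 hc1 hlo i) (hv.le_one_sub_p hc0 hc1 hlo i)
  linarith

/-- For large samples the clean event has probability at least one half. -/
theorem IsExploration.half_le_measure_cleanEvent (hX : IsExploration μ c v M X)
    [IsProbabilityMeasure μ] (hv : IsPreference lo hi B v) (hc0 : 0 < c) (hc1 : c < 1)
    (hlo : 0 < lo) (hM : 0 < M) (hM2 : 2 * numTests c / minEps c lo hi ^ 2 ≤ (M : ℝ)) :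
    2⁻¹ ≤ μ (cleanEvent v c X) := by
  have hM' : (0 : ℝ) < M := by exact_mod_cast hM
  have hε := minEps_pos hc0 hlo hv.le
  set ε := minEps c lo hi
  -- Off the clean event some deviation is at least the uniform tolerance; Markov's inequality for
  -- its square and a union bound follow.
  have hsub : (cleanEvent v c X)ᶜ ⊆ ⋃ i, {ω | ENNReal.ofReal (ε ^ 2) ≤
      ENNReal.ofReal (deviation v c i (fun m => X i m ω) ^ 2)} := by
    intro ω hω
    simp only [cleanEvent, mem_compl_iff, mem_ofPred_eq, not_forall] at hω
    obtain ⟨i, hi⟩ := hω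
    refine mem_iUnion.2 ⟨i, ENNReal.ofReal_le_ofReal ?_⟩
    have h1 : ¬ |deviation v c i (fun m => X i m ω)| < eps v c i := by
      intro h
      apply hi
      rw [abs_lt, deviation] at h
      constructor <;> linarith [h.1, h.2]
    rw [← sq_abs (deviation _ _ _ _)]
    have := (hv.minEps_le hc0 hc1 hlo i).trans (not_lt.1 h1)
    gcongr
  have hone : ∀ i, μ {ω | ENNReal.ofReal (ε ^ 2) ≤
      ENNReal.ofReal (deviation v c i (fun m => X i m ω) ^ 2)} ≤
      ENNReal.ofReal (1 / (M * ε ^ 2)) := by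
    intro i
    have h1 := mul_meas_ge_le_lintegral (μ := μ)
      ((measurable_deviation (v := v) hX i).pow_const 2).ennreal_ofReal (ENNReal.ofReal (ε ^ 2))
    have h2 := h1.trans (hX.lintegral_deviation_sq_le hv hc0 hc1 hlo hM i)
    have h3 : ENNReal.ofReal (1 / (M * ε ^ 2)) =
        ENNReal.ofReal (1 / M) / ENNReal.ofReal (ε ^ 2) := by
      rw [← ENNReal.ofReal_div_of_pos (by positivity), div_div]
    rw [h3, ENNReal.le_div_iff_mul_le (Or.inl (by positivity)) (Or.inl ENNReal.ofReal_ne_top),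
      mul_comm]
    exact h2
  have hcompl : μ (cleanEvent v c X)ᶜ ≤ 2⁻¹ := by
    calc μ (cleanEvent v c X)ᶜ ≤ ∑ i, μ {ω | ENNReal.ofReal (ε ^ 2) ≤
          ENNReal.ofReal (deviation v c i (fun m => X i m ω) ^ 2)} :=
          (measure_mono hsub).trans (measure_iUnion_fintype_le _ _)
      _ ≤ ∑ _i : Fin (numTests c), ENNReal.ofReal (1 / (M * ε ^ 2)) :=
          Finset.sum_le_sum fun i _ => hone i
      _ = ENNReal.ofReal (numTests c * (1 / (M * ε ^ 2))) := by
          rw [Finset.sum_const, Finset.card_univ, Fintype.card_fin, nsmul_eq_mul,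
            ENNReal.ofReal_mul (by positivity), ENNReal.ofReal_natCast]
      _ ≤ ENNReal.ofReal (1 / 2) := by
          refine ENNReal.ofReal_le_ofReal ?_
          rw [div_le_iff₀ (by positivity)] at hM2
          rw [mul_one_div, div_le_div_iff₀ (by positivity) (by norm_num)]
          linarith
      _ = 2⁻¹ := by
          rw [one_div, ENNReal.ofReal_inv_of_pos (by norm_num)]; simp
  have h1 : μ (cleanEvent v c X) + μ (cleanEvent v c X)ᶜ = 1 :=
    prob_add_prob_compl (measurableSet_cleanEvent hX)
  by_contra hlt
  rw [not_le] at hlt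
  have : μ (cleanEvent v c X) + μ (cleanEvent v c X)ᶜ < 2⁻¹ + 2⁻¹ :=
    ENNReal.add_lt_add_of_lt_of_le (ne_top_of_le_ne_top (by simp) hcompl) hlt hcompl
  rw [h1, ENNReal.inv_two_add_inv_two] at this
  exact lt_irrefl _ this

theorem le_numNone_of_mem_cleanEvent {Ω : Type*} {X : Fin (numTests c) → Fin M → Ω → Outcome}
    {ω : Ω} (hω : ω ∈ cleanEvent v c X) (hM : 0 < M)
    (i : Fin (numTests c)) : p v c i * M / 2 ≤ numNone fun m => X i m ω := by
  have hM' : (0 : ℝ) < M := by exact_mod_cast hM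
  have h := (hω i).1
  rw [lt_div_iff₀ hM'] at h
  nlinarith [eps_le_left v c i]

/-! ### The mass estimate -/

/-- On the clean event the estimate of the mass is off by the deviation of the no-purchase rate,
up to a term of order `1 / M`. -/
theorem IsPreference.abs_mass_sub_alphaHat_le {Ω : Type*} {X : Fin (numTests c) → Fin M → Ω → Outcome}
    (hv : IsPreference lo hi B v) (hc0 : 0 < c)
    (hc1 : c < 1) (hlo : 0 < lo) (hM : 0 < M) {ω : Ω} (hω : ω ∈ cleanEvent v c X)
    (i : Fin (numTests c)) :
    |mass v (testAssortment c i) - alphaHat fun m => X i m ω| ≤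
      2 * (1 + hi * c) ^ 2 * (|deviation v c i fun m => X i m ω| + 1 / M) := by
  have hM' : (0 : ℝ) < M := by exact_mod_cast hM
  have hp := hv.p_pos hc0 hc1 hlo i
  have hp1 := hv.p_lt_one hc0 hc1 hlo i
  have he := le_numNone_of_mem_cleanEvent hω hM i
  have hsum := numNone_add_numSold_cast fun m => X i m ω
  have hα : mass v (testAssortment c i) = (1 - p v c i) / p v c i := by
    rw [hv.one_sub_p hc0 hc1 hlo, mul_div_cancel_right₀ _ hp.ne']
  have hple := hv.le_p hc0 hc1 hlo i
  rw [hα]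
  unfold deviation alphaHat
  set P := p v c i
  set e : ℝ := ((numNone fun m => X i m ω : ℕ) : ℝ)
  set n : ℝ := ((numSold fun m => X i m ω : ℕ) : ℝ)
  have he0 : 0 < e := lt_of_lt_of_le (by positivity) he
  have hn : n = M - e := by linarith
  -- Over the common denominator the numerator is the deviation times `M`, up to `1 - P`, which
  -- stems from the `+ 1` in the estimator and produces the `1 / M` term.
  have h1 : (1 - P) / P - n / (e + 1) = -((P - e / M) * M - (1 - P)) / (P * (e + 1)) := by
    rw [hn]; field_simp; ring
  have h2 : |-((P - e / M) * M - (1 - P))| ≤ (|P - e / M| + 1 / M) * M := by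
    rw [abs_neg]
    refine (abs_sub _ _).trans ?_
    rw [abs_mul, abs_of_pos hM', add_mul, one_div_mul_cancel hM'.ne',
      abs_of_pos (by linarith : 0 < 1 - P)]
    linarith
  have hhi : 0 < 1 + hi * c := by
    have := mul_pos hlo hc0
    nlinarith [hv.le]
  have h3 : 1 / P ≤ 1 + hi * c := by
    rw [div_le_iff₀ hhi] at hple
    rw [div_le_iff₀ hp]; linarith
  rw [h1, abs_div, abs_of_pos (by positivity : 0 < P * (e + 1))]
  calc |-((P - e / M) * M - (1 - P))| / (P * (e + 1))
      -- The clean event gives `e ≥ P M / 2`, so the denominator is of order `M`.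
      ≤ (|P - e / M| + 1 / M) * M / (P * (P * M / 2)) := by
        gcongr
        linarith
    _ = 2 * (1 / P) ^ 2 * (|P - e / M| + 1 / M) := by field_simp
    _ ≤ _ := by gcongr

theorem abs_deviation_le_one {Ω : Type*} {X : Fin (numTests c) → Fin M → Ω → Outcome}
    (hv : IsPreference lo hi B v) (hc0 : 0 < c) (hc1 : c < 1)
    (hlo : 0 < lo) {ω : Ω} (hω : ω ∈ cleanEvent v c X) (i : Fin (numTests c)) :
    |deviation v c i fun m => X i m ω| ≤ 1 := by
  have h := hω i
  have h1 := eps_le_right v c i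
  have h2 := hv.p_pos hc0 hc1 hlo i
  rw [abs_le, deviation]
  constructor <;> linarith [h.1, h.2]

/-- The constant in the bound for the estimate of the mass. -/
noncomputable def massConst (c lo hi : ℝ) : ℝ :=
  8 * (1 + hi * c) ^ 2 * (1 + √(2 * numTests c / minEps c lo hi ^ 2))

theorem massConst_pos (hc0 : 0 < c) (hlo : 0 < lo) (hhi : lo ≤ hi) : 0 < massConst c lo hi := by
  have : 0 < hi := by linarith
  unfold massConst
  positivity

theorem lintegral_cond_le_of_le {s : Set Ω} (hs : MeasurableSet s) [IsFiniteMeasure μ]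
    {F : Ω → ENNReal} {b : ENNReal} (h : ∀ ω ∈ s, F ω ≤ b) : ∫⁻ ω, F ω ∂(cond μ s) ≤ b := by
  by_cases h0 : μ s = 0
  · rw [cond_eq_zero_of_meas_eq_zero h0]; simp
  have := cond_isProbabilityMeasure h0
  calc ∫⁻ ω, F ω ∂(cond μ s) ≤ ∫⁻ _, b ∂(cond μ s) := by
        refine lintegral_mono_ae ?_
        filter_upwards [ae_cond_mem (μ := μ) hs] with ω hω using h ω hω
    _ = b := by simp

/-- Mean absolute error of the estimate of the mass on the clean event. -/
theorem IsExploration.lintegral_mass_sub_alphaHat_le (hX : IsExploration μ c v M X)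
    [IsProbabilityMeasure μ] (hv : IsPreference lo hi B v) (hc0 : 0 < c) (hc1 : c < 1)
    (hlo : 0 < lo) (hM : 0 < M) (i : Fin (numTests c)) :
    ∫⁻ ω, ENNReal.ofReal |mass v (testAssortment c i) - alphaHat fun m => X i m ω|
        ∂(cond μ (cleanEvent v c X)) ≤
      ENNReal.ofReal (massConst c lo hi * (1 / √(M : ℝ))) := by
  have hM' : (0 : ℝ) < M := by exact_mod_cast hM
  have hM1 : (1 : ℝ) ≤ M := by exact_mod_cast hM
  have hs : 0 < √(M : ℝ) := Real.sqrt_pos.2 hM'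
  have hsM : 1 / (M : ℝ) ≤ 1 / √(M : ℝ) :=
    one_div_le_one_div_of_le hs (Real.sqrt_le_iff.2 ⟨hM'.le, by nlinarith⟩)
  set M0 := 2 * numTests c / minEps c lo hi ^ 2 with hM0
  have hR : 0 ≤ (1 + hi * c) ^ 2 := sq_nonneg _
  set R := (1 + hi * c) ^ 2 with hRdef
  have hEm := measurableSet_cleanEvent hX
  -- Beyond `M0` the clean event has probability at least one half, and conditioning at most doubles
  -- the integral.
  rcases le_or_gt M0 (M : ℝ) with hcase | hcase
  · have hhalf := hX.half_le_measure_cleanEvent hv hc0 hc1 hlo hM hcase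
    have hint : ∫⁻ ω in cleanEvent v c X, ENNReal.ofReal
        |mass v (testAssortment c i) - alphaHat fun m => X i m ω| ∂μ ≤
        ENNReal.ofReal (4 * R * (1 / √(M : ℝ))) := by
      calc _ ≤ ∫⁻ ω in cleanEvent v c X, (ENNReal.ofReal (2 * R) * ENNReal.ofReal
            |deviation v c i fun m => X i m ω| + ENNReal.ofReal (2 * R * (1 / M))) ∂μ := by
            refine setLIntegral_mono' hEm fun ω hω => ?_
            rw [← ENNReal.ofReal_mul (by positivity),
              ← ENNReal.ofReal_add (by positivity) (by positivity)]
            refine ENNReal.ofReal_le_ofReal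
              ((hv.abs_mass_sub_alphaHat_le hc0 hc1 hlo hM hω i).trans_eq ?_)
            ring
        _ ≤ ∫⁻ ω, (ENNReal.ofReal (2 * R) * ENNReal.ofReal
            |deviation v c i fun m => X i m ω| + ENNReal.ofReal (2 * R * (1 / M))) ∂μ :=
            setLIntegral_le_lintegral _ _
        _ = ENNReal.ofReal (2 * R) * (∫⁻ ω, ENNReal.ofReal
            |deviation v c i fun m => X i m ω| ∂μ) + ENNReal.ofReal (2 * R * (1 / M)) := by
            rw [lintegral_add_right _ measurable_const,
              lintegral_const_mul' _ _ ENNReal.ofReal_ne_top]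
            simp
        _ ≤ ENNReal.ofReal (2 * R) * ENNReal.ofReal (1 / √(M : ℝ)) +
            ENNReal.ofReal (2 * R * (1 / M)) := by
            gcongr
            exact hX.lintegral_abs_deviation_le hv hc0 hc1 hlo hM i
        _ ≤ ENNReal.ofReal (4 * R * (1 / √(M : ℝ))) := by
            rw [← ENNReal.ofReal_mul (by positivity),
              ← ENNReal.ofReal_add (by positivity) (by positivity)]
            refine ENNReal.ofReal_le_ofReal ?_
            nlinarith [mul_le_mul_of_nonneg_left hsM hR]
    rw [ProbabilityTheory.cond, lintegral_smul_measure, smul_eq_mul]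
    calc _ ≤ 2 * ENNReal.ofReal (4 * R * (1 / √(M : ℝ))) := by
          refine mul_le_mul' ?_ hint
          rw [ENNReal.inv_le_iff_inv_le]
          exact hhalf
      _ = ENNReal.ofReal (8 * R * (1 / √(M : ℝ))) := by
          rw [← ENNReal.ofReal_ofNat 2, ← ENNReal.ofReal_mul (by norm_num)]
          congr 1; ring
      _ ≤ _ := by
          refine ENNReal.ofReal_le_ofReal ?_
          rw [massConst, ← hM0, ← hRdef]
          refine mul_le_mul_of_nonneg_right ?_ (by positivity)
          have := Real.sqrt_nonneg M0
          nlinarith [mul_nonneg hR this]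
  · refine lintegral_cond_le_of_le hEm fun ω hω => ENNReal.ofReal_le_ofReal ?_
    refine (hv.abs_mass_sub_alphaHat_le hc0 hc1 hlo hM hω i).trans ?_
    have h1 := abs_deviation_le_one hv hc0 hc1 hlo hω i
    have h2 : 1 / (M : ℝ) ≤ 1 := by rw [div_le_one hM']; exact hM1
    -- Below `M0` the error is bounded by a constant on the clean event, and `√(M0 / M) ≥ 1`
    -- supplies the required rate; this accounts for the square root in `massConst`.
    have h3 : 1 ≤ √M0 * (1 / √(M : ℝ)) := by
      rw [mul_one_div, one_le_div hs]
      exact Real.sqrt_le_sqrt hcase.le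
    have h4 : 0 ≤ 1 / √(M : ℝ) := by positivity
    rw [massConst, ← hM0, ← hRdef]
    calc 2 * R * (|deviation v c i fun m => X i m ω| + 1 / M) ≤ 2 * R * (1 + 1) := by gcongr
      _ ≤ 8 * R * 1 := by linarith
      _ ≤ 8 * R * ((1 + √M0) * (1 / √(M : ℝ))) := by
          gcongr
          linarith
      _ = _ := by ring

end exploration

end KDEP

namespace KDEP

/-! ### The estimate of the preference function -/

section exploration

variable {Ω : Type*} [MeasurableSpace Ω] {μ : Measure Ω} {c lo hi B : ℝ} {v : ℝ → ℝ} {M : ℕ}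
  {X : Fin (numTests c) → Fin M → Ω → Outcome}

/-- The kernel order depends on the random count, so the count is treated as a coordinate in a
countable space. -/
theorem measurable_average_uncurry {β : Type*} [MeasurableSpace β] {f : ℕ → ℝ → ℝ → ℝ}
    (hf : ∀ n, Measurable fun z : ℝ × ℝ => f n z.1 z.2) {N : β → ℕ} (hN : Measurable N)
    {D : Fin M → β → Outcome} (hD : ∀ m, Measurable (D m)) :
    Measurable fun z : β × ℝ => 1 / (N z.1 : ℝ) *
      ∑ m, if (D m z.1).isLeft = true then f (N z.1) z.2 (product (D m z.1)) else 0 := by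
  have hn : Measurable fun z : β × ℝ => N z.1 := hN.comp measurable_fst
  have hf' : Measurable fun y : ℕ × (ℝ × ℝ) => f y.1 y.2.1 y.2.2 :=
    measurable_from_prod_countable_right hf
  refine Measurable.mul ?_ (Finset.measurable_sum _ fun m _ => Measurable.ite ?_ ?_ measurable_const)
  · exact ((measurable_from_top (f := fun n : ℕ => (n : ℝ))).comp hn).const_div 1
  · exact (measurable_isLeft.comp ((hD m).comp measurable_fst)) (measurableSet_singleton true)
  · have h1 : Measurable fun z : β × ℝ => product (D m z.1) :=
      measurable_product.comp ((hD m).comp measurable_fst)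
    exact hf'.comp (hn.prodMk (measurable_snd.prodMk h1))

theorem measurable_fHat_uncurry (hX : IsExploration μ c v M X) (i : Fin (numTests c)) :
    Measurable fun z : Ω × ℝ => fHat c i (fun m => X i m z.1) z.2 := by
  have h := measurable_average_uncurry
    (f := fun n => scaledKernel (bandwidth c) (order c n) (leftEnd c i) (rightEnd c i))
    (fun n => measurable_scaledKernel _ _ _ _) (measurable_numSold hX i) (hX.measurable i)
  convert h using 2 with z
  rw [fHat_eq, Finset.sum_filter]

theorem measurable_fHat (c : ℝ) (i : Fin (numTests c)) {M : ℕ} (d : Fin M → Outcome) :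
    Measurable (fHat c i d) := by
  have h : fHat c i d = fun x => 1 / (numSold d : ℝ) *
      ∑ m ∈ Finset.univ.filter (fun m => (d m).isLeft = true),
        scaledKernel (bandwidth c) (order c (numSold d)) (leftEnd c i) (rightEnd c i) x
          (product (d m)) := funext fun x => fHat_eq c i d x
  rw [h]
  have hk := measurable_scaledKernel (bandwidth c) (order c (numSold d)) (leftEnd c i)
    (rightEnd c i)
  generalize scaledKernel (bandwidth c) (order c (numSold d)) (leftEnd c i) (rightEnd c i) = f
    at *
  exact measurable_const.mul (Finset.measurable_sum _ fun m _ =>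
    hk.comp (measurable_id.prodMk measurable_const))

theorem vHatPart_eq (c : ℝ) (i : Fin (numTests c)) {M : ℕ} (d : Fin M → Outcome) {x : ℝ}
    (hx : x ∈ testAssortment c i) : vHatPart c i d x = alphaHat d * fHat c i d x := by
  rw [vHatPart, if_pos hx, alphaHat, fHat]
  -- Without purchases both sides vanish; otherwise the number of purchases cancels.
  by_cases h0 : numSold d = 0
  · have h1 : sumSold d (fun y => dataKernel c i d x ((y - x) / bandwidth c)) = 0 := by
      rw [sumSold_eq, Finset.card_eq_zero.1 h0, Finset.sum_empty]
    rw [h1]; simp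
  · have hn : (numSold d : ℝ) ≠ 0 := by exact_mod_cast h0
    rw [← one_div_mul_one_div, ← one_div_mul_one_div]
    field_simp

theorem aemeasurable_lintegral_fHat (hX : IsExploration μ c v M X)
    (hv : IsPreference lo hi B v) (hc0 : 0 < c) (hc1 : c < 1) (i : Fin (numTests c))
    (ν : Measure Ω) [SFinite ν] :
    AEMeasurable (fun ω => ∫⁻ x in testAssortment c i, ENNReal.ofReal
      ((density v c i x - fHat c i (fun m => X i m ω) x) ^ 2)) ν := by
  have h1 : AEMeasurable (fun z : Ω × ℝ => density v c i z.2)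
      (ν.prod (volume.restrict (testAssortment c i))) :=
    (hv.aemeasurable_density hc0 hc1 i).comp_snd
  have h2 := ((h1.sub (measurable_fHat_uncurry hX i).aemeasurable).pow_const 2).ennreal_ofReal
  exact h2.lintegral_prod_right'

theorem measurable_alphaHat (hX : IsExploration μ c v M X) (i : Fin (numTests c)) :
    Measurable fun ω => alphaHat fun m => X i m ω := by
  have hcast := measurable_from_top (f := fun n : ℕ => (n : ℝ))
  exact (hcast.comp (measurable_numSold hX i)).div
    ((hcast.comp (measurable_numNone hX i)).add_const 1)

/-- The estimate is the average over the test assortments that contain a product. -/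
theorem abs_sub_vHat_le (hc0 : 0 < c) (hc1 : c < 1) {M : ℕ}
    (D : Fin (numTests c) → Fin M → Outcome) (v : ℝ → ℝ) {x : ℝ} (hx : x ∈ Icc (0 : ℝ) 1) :
    |v x - vHat c D x| ≤ ∑ i, (testAssortment c i).indicator
      (fun x => |v x - alphaHat (D i) * fHat c i (D i) x|) x := by
  classical
  set s := Finset.univ.filter fun i => x ∈ testAssortment c i with hs
  have hcov : cover c x = s.card := by
    unfold cover
    rw [hs]
  have hpos : 1 ≤ s.card := by
    obtain ⟨i, hi⟩ := exists_mem_testAssortment hc0 hc1 hx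
    exact Finset.card_pos.2 ⟨i, by simp [hs, hi]⟩
  have hpos' : (1 : ℝ) ≤ s.card := by exact_mod_cast hpos
  have hsum : ∑ i, vHatPart c i (D i) x = ∑ i ∈ s, alphaHat (D i) * fHat c i (D i) x := by
    rw [hs, Finset.sum_filter]
    refine Finset.sum_congr rfl fun i _ => ?_
    split_ifs with h
    · exact vHatPart_eq c i (D i) h
    · rw [vHatPart, if_neg h]
  have hdiff : v x - vHat c D x =
      1 / (s.card : ℝ) * ∑ i ∈ s, (v x - alphaHat (D i) * fHat c i (D i) x) := by
    rw [vHat, hcov, hsum, Finset.sum_sub_distrib, Finset.sum_const, nsmul_eq_mul]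
    field_simp
  rw [hdiff, abs_mul, abs_of_pos (by positivity)]
  calc 1 / (s.card : ℝ) * |∑ i ∈ s, (v x - alphaHat (D i) * fHat c i (D i) x)|
      ≤ 1 * ∑ i ∈ s, |v x - alphaHat (D i) * fHat c i (D i) x| := by
        -- Only `1 / k(x) ≤ 1` is used, so the average is bounded by the sum.
        refine mul_le_mul ?_ (Finset.abs_sum_le_sum_abs _ _) (abs_nonneg _) zero_le_one
        rw [div_le_one (by linarith)]; exact hpos'
    _ = _ := by
        rw [one_mul, hs, Finset.sum_filter]
        refine Finset.sum_congr rfl fun i _ => ?_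
        rw [indicator_apply]

/-- Error of the estimate of `v` on a test assortment for given data. -/
theorem IsPreference.lintegral_abs_sub_le (hv : IsPreference lo hi B v) (hc0 : 0 < c)
    (hc1 : c < 1) (hlo : 0 < lo) (i : Fin (numTests c)) {M : ℕ} (d : Fin M → Outcome) {K t : ℝ}
    (hK : alphaHat d ≤ K) (ht : 0 < t) :
    ∫⁻ x in testAssortment c i, ENNReal.ofReal |v x - alphaHat d * fHat c i d x| ≤
      ENNReal.ofReal |mass v (testAssortment c i) - alphaHat d| +
        (ENNReal.ofReal (K * (t / 2 * c)) + ENNReal.ofReal (K / (2 * t)) *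
          ∫⁻ x in testAssortment c i, ENNReal.ofReal ((density v c i x - fHat c i d x) ^ 2)) := by
  set α := mass v (testAssortment c i) with hα
  have hα0 : 0 < α := hv.mass_pos hc0 hc1 hlo i
  have ha0 : 0 ≤ alphaHat d := by unfold alphaHat; positivity
  have hK0 : 0 ≤ K := ha0.trans hK
  set a := alphaHat d
  have hpt : ∀ x ∈ testAssortment c i, ENNReal.ofReal |v x - a * fHat c i d x| ≤
      ENNReal.ofReal |α - a| * ENNReal.ofReal (density v c i x) +
        (ENNReal.ofReal (K * (t / 2)) + ENNReal.ofReal (K / (2 * t)) *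
          ENNReal.ofReal ((density v c i x - fHat c i d x) ^ 2)) := by
    intro x hx
    have hρ := hv.density_nonneg hc0 hc1 hlo i hx
    have hvx : v x = α * density v c i x := by
      rw [density, ← hα]; field_simp
    rw [← ENNReal.ofReal_mul (abs_nonneg _), ← ENNReal.ofReal_mul (by positivity),
      ← ENNReal.ofReal_add (by positivity) (by positivity),
      ← ENNReal.ofReal_add (by positivity) (by positivity)]
    refine ENNReal.ofReal_le_ofReal ?_
    set ρ := density v c i x
    set f := fHat c i d x
    -- One part carries the mass error and the density, which integrates to `1`; the other carries
    -- the density error.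
    have h1 : v x - a * f = (α - a) * ρ + a * (ρ - f) := by rw [hvx]; ring
    -- Young's inequality with a free parameter `t`, to be fixed as the target rate.
    have h2 : |ρ - f| ≤ t / 2 + 1 / (2 * t) * (ρ - f) ^ 2 := by
      have h3 : 0 ≤ (t - |ρ - f|) ^ 2 / (2 * t) := by positivity
      have h4 : (t - |ρ - f|) ^ 2 / (2 * t) =
          t / 2 + 1 / (2 * t) * (ρ - f) ^ 2 - |ρ - f| := by
        rw [← sq_abs (ρ - f)]; field_simp; ring
      linarith
    rw [h1]
    refine (abs_add_le _ _).trans ?_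
    rw [abs_mul, abs_mul, abs_of_nonneg hρ, abs_of_nonneg ha0]
    refine add_le_add le_rfl ?_
    calc a * |ρ - f| ≤ K * (t / 2 + 1 / (2 * t) * (ρ - f) ^ 2) :=
          mul_le_mul hK h2 (abs_nonneg _) hK0
      _ = _ := by ring
  have hmρ := (hv.aemeasurable_density hc0 hc1 i).ennreal_ofReal
  have hρ1 : ∫⁻ x in testAssortment c i, ENNReal.ofReal (density v c i x) = 1 := by
    rw [← ofReal_integral_eq_lintegral_ofReal (hv.integrableOn_density hc0 hc1 i)
      ((ae_restrict_iff' (measurableSet_testAssortment i)).2 (ae_of_all _ fun x hx =>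
        hv.density_nonneg hc0 hc1 hlo i hx)), hv.integral_density hc0 hc1 hlo]
    simp
  refine (setLIntegral_mono' (measurableSet_testAssortment i) hpt).trans_eq ?_
  rw [lintegral_add_left' (hmρ.const_mul _), lintegral_const_mul' _ _ ENNReal.ofReal_ne_top,
    hρ1, mul_one, lintegral_add_left measurable_const,
    lintegral_const_mul' _ _ ENNReal.ofReal_ne_top, setLIntegral_const, volume_testAssortment,
    ← ENNReal.ofReal_mul (by positivity), mul_assoc]

theorem IsPreference.lintegral_abs_sub_vHat_le (hv : IsPreference lo hi B v) (hc0 : 0 < c)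
    (hc1 : c < 1) {M : ℕ} (D : Fin (numTests c) → Fin M → Outcome) :
    ∫⁻ x in Icc (0 : ℝ) 1, ENNReal.ofReal |v x - vHat c D x| ≤
      ∑ i, ∫⁻ x in testAssortment c i, ENNReal.ofReal |v x - alphaHat (D i) * fHat c i (D i) x| := by
  have hm : ∀ i, AEMeasurable (fun x => (testAssortment c i).indicator
      (fun x => ENNReal.ofReal |v x - alphaHat (D i) * fHat c i (D i) x|) x)
      (volume.restrict (Icc (0 : ℝ) 1)) := by
    intro i
    have h1 : AEMeasurable v (volume.restrict (Icc (0 : ℝ) 1)) := hv.aemeasurable le_rfl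
    have h2 : AEMeasurable (fun x => alphaHat (D i) * fHat c i (D i) x)
      (volume.restrict (Icc (0 : ℝ) 1)) := ((measurable_fHat c i (D i)).const_mul _).aemeasurable
    have h3 : AEMeasurable (fun x => |v x - alphaHat (D i) * fHat c i (D i) x|)
      (volume.restrict (Icc (0 : ℝ) 1)) := continuous_abs.measurable.comp_aemeasurable (h1.sub h2)
    exact h3.ennreal_ofReal.indicator (measurableSet_testAssortment i)
  calc _ ≤ ∫⁻ x in Icc (0 : ℝ) 1, ∑ i, (testAssortment c i).indicator
        (fun x => ENNReal.ofReal |v x - alphaHat (D i) * fHat c i (D i) x|) x := by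
        refine setLIntegral_mono' measurableSet_Icc fun x hx => ?_
        refine (ENNReal.ofReal_le_ofReal (abs_sub_vHat_le hc0 hc1 D v hx)).trans_eq ?_
        rw [ENNReal.ofReal_sum_of_nonneg fun i _ => indicator_nonneg (fun _ _ => abs_nonneg _) _]
        refine Finset.sum_congr rfl fun i _ => ?_
        by_cases h : x ∈ testAssortment c i
        · simp only [indicator_of_mem h]
        · simp only [indicator_of_notMem h, ENNReal.ofReal_zero]
    _ = ∑ i, ∫⁻ x in Icc (0 : ℝ) 1, (testAssortment c i).indicator
        (fun x => ENNReal.ofReal |v x - alphaHat (D i) * fHat c i (D i) x|) x :=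
        lintegral_finsetSum' _ fun i _ => hm i
    _ = _ := by
        refine Finset.sum_congr rfl fun i _ => ?_
        rw [setLIntegral_indicator (measurableSet_testAssortment i),
          inter_eq_self_of_subset_left (testAssortment_subset hc0 hc1 i)]

/-- The clean event gives at least `p M / 2` no-purchases, so the ratio is at most `2 / p`. -/
theorem IsPreference.alphaHat_le {Ω : Type*} {X : Fin (numTests c) → Fin M → Ω → Outcome}
    (hv : IsPreference lo hi B v) (hc0 : 0 < c)
    (hc1 : c < 1) (hlo : 0 < lo) (hM : 0 < M) {ω : Ω} (hω : ω ∈ cleanEvent v c X)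
    (i : Fin (numTests c)) : alphaHat (fun m => X i m ω) ≤ 2 * (1 + hi * c) := by
  have hM' : (0 : ℝ) < M := by exact_mod_cast hM
  have he := le_numNone_of_mem_cleanEvent hω hM i
  have hsum := numNone_add_numSold_cast fun m => X i m ω
  have hple := hv.le_p hc0 hc1 hlo i
  have hhi : 0 < 1 + hi * c := by
    have := mul_pos hlo hc0
    nlinarith [hv.le]
  rw [div_le_iff₀ hhi] at hple
  unfold alphaHat
  rw [div_le_iff₀ (by positivity)]
  have h1 := mul_le_mul_of_nonneg_left he (by positivity : 0 ≤ 2 * (1 + hi * c))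
  have h2 : 2 * (1 + hi * c) * (p v c i * M / 2) = p v c i * (1 + hi * c) * M := by ring
  have h3 : (0 : ℝ) ≤ ((numNone fun m => X i m ω : ℕ) : ℝ) := Nat.cast_nonneg _
  nlinarith

/-- The constant in the bound for the estimate of the preference function. -/
noncomputable def preferenceConst (c lo hi B : ℝ) : ℝ :=
  numTests c * (massConst c lo hi +
    ((1 + hi * c) * c + (1 + hi * c) * densityConst c lo hi B))

theorem preferenceConst_pos (hc0 : 0 < c) (hc1 : c < 1) (hlo : 0 < lo) (hhi : lo ≤ hi) :
    0 < preferenceConst c lo hi B := by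
  have h1 := massConst_pos hc0 hlo hhi
  have h2 := densityConst_pos (B := B) hc0 hlo hhi
  have h3 : 0 < numTests c := by have := two_le_numTests hc0 hc1; omega
  have h4 : 0 < hi := by linarith
  unfold preferenceConst
  positivity

/-- Mean integrated absolute error of the estimate of the preference function. -/
theorem IsExploration.lintegral_sub_vHat_le (hX : IsExploration μ c v M X)
    [IsProbabilityMeasure μ] (hv : IsPreference lo hi B v) (hc0 : 0 < c) (hc1 : c < 1)
    (hlo : 0 < lo) (hM : 1 ≤ Real.log M) (hE : μ (cleanEvent v c X) ≠ 0) :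
    ∫⁻ ω, (∫⁻ x in Icc (0 : ℝ) 1, ENNReal.ofReal |v x - vHat c (fun i m => X i m ω) x|)
        ∂(cond μ (cleanEvent v c X)) ≤
      ENNReal.ofReal (preferenceConst c lo hi B *
        (Real.log M ^ (1 / 2 : ℝ) / (M : ℝ) ^ (1 / 2 : ℝ))) := by
  have hM0 : 0 < M := by
    rcases Nat.eq_zero_or_pos M with h | h
    · rw [h] at hM; norm_num at hM
    · exact h
  have hM' : (0 : ℝ) < M := by exact_mod_cast hM0
  have hlog : 0 < Real.log M := by linarith
  have hprob := cond_isProbabilityMeasure hE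
  set ν := cond μ (cleanEvent v c X) with hν
  rw [← Real.sqrt_eq_rpow, ← Real.sqrt_eq_rpow]
  -- With the target rate as parameter, both terms of Young's inequality are of order `t`, because
  -- the integrated squared error is of order `t²`.
  set t := √(Real.log M) / √(M : ℝ) with ht
  have ht0 : 0 < t := div_pos (Real.sqrt_pos.2 hlog) (Real.sqrt_pos.2 hM')
  have ht2 : Real.log M / M = t ^ 2 := by
    rw [ht, div_pow, Real.sq_sqrt hlog.le, Real.sq_sqrt hM'.le]
  have hst : 1 / √(M : ℝ) ≤ t := by
    rw [ht]
    gcongr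
    exact Real.one_le_sqrt.2 hM
  have hhi : 0 < 1 + hi * c := by
    have := mul_pos hlo hc0
    nlinarith [hv.le]
  have hC1 := massConst_pos hc0 hlo hv.le
  have hC2 := densityConst_pos (B := B) hc0 hlo hv.le
  set K := 2 * (1 + hi * c) with hK
  have hK0 : 0 < K := by positivity
  set Z : Fin (numTests c) → Ω → ENNReal := fun i ω => ∫⁻ x in testAssortment c i,
    ENNReal.ofReal ((density v c i x - fHat c i (fun m => X i m ω) x) ^ 2) with hZ
  set A : Fin (numTests c) → Ω → ENNReal := fun i ω =>
    ENNReal.ofReal |mass v (testAssortment c i) - alphaHat fun m => X i m ω| with hA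
  have hZm : ∀ i, AEMeasurable (Z i) ν := fun i =>
    aemeasurable_lintegral_fHat hX hv hc0 hc1 i ν
  have hAm : ∀ i, Measurable (A i) := fun i =>
    (continuous_abs.measurable.comp ((measurable_alphaHat hX i).const_sub _)).ennreal_ofReal
  have hone : ∀ i, ∫⁻ ω, (A i ω + (ENNReal.ofReal (K * (t / 2 * c)) +
      ENNReal.ofReal (K / (2 * t)) * Z i ω)) ∂ν ≤
      ENNReal.ofReal ((massConst c lo hi + ((1 + hi * c) * c +
        (1 + hi * c) * densityConst c lo hi B)) * t) := by
    intro i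
    rw [lintegral_add_left (hAm i), lintegral_add_left measurable_const,
      lintegral_const_mul' _ _ ENNReal.ofReal_ne_top, lintegral_const, measure_univ, mul_one]
    calc _ ≤ ENNReal.ofReal (massConst c lo hi * (1 / √(M : ℝ))) +
          (ENNReal.ofReal (K * (t / 2 * c)) + ENNReal.ofReal (K / (2 * t)) *
            ENNReal.ofReal (densityConst c lo hi B * (Real.log M / M))) := by
          gcongr
          · exact hX.lintegral_mass_sub_alphaHat_le hv hc0 hc1 hlo hM0 i
          · exact hX.lintegral_density_sub_fHat_le hv hc0 hc1 hlo hM i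
      _ ≤ _ := by
          rw [ht2, ← ENNReal.ofReal_mul (by positivity),
            ← ENNReal.ofReal_add (by positivity) (by positivity),
            ← ENNReal.ofReal_add (by positivity) (by positivity)]
          refine ENNReal.ofReal_le_ofReal ?_
          have h1 : K / (2 * t) * (densityConst c lo hi B * t ^ 2) =
              (1 + hi * c) * densityConst c lo hi B * t := by
            rw [hK]; field_simp
          have h2 := mul_le_mul_of_nonneg_left hst hC1.le
          rw [h1, hK]
          nlinarith
  calc _ ≤ ∫⁻ ω, ∑ i, (A i ω + (ENNReal.ofReal (K * (t / 2 * c)) +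
        ENNReal.ofReal (K / (2 * t)) * Z i ω)) ∂ν := by
        refine lintegral_mono_ae ?_
        filter_upwards [ae_cond_mem (μ := μ) (measurableSet_cleanEvent hX)] with ω hω
        refine (hv.lintegral_abs_sub_vHat_le hc0 hc1 fun i m => X i m ω).trans ?_
        exact Finset.sum_le_sum fun i _ => hv.lintegral_abs_sub_le hc0 hc1 hlo i
          (fun m => X i m ω) (hv.alphaHat_le hc0 hc1 hlo hM0 hω i) ht0
    _ = ∑ i, ∫⁻ ω, (A i ω + (ENNReal.ofReal (K * (t / 2 * c)) +
        ENNReal.ofReal (K / (2 * t)) * Z i ω)) ∂ν :=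
        lintegral_finsetSum' _ fun i _ =>
          (hAm i).aemeasurable.add (((hZm i).const_mul _).const_add _)
    _ ≤ ∑ _i : Fin (numTests c), ENNReal.ofReal ((massConst c lo hi + ((1 + hi * c) * c +
        (1 + hi * c) * densityConst c lo hi B)) * t) := Finset.sum_le_sum fun i _ => hone i
    _ = _ := by
        rw [Finset.sum_const, Finset.card_univ, Fintype.card_fin, nsmul_eq_mul,
          ← ENNReal.ofReal_natCast, ← ENNReal.ofReal_mul (by positivity), preferenceConst]
        congr 1; ring

/-- The minimal sample size is at least `7 > e`; this also excludes `M = 0`. -/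
theorem IsPreference.one_le_log (hv : IsPreference lo hi B v) (hc0 : 0 < c) (hc1 : c < 1)
    (hlo : 0 < lo) {i : Fin (numTests c)} {M : ℝ} (hM : minSize v c i ≤ M) :
    1 ≤ Real.log M := by
  have hp := hv.p_pos hc0 hc1 hlo i
  have hp1 := hv.p_lt_one hc0 hc1 hlo i
  have h1 : 7 / (1 - p v c i) ≤ M := (le_max_right _ _).trans hM
  rw [div_le_iff₀ (by linarith)] at h1
  have h7 : 7 ≤ M := by nlinarith
  rw [Real.le_log_iff_exp_le (by linarith)]
  linarith [Real.exp_one_lt_d9]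

end exploration

end KDEP

/-! ### Assembly of the three bounds -/

/-- The constants depend only on the capacity `c`, on the bounds `lo`, `hi` for the preference
function and on the bound `B` for its derivatives. Expectations of nonnegative random variables
are Lebesgue integrals with values in `[0,∞]`. -/
theorem proposition5 (c lo hi B : ℝ) (hc0 : 0 < c) (hc1 : c < 1) (hlo : 0 < lo) :
    ∃ C₁ C₂ C₃ : ℝ, 0 < C₁ ∧ 0 < C₂ ∧ 0 < C₃ ∧
      ∀ (v : ℝ → ℝ), KDEP.IsPreference lo hi B v →
      ∀ {Ω : Type*} [MeasurableSpace Ω] (μ : Measure Ω) [IsProbabilityMeasure μ] (M : ℕ)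
        (X : Fin (KDEP.numTests c) → Fin M → Ω → KDEP.Outcome),
        KDEP.IsExploration μ c v M X →
        (∀ i, KDEP.minSize v c i ≤ (M : ℝ) →
          ∫⁻ ω, ENNReal.ofReal
              |KDEP.mass v (KDEP.testAssortment c i) - KDEP.alphaHat (fun m => X i m ω)|
              ∂(cond μ (KDEP.cleanEvent v c X))
            ≤ ENNReal.ofReal (C₁ * (1 / √(M : ℝ))) ∧
          ∫⁻ ω, (∫⁻ x in KDEP.testAssortment c i, ENNReal.ofReal
              ((KDEP.density v c i x - KDEP.fHat c i (fun m => X i m ω) x) ^ 2))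
              ∂(cond μ (KDEP.cleanEvent v c X))
            ≤ ENNReal.ofReal (C₂ * (Real.log M / M))) ∧
        ((∀ i, KDEP.minSize v c i ≤ (M : ℝ)) →
          μ (KDEP.cleanEvent v c X) ≠ 0 ∧
          ∫⁻ ω, (∫⁻ x in Icc (0 : ℝ) 1, ENNReal.ofReal
              |v x - KDEP.vHat c (fun i m => X i m ω) x|)
              ∂(cond μ (KDEP.cleanEvent v c X))
            ≤ ENNReal.ofReal (C₃ * ((Real.log M) ^ (1 / 2 : ℝ) / (M : ℝ) ^ (1 / 2 : ℝ)))) := by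
  -- Positivity of the explicit constants needs `lo ≤ hi`, which follows once some preference
  -- function exists; otherwise any constants do.
  by_cases hex : ∃ v, KDEP.IsPreference lo hi B v
  swap
  · exact ⟨1, 1, 1, one_pos, one_pos, one_pos, fun v hv => absurd ⟨v, hv⟩ hex⟩
  obtain ⟨v₀, hv₀⟩ := hex
  refine ⟨KDEP.massConst c lo hi, KDEP.densityConst c lo hi B, KDEP.preferenceConst c lo hi B,
    KDEP.massConst_pos hc0 hlo hv₀.le, KDEP.densityConst_pos hc0 hlo hv₀.le,
    KDEP.preferenceConst_pos hc0 hc1 hlo hv₀.le, ?_⟩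
  intro v hv Ω _ μ _ M X hX
  refine ⟨fun i hM => ?_, fun hM => ?_⟩
  · have hlog := hv.one_le_log hc0 hc1 hlo hM
    have hM0 : 0 < M := by
      rcases Nat.eq_zero_or_pos M with h | h
      · rw [h] at hlog; norm_num at hlog
      · exact h
    exact ⟨hX.lintegral_mass_sub_alphaHat_le hv hc0 hc1 hlo hM0 i,
      hX.lintegral_density_sub_fHat_le hv hc0 hc1 hlo hlog i⟩
  · have hE := hX.measure_cleanEvent_ne_zero hv hc0 hc1 hlo hM
    have hN := KDEP.two_le_numTests hc0 hc1
    exact ⟨hE, hX.lintegral_sub_vHat_le hv hc0 hc1 hlo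
      (hv.one_le_log hc0 hc1 hlo (hM ⟨0, by omega⟩)) hE⟩
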